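/- **Model.** An untrusted transmitter (UT, $N_t$ antennas) serves an untrusted receiver (UR, $N_r$ antennas); $M$ monitoring nodes (MNs, $N$ antennas each) observe ($\alpha_m=1$) or jam ($\alpha_m=0$). In a coherence interval of $\tau$ symbols, $\tau_r$ symbols are used for uplink training and $\tau_t$ for beamforming training ($\tau_t+\tau_r\le\tau$), with orthonormal pilots. The channels $G_{rt}=\sqrt{\beta_{rt}}H_{rt}$ (UT–UR), $G_{mr}=\sqrt{\beta_{mr}}H_{mr}$ (MN–UR), $G_{tm}=\sqrt{\beta_{tm}}H_{tm}$ (UT–MN), $G_{mm'}=\sqrt{\beta_{mm'}}H_{mm'}$ (MN–MN, $G_{mm}=0$) and the training noise have i.i.d. $\mathcal{CN}(0,1)$ small-scale entries. $\hat G_{rt},\hat G_{mr}$ are the uplink MMSE estimates, $W$ is a column-normalized precoder computed from $\hat G_{rt}$, $A_r=G_{rt}^HW$, $B_m=G_{tm}^HW$, $\hat B_m$ is the MMSE estimate of $B_m$ at MN $m$ from the beamforming pilots (computed row by row), and $V_m=\hat B_m(\hat B_m^H\hat B_m+\varrho I)^{-1}$ with $\varrho>0$. In each of the $\tau-\tau_t-\tau_r$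 data symbols, $$y_r=\sqrt{\rho_t}A_r\Lambda_r^{1/2}x+\sqrt{\rho_J}F_r^Jx^J+\omega_r,\qquad z_c=\sum_{m}\alpha_mV_m^H\big(\sqrt{\rho_t}B_m\Lambda_r^{1/2}x+\sqrt{\rho_J}F_m^Jx^J+\omega_m\big)$$ are the signals at the UR and at the CPU, where $$F_r^J=\sum_m(1-\alpha_m)G_{mr}^H\hat G_{mr}\Pi_{mr}^{1/2},\qquad F_m^J=\sum_{m'}(1-\alpha_{m'})G_{mm'}^H\hat G_{m'r}\Pi_{m'r}^{1/2},$$ $\Lambda_r,\Pi_{mr}$ are nonnegative diagonal power matrices and $\rho_t,\rho_J\ge0$ are powers. The data symbols $x$ and the noises $\omega_r,\omega_1,\dots,\omega_M$ have i.i.d. $\mathcal{CN}(0,1)$ entries, also over the data symbols of the interval, and $x^J$ is independent of them with $E\{x^J(x^J)^H\}=I$. The side information $\Theta_r$ (at the UR) and $\Theta_c$ (at the CPU) is arbitrary, except that each of them, jointly with the channels and the training noise, is independent of $(x,x^J,\omega_r,\omega_1,\dots,\omega_M)$ over the interval. **Claim.** Put $D=\sum_m\alpha_mV_m^HB_m\Lambda_r^{1/2}$,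 $$\Psi_r=I+\rho_JE\{F_r^J(F_r^J)^H|\Theta_r\}+\rho_tE\{A_r\Lambda_rA_r^H|\Theta_r\}-\rho_tE\{A_r\Lambda_r^{1/2}|\Theta_r\}E\{A_r\Lambda_r^{1/2}|\Theta_r\}^H,$$ $$\Psi_c=\rho_JE\Big\{\sum_{m,l}\alpha_m\alpha_lV_m^HF_m^J(F_l^J)^HV_l\Big|\Theta_c\Big\}+\rho_tE\{DD^H|\Theta_c\}+E\Big\{\sum_m\alpha_mV_m^HV_m\Big|\Theta_c\Big\}-\rho_tE\{D|\Theta_c\}E\{D^H|\Theta_c\},$$ $$\Upsilon_r=\rho_tE\{\Lambda_r^{1/2}A_r^H|\Theta_r\}\Psi_r^{-1}E\{A_r\Lambda_r^{1/2}|\Theta_r\},\qquad\Upsilon_c=\rho_tE\{D^H|\Theta_c\}\Psi_c^{-1}E\{D|\Theta_c\}.$$ Then $\Psi_r$ is almost surely positive definite and $\Psi_c$ almost surely positive semidefinite ($\Upsilon_c$ is read as $0$ where $\Psi_c$ is singular); if $F_r^J$ is independent of $\Theta_r$, the jamming term of $\Psi_r$ equals $\rho_JE\{F_r^J(F_r^J)^H\}$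 almost surely. For $s\in\{r,c\}$, $\log_2\det(I+\Upsilon_s)$ is integrable and $$\mathrm{SE}_s=\Big(1-\frac{\tau_t+\tau_r}{\tau}\Big)E\{\log_2\det(I+\Upsilon_s)\}$$ is an achievable spectral efficiency with MMSE-SIC, for every decoding order of the $N_r$ streams, at the UR ($s=r$) and at the CPU ($s=c$). That is, for the MMSE-SIC receiver that works with the effective channel $\sqrt{\rho_t}E\{A_r\Lambda_r^{1/2}|\Theta_r\}$ resp. $\sqrt{\rho_t}E\{D|\Theta_c\}$ and the interference-plus-noise covariance $\Psi_s$: (i) almost surely where $\Psi_s$ is invertible, $\log_2\det(I+\Upsilon_s)=\sum_k\log_2(1+\mathrm{SINR}_k)$, where $\mathrm{SINR}_k$ is the output SINR of the MMSE filter for stream $k$ after cancellation of the streams decoded before it; (ii) $\mathrm{SE}_s$ is at most $\tfrac1\tau$ times the sum over $k$ of the mutual information (in bits) between the symbols of stream $k$ in a coherence interval and the pair formed by the corresponding outputs of its MMSE filter, after cancellation of the (correctly decoded) earlier streams, and $\Theta_s$; (iii) $\mathrm{SE}_s$ is at most $\tfrac1\tau$ times the mutual information (in bits) between all data symbols of a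 coherence interval and the pair formed by the received signals ($y_r$ resp. $z_c$) of the interval and $\Theta_s$. -/

import Mathlib

open MeasureTheory ProbabilityTheory
open scoped ENNReal NNReal Matrix ComplexConjugate ComplexOrder

noncomputable section

/-! ### Information-theoretic and probabilistic notions -/

/-- The circularly symmetric complex Gaussian law `CN(0,1)`: real and imaginary parts are
independent centred real Gaussians of variance `1/2`. -/
def stdComplexGaussian : Measure ℂ :=
  ((gaussianReal 0 (1 / 2)).prod (gaussianReal 0 (1 / 2))).map
    (fun q : ℝ × ℝ => (q.1 : ℂ) + (q.2 : ℂ) * Complex.I)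

/-- The mutual information (in nats) of two random elements: the Kullback-Leibler divergence of
their joint law from the product of their laws. -/
def mutualInfo {Ω 𝓧 𝓨 : Type*} [MeasurableSpace Ω] [MeasurableSpace 𝓧] [MeasurableSpace 𝓨]
    (P : Measure Ω) (X : Ω → 𝓧) (Y : Ω → 𝓨) : ℝ≥0∞ :=
  InformationTheory.klDiv (P.map (fun ω => (X ω, Y ω))) ((P.map X).prod (P.map Y))

/-- Entrywise expectation of a random complex matrix. -/
def matExp {Ω : Type*} [MeasurableSpace Ω] (P : Measure Ω) {m n : Type*}
    (X : Ω → Matrix m n ℂ) : Matrix m n ℂ :=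
  Matrix.of fun i j => ∫ ω, X ω i j ∂P

/-- Entrywise conditional expectation `E{X | Θ}` of a random complex matrix, given the sigma-algebra
generated by the random element `Θ`. -/
def matCondExp {Ω 𝓣 : Type*} [MeasurableSpace Ω] [MeasurableSpace 𝓣] (P : Measure Ω)
    (Θ : Ω → 𝓣) {m n : Type*} (X : Ω → Matrix m n ℂ) (ω : Ω) : Matrix m n ℂ :=
  Matrix.of fun i j =>
    (P[fun ω' => X ω' i j | MeasurableSpace.comap Θ inferInstance]) ω

/-! ### The MMSE-SIC receiver

The receiver treats its observation as `y = ∑ⱼ hⱼ xⱼ + (interference plus noise)`, where `hⱼ` is the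
`j`-th column of a known effective channel `H` and the interference plus noise has covariance `Ψ`.
The permutation `σ` is the decoding order: stream `j` is decoded before stream `k` if `σ j < σ k`. -/

section SIC

variable {ι : Type*} [Fintype ι] [DecidableEq ι] {n : ℕ}

/-- Covariance of the observation at the stage at which stream `k` is decoded: all streams decoded
earlier have been cancelled. -/
def sicCov (H : Matrix ι (Fin n) ℂ) (Ψ : Matrix ι ι ℂ) (σ : Equiv.Perm (Fin n)) (k : Fin n) :
    Matrix ι ι ℂ :=
  (∑ j with σ k ≤ σ j, Matrix.vecMulVec (fun i => H i j) (star fun i => H i j)) + Ψ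

/-- The linear MMSE filter for stream `k`. -/
def sicFilter (H : Matrix ι (Fin n) ℂ) (Ψ : Matrix ι ι ℂ) (σ : Equiv.Perm (Fin n)) (k : Fin n) :
    ι → ℂ :=
  (sicCov H Ψ σ k)⁻¹ *ᵥ fun i => H i k

/-- The signal-to-interference-plus-noise ratio of stream `k` at the output of its MMSE filter. -/
def sicSINR (H : Matrix ι (Fin n) ℂ) (Ψ : Matrix ι ι ℂ) (σ : Equiv.Perm (Fin n)) (k : Fin n) : ℝ :=
  ‖star (sicFilter H Ψ σ k) ⬝ᵥ (fun i => H i k)‖ ^ 2 /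
    (star (sicFilter H Ψ σ k) ⬝ᵥ
      ((sicCov H Ψ σ k - Matrix.vecMulVec (fun i => H i k) (star fun i => H i k)) *ᵥ
        sicFilter H Ψ σ k)).re

/-- Output of the MMSE filter of stream `k` after the streams decoded earlier have been subtracted
from the observation `y`. -/
def sicOutput (H : Matrix ι (Fin n) ℂ) (Ψ : Matrix ι ι ℂ) (σ : Equiv.Perm (Fin n)) (k : Fin n)
    (x : Fin n → ℂ) (y : ι → ℂ) : ℂ :=
  star (sicFilter H Ψ σ k) ⬝ᵥ (y - ∑ j with σ j < σ k, x j • fun i => H i j)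

end SIC

/-! ### The cell-free proactive monitoring system -/

/-- Deterministic parameters: `M` monitoring nodes (MNs) with `N` antennas each, an untrusted
transmitter (UT) with `Nt` antennas, an untrusted receiver (UR) with `Nr` antennas, a coherence
interval of `τ` symbols, of which `τr` are used for uplink training and `τt` for beamforming
training. -/
structure SystemParams (M N Nt Nr τ τr τt : ℕ) where
  /-- normalized powers of the UR pilots, of the UT, and of the jamming MNs -/
  ρr : ℝ
  ρt : ℝ
  ρJ : ℝ
  /-- large-scale fading UT-UR, MN-UR, UT-MN, MN-MN -/
  βrt : ℝ
  βmr : Fin M → ℝ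
  βtm : Fin M → ℝ
  βmm : Fin M → Fin M → ℝ
  /-- `α m = 1`: MN `m` observes; `α m = 0`: MN `m` jams -/
  α : Fin M → ℝ
  /-- diagonals of the power allocation matrices of the UT and of the MNs -/
  lam : Fin Nr → ℝ
  piJ : Fin M → Fin Nr → ℝ
  /-- regularization of the MMSE combiner at the MNs -/
  ϱ : ℝ
  /-- uplink pilots, one column per UR antenna -/
  pilotUL : Matrix (Fin τr) (Fin Nr) ℂ
  /-- beamforming training pilots, one row per stream -/
  pilotBF : Matrix (Fin Nr) (Fin τt) ℂ
  /-- the rule by which the UT turns its channel estimate into (not yet normalized) precoding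
  vectors, the columns of the value -/
  precoder : Matrix (Fin Nt) (Fin Nr) ℂ → Matrix (Fin Nt) (Fin Nr) ℂ
  ρr_nonneg : 0 ≤ ρr
  ρt_nonneg : 0 ≤ ρt
  ρJ_nonneg : 0 ≤ ρJ
  βrt_nonneg : 0 ≤ βrt
  βmr_nonneg : ∀ m, 0 ≤ βmr m
  βtm_nonneg : ∀ m, 0 ≤ βtm m
  βmm_nonneg : ∀ m m', 0 ≤ βmm m m'
  α_binary : ∀ m, α m = 0 ∨ α m = 1
  lam_nonneg : ∀ n, 0 ≤ lam n
  piJ_nonneg : ∀ m n, 0 ≤ piJ m n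
  ϱ_pos : 0 < ϱ
  pilotUL_orthonormal : pilotULᴴ * pilotUL = 1
  pilotBF_orthonormal : pilotBF * pilotBFᴴ = 1
  precoder_measurable : ∀ i n,
    Measurable fun g : Fin Nt → Fin Nr → ℂ => precoder (Matrix.of g) i n
  coherence_pos : 0 < τ
  training_le : τt + τr ≤ τ

/-- Index set of the scalar small-scale fading coefficients and training-phase noise samples. -/
inductive TrainIdx (M N Nt Nr τr τt : ℕ)
  | Hrt (i : Fin Nt) (n : Fin Nr)
  | Hmr (m : Fin M) (p : Fin N) (n : Fin Nr)
  | Htm (m : Fin M) (i : Fin Nt) (p : Fin N)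
  | Hmm (m m' : Fin M) (p q : Fin N)
  | noiseUT (i : Fin Nt) (s : Fin τr)
  | noiseULMN (m : Fin M) (p : Fin N) (s : Fin τr)
  | noiseBFMN (m : Fin M) (p : Fin N) (s : Fin τt)

/-- Index set of the scalar data symbols and data-phase noise samples, for `T` data symbols
per coherence interval. -/
inductive DataIdx (M N Nr T : ℕ)
  | sym (t : Fin T) (n : Fin Nr)
  | noiseUR (t : Fin T) (n : Fin Nr)
  | noiseMN (t : Fin T) (m : Fin M) (p : Fin N)

/-- The elementary random variables of one coherence interval: fading and training noise, data
symbols and data-phase noise, and the jamming symbols. -/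
structure Signals (Ω : Type*) (M N Nt Nr τ τr τt : ℕ) where
  train : TrainIdx M N Nt Nr τr τt → Ω → ℂ
  data : DataIdx M N Nr (τ - (τt + τr)) → Ω → ℂ
  jam : Fin (τ - (τt + τr)) → Fin Nr → Ω → ℂ

namespace Signals

variable {Ω : Type*} [MeasurableSpace Ω] {M N Nt Nr τ τr τt : ℕ}

/-- The stochastic model: fading coefficients and training noise are i.i.d. `CN(0,1)`; data symbols
(Gaussian signaling) and data-phase noise are i.i.d. `CN(0,1)`; the jamming vectors satisfy
`E{xᴶ (xᴶ)ᴴ} = I` and are independent of data symbols and data-phase noise. -/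
structure IsModel (S : Signals Ω M N Nt Nr τ τr τt) (P : Measure Ω) : Prop where
  train_measurable : ∀ i, Measurable (S.train i)
  train_law : ∀ i, P.map (S.train i) = stdComplexGaussian
  train_indep : iIndepFun S.train P
  data_measurable : ∀ i, Measurable (S.data i)
  data_law : ∀ i, P.map (S.data i) = stdComplexGaussian
  data_indep : iIndepFun S.data P
  jam_measurable : ∀ t n, Measurable (S.jam t n)
  jam_memLp : ∀ t n, MemLp (S.jam t n) 2 P
  jam_cov : ∀ t n n', ∫ ω, S.jam t n ω * conj (S.jam t n' ω) ∂P = if n = n' then 1 else 0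
  data_jam_indep : IndepFun (fun ω i => S.data i ω) (fun ω t n => S.jam t n ω) P

/-- `Θ` is side information: a random element which, jointly with the fading and the training-phase
noise, is independent of what happens in the data phase (data symbols, data-phase noise, jamming
symbols). It may depend on fading and training in any way and contain additional randomness. -/
structure IsSideInfo {𝓣 : Type*} [MeasurableSpace 𝓣] (S : Signals Ω M N Nt Nr τ τr τt)
    (P : Measure Ω) (Θ : Ω → 𝓣) : Prop where
  measurable : Measurable Θ
  indep : IndepFun (fun ω => ((fun i => S.train i ω), Θ ω))
    (fun ω => ((fun i => S.data i ω), (fun t n => S.jam t n ω))) P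

variable (S : Signals Ω M N Nt Nr τ τr τt) (p : SystemParams M N Nt Nr τ τr τt)

/-! #### Channels -/

/-- Channel between UR and UT. -/
def Grt (ω : Ω) : Matrix (Fin Nt) (Fin Nr) ℂ :=
  Matrix.of fun i n => (Real.sqrt p.βrt : ℂ) * S.train (.Hrt i n) ω

/-- Channel between UR and MN `m`. -/
def Gmr (m : Fin M) (ω : Ω) : Matrix (Fin N) (Fin Nr) ℂ :=
  Matrix.of fun a n => (Real.sqrt (p.βmr m) : ℂ) * S.train (.Hmr m a n) ω

/-- Channel between UT and MN `m`. -/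
def Gtm (m : Fin M) (ω : Ω) : Matrix (Fin Nt) (Fin N) ℂ :=
  Matrix.of fun i a => (Real.sqrt (p.βtm m) : ℂ) * S.train (.Htm m i a) ω

/-- Channel between MNs `m` and `m'`; zero for `m' = m`. -/
def Gmm (m m' : Fin M) (ω : Ω) : Matrix (Fin N) (Fin N) ℂ :=
  Matrix.of fun a b =>
    if m' = m then 0 else (Real.sqrt (p.βmm m m') : ℂ) * S.train (.Hmm m m' a b) ω

/-! #### Uplink training -/

/-- MMSE estimate at the UT of `Grt`, from the received pilot matrix
`√(τr ρr) G Φᴴ + noise` projected on the pilots. -/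
def GrtHat (ω : Ω) : Matrix (Fin Nt) (Fin Nr) ℂ :=
  ((Real.sqrt (τr * p.ρr) * p.βrt / (τr * p.ρr * p.βrt + 1) : ℝ) : ℂ) •
    (((Real.sqrt (τr * p.ρr) : ℂ) • (S.Grt p ω * p.pilotULᴴ) +
      Matrix.of fun i s => S.train (.noiseUT i s) ω) * p.pilotUL)

/-- MMSE estimate at MN `m` of `Gmr m`. -/
def GmrHat (m : Fin M) (ω : Ω) : Matrix (Fin N) (Fin Nr) ℂ :=
  ((Real.sqrt (τr * p.ρr) * p.βmr m / (τr * p.ρr * p.βmr m + 1) : ℝ) : ℂ) •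
    (((Real.sqrt (τr * p.ρr) : ℂ) • (S.Gmr p m ω * p.pilotULᴴ) +
      Matrix.of fun a s => S.train (.noiseULMN m a s) ω) * p.pilotUL)

/-- The precoding matrix: normalized columns of the precoder computed from the UT's estimate. -/
def W (ω : Ω) : Matrix (Fin Nt) (Fin Nr) ℂ :=
  Matrix.of fun i n => p.precoder (S.GrtHat p ω) i n /
    (Real.sqrt (∑ i', ‖p.precoder (S.GrtHat p ω) i' n‖ ^ 2) : ℂ)

/-! #### Effective channels and beamforming training -/

/-- Effective channel `A = Gᴴ W` from the UT to the UR. -/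
def A (ω : Ω) : Matrix (Fin Nr) (Fin Nr) ℂ := (S.Grt p ω)ᴴ * S.W p ω

/-- Effective channel `Bₘ = Gᴴ W` from the UT to MN `m`; its `a`-th row is `b_aᴴ`. -/
def B (m : Fin M) (ω : Ω) : Matrix (Fin N) (Fin Nr) ℂ := (S.Gtm p m ω)ᴴ * S.W p ω

/-- Beamforming pilots received by MN `m`, projected on the pilots; the `a`-th row is `ỹ_aᴴ`. -/
def YtildeMN (m : Fin M) (ω : Ω) : Matrix (Fin N) (Fin Nr) ℂ :=
  ((Real.sqrt (τt * p.ρt) : ℂ) • (S.B p m ω * p.pilotBF) +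
    Matrix.of fun a s => S.train (.noiseBFMN m a s) ω) * p.pilotBFᴴ

/-- The column vector `b_a` of MN `m` as an `Nr × 1` matrix. -/
def bcol (m : Fin M) (a : Fin N) (ω : Ω) : Matrix (Fin Nr) (Fin 1) ℂ :=
  Matrix.of fun n _ => conj (S.B p m ω a n)

/-- The column vector `ỹ_a` of MN `m`. -/
def ycol (m : Fin M) (a : Fin N) (ω : Ω) : Matrix (Fin Nr) (Fin 1) ℂ :=
  Matrix.of fun n _ => conj (S.YtildeMN p m ω a n)

/-- Covariance matrix of `b_a`. -/
def bCov (P : Measure Ω) (m : Fin M) (a : Fin N) : Matrix (Fin Nr) (Fin Nr) ℂ :=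
  matExp P fun ω => (S.bcol p m a ω - matExp P (S.bcol p m a)) *
    (S.bcol p m a ω - matExp P (S.bcol p m a))ᴴ

/-- MMSE estimate of `b_a`. -/
def bHat (P : Measure Ω) (m : Fin M) (a : Fin N) (ω : Ω) : Matrix (Fin Nr) (Fin 1) ℂ :=
  matExp P (S.bcol p m a) + (Real.sqrt (τt * p.ρt) : ℂ) •
    (S.bCov p P m a * (((τt * p.ρt : ℝ) : ℂ) • S.bCov p P m a + 1)⁻¹ *
      (S.ycol p m a ω - (Real.sqrt (τt * p.ρt) : ℂ) • matExp P (S.bcol p m a)))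

/-- Estimated effective channel at MN `m`, with rows `b̂_aᴴ`. -/
def BHat (P : Measure Ω) (m : Fin M) (ω : Ω) : Matrix (Fin N) (Fin Nr) ℂ :=
  Matrix.of fun a n => conj (S.bHat p P m a ω n 0)

/-- MMSE combining matrix of MN `m`. -/
def V (P : Measure Ω) (m : Fin M) (ω : Ω) : Matrix (Fin N) (Fin Nr) ℂ :=
  S.BHat p P m ω * ((S.BHat p P m ω)ᴴ * S.BHat p P m ω + (p.ϱ : ℂ) • 1)⁻¹

end Signals

/-- `Λ^{1/2}`. -/
def SystemParams.lamSqrt {M N Nt Nr τ τr τt : ℕ} (p : SystemParams M N Nt Nr τ τr τt) :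
    Matrix (Fin Nr) (Fin Nr) ℂ :=
  Matrix.diagonal fun n => (Real.sqrt (p.lam n) : ℂ)

/-- `Λ`. -/
def SystemParams.Lam {M N Nt Nr τ τr τt : ℕ} (p : SystemParams M N Nt Nr τ τr τt) :
    Matrix (Fin Nr) (Fin Nr) ℂ :=
  Matrix.diagonal fun n => (p.lam n : ℂ)

/-- `Πₘ^{1/2}`. -/
def SystemParams.piSqrt {M N Nt Nr τ τr τt : ℕ} (p : SystemParams M N Nt Nr τ τr τt) (m : Fin M) :
    Matrix (Fin Nr) (Fin Nr) ℂ :=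
  Matrix.diagonal fun n => (Real.sqrt (p.piJ m n) : ℂ)

namespace Signals

variable {Ω 𝓣 : Type*} [MeasurableSpace Ω] [MeasurableSpace 𝓣] {M N Nt Nr τ τr τt : ℕ}
variable (S : Signals Ω M N Nt Nr τ τr τt) (p : SystemParams M N Nt Nr τ τr τt)

/-! #### Data transmission -/

/-- Data symbol vector in channel use `t`. -/
def x (t : Fin (τ - (τt + τr))) (ω : Ω) : Fin Nr → ℂ := fun n => S.data (.sym t n) ω

/-- Jamming symbol vector in channel use `t`. -/
def xJ (t : Fin (τ - (τt + τr))) (ω : Ω) : Fin Nr → ℂ := fun n => S.jam t n ω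

/-- Signal transmitted by the UT. -/
def sUT (t : Fin (τ - (τt + τr))) (ω : Ω) : Fin Nt → ℂ :=
  (Real.sqrt p.ρt : ℂ) • ((S.W p ω * p.lamSqrt) *ᵥ S.x t ω)

/-- Jamming signal transmitted by MN `m` (maximum-ratio precoding). -/
def sMN (m : Fin M) (t : Fin (τ - (τt + τr))) (ω : Ω) : Fin N → ℂ :=
  ((1 - p.α m) * Real.sqrt p.ρJ : ℂ) • ((S.GmrHat p m ω * p.piSqrt m) *ᵥ S.xJ t ω)

/-- Signal received at the UR. -/
def yUR (t : Fin (τ - (τt + τr))) (ω : Ω) : Fin Nr → ℂ :=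
  (S.Grt p ω)ᴴ *ᵥ S.sUT p t ω + ∑ m, (S.Gmr p m ω)ᴴ *ᵥ S.sMN p m t ω +
    fun n => S.data (.noiseUR t n) ω

/-- Signal received at MN `m`. -/
def yMN (m : Fin M) (t : Fin (τ - (τt + τr))) (ω : Ω) : Fin N → ℂ :=
  (p.α m : ℂ) • ((S.Gtm p m ω)ᴴ *ᵥ S.sUT p t ω) +
    (p.α m : ℂ) • (∑ m', (S.Gmm p m m' ω)ᴴ *ᵥ S.sMN p m' t ω) +
    (p.α m : ℂ) • (fun a => S.data (.noiseMN t m a) ω)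

/-- Aggregated signal at the central processing unit (CPU). -/
def zCPU (P : Measure Ω) (t : Fin (τ - (τt + τr))) (ω : Ω) : Fin Nr → ℂ :=
  ∑ m, (p.α m : ℂ) • ((S.V p P m ω)ᴴ *ᵥ S.yMN p m t ω)

/-! #### Quantities in the spectral efficiency formulas -/

/-- `F_rᴶ`, the jamming channel seen by the UR (without the factor `√ρJ`). -/
def FJr (ω : Ω) : Matrix (Fin Nr) (Fin Nr) ℂ :=
  ∑ m, (1 - p.α m : ℂ) • ((S.Gmr p m ω)ᴴ * S.GmrHat p m ω * p.piSqrt m)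

/-- `F_mᴶ`, the jamming channel seen by MN `m` (without the factor `√ρJ`). -/
def FJ (m : Fin M) (ω : Ω) : Matrix (Fin N) (Fin Nr) ℂ :=
  ∑ m', (1 - p.α m' : ℂ) • ((S.Gmm p m m' ω)ᴴ * S.GmrHat p m' ω * p.piSqrt m')

/-- `D = ∑ₘ αₘ Vₘᴴ Bₘ Λ^{1/2}`. -/
def D (P : Measure Ω) (ω : Ω) : Matrix (Fin Nr) (Fin Nr) ℂ :=
  ∑ m, (p.α m : ℂ) • ((S.V p P m ω)ᴴ * S.B p m ω * p.lamSqrt)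

/-- Interference-plus-noise covariance at the UR, for a given covariance `J` of the jamming
channel. -/
def PsiRWith (P : Measure Ω) (Θ : Ω → 𝓣) (J : Matrix (Fin Nr) (Fin Nr) ℂ) (ω : Ω) :
    Matrix (Fin Nr) (Fin Nr) ℂ :=
  1 + (p.ρJ : ℂ) • J +
    (p.ρt : ℂ) • matCondExp P Θ (fun ω' => S.A p ω' * p.Lam * (S.A p ω')ᴴ) ω -
    (p.ρt : ℂ) • (matCondExp P Θ (fun ω' => S.A p ω' * p.lamSqrt) ω *
      (matCondExp P Θ (fun ω' => S.A p ω' * p.lamSqrt) ω)ᴴ)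

/-- `Ψ_r`, the interference-plus-noise covariance at the UR given the side information. -/
def PsiR (P : Measure Ω) (Θ : Ω → 𝓣) (ω : Ω) : Matrix (Fin Nr) (Fin Nr) ℂ :=
  S.PsiRWith p P Θ (matCondExp P Θ (fun ω' => S.FJr p ω' * (S.FJr p ω')ᴴ) ω) ω

/-- `Ψ_c`, the interference-plus-noise covariance at the CPU given the side information. -/
def PsiC (P : Measure Ω) (Θ : Ω → 𝓣) (ω : Ω) : Matrix (Fin Nr) (Fin Nr) ℂ :=
  (p.ρJ : ℂ) • matCondExp P Θ (fun ω' => ∑ m, ∑ l, (p.α m * p.α l : ℂ) •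
      ((S.V p P m ω')ᴴ * S.FJ p m ω' * (S.FJ p l ω')ᴴ * S.V p P l ω')) ω +
    (p.ρt : ℂ) • matCondExp P Θ (fun ω' => S.D p P ω' * (S.D p P ω')ᴴ) ω +
    matCondExp P Θ (fun ω' => ∑ m, (p.α m : ℂ) • ((S.V p P m ω')ᴴ * S.V p P m ω')) ω -
    (p.ρt : ℂ) • (matCondExp P Θ (fun ω' => S.D p P ω') ω *
      matCondExp P Θ (fun ω' => (S.D p P ω')ᴴ) ω)

/-- `Υ_r`. -/
def UpsilonR (P : Measure Ω) (Θ : Ω → 𝓣) (ω : Ω) : Matrix (Fin Nr) (Fin Nr) ℂ :=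
  (p.ρt : ℂ) • (matCondExp P Θ (fun ω' => p.lamSqrt * (S.A p ω')ᴴ) ω * (S.PsiR p P Θ ω)⁻¹ *
    matCondExp P Θ (fun ω' => S.A p ω' * p.lamSqrt) ω)

/-- `Υ_c` (zero where `Ψ_c` is singular). -/
def UpsilonC (P : Measure Ω) (Θ : Ω → 𝓣) (ω : Ω) : Matrix (Fin Nr) (Fin Nr) ℂ :=
  (p.ρt : ℂ) • (matCondExp P Θ (fun ω' => (S.D p P ω')ᴴ) ω * (S.PsiC p P Θ ω)⁻¹ *
    matCondExp P Θ (fun ω' => S.D p P ω') ω)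

/-- Effective channel `√ρt E{A Λ^{1/2} | Θ}` known to the UR. -/
def HR (P : Measure Ω) (Θ : Ω → 𝓣) (ω : Ω) : Matrix (Fin Nr) (Fin Nr) ℂ :=
  (Real.sqrt p.ρt : ℂ) • matCondExp P Θ (fun ω' => S.A p ω' * p.lamSqrt) ω

/-- Effective channel `√ρt E{D | Θ}` known to the CPU. -/
def HC (P : Measure Ω) (Θ : Ω → 𝓣) (ω : Ω) : Matrix (Fin Nr) (Fin Nr) ℂ :=
  (Real.sqrt p.ρt : ℂ) • matCondExp P Θ (fun ω' => S.D p P ω') ω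

/-! #### Spectral efficiency -/

/-- Rate, in bits per channel use of the coherence interval (training included), at which the
observations `y t` together with the side information `Θ` convey the data symbols of one coherence
interval: the mutual information of the two, divided by the length `τ` of the interval. -/
def jointRate (P : Measure Ω) (Θ : Ω → 𝓣) (y : Fin (τ - (τt + τr)) → Ω → Fin Nr → ℂ) : ℝ≥0∞ :=
  mutualInfo P (fun ω t => S.x t ω) (fun ω => ((fun t => y t ω), Θ ω)) /
    ENNReal.ofReal (τ * Real.log 2)

/-- Rate, in bits per channel use of the coherence interval, of the MMSE-SIC receiver with effective
channel `H`, interference-plus-noise covariance `Ψ` and decoding order `σ`: the sum over the streams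
of the mutual information between the symbols of the stream and the outputs of its MMSE filter
together with the side information, divided by the length of the interval. -/
def sicRate (P : Measure Ω) (Θ : Ω → 𝓣) (y : Fin (τ - (τt + τr)) → Ω → Fin Nr → ℂ)
    (H Ψ : Ω → Matrix (Fin Nr) (Fin Nr) ℂ) (σ : Equiv.Perm (Fin Nr)) : ℝ≥0∞ :=
  (∑ k, mutualInfo P (fun ω t => S.x t ω k)
    (fun ω => ((fun t => sicOutput (H ω) (Ψ ω) σ k (S.x t ω) (y t ω)), Θ ω))) /
    ENNReal.ofReal (τ * Real.log 2)

end Signals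

/-- `log₂ det (I + Υ)`. -/
def logDet {n : ℕ} (Υ : Matrix (Fin n) (Fin n) ℂ) : ℝ := Real.logb 2 (1 + Υ).det.re

/-- `(1 - (τt + τr)/τ) E{log₂ det (I + Υ)}`. -/
def spectralEff {Ω : Type*} [MeasurableSpace Ω] (τ τr τt : ℕ) (P : Measure Ω) {n : ℕ}
    (Υ : Ω → Matrix (Fin n) (Fin n) ℂ) : ℝ :=
  (1 - ((τt : ℝ) + τr) / τ) * ∫ ω, logDet (Υ ω) ∂P

end

/-! Both receivers are instances of one block fading channel `y = A x + G v`: the matrices depend on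
fading and training only, `x` is Gaussian, and `v` (jamming symbols and receiver noise) is white and
uncorrelated with `x`, but need not be Gaussian. Given the side information `Θ`, put `H = E{A | Θ}`
and `Ψ = E{A Aᴴ + G Gᴴ | Θ} - H Hᴴ`; the fluctuation of `A` around `H` counts as noise.

The mutual information is not computed but bounded below by a mismatched decoder. By
Donsker-Varadhan (`ofReal_integral_le_mutualInfo`), `E g(X, Y)` is a lower bound as soon as `exp
g(·, y)` has integral at most one under the law of `X`, for each `y`. The test function is the
log-ratio of the Gaussian posterior `CN(u, d)` to the prior `CN(0,1)` at the symbol, where `u` is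
the output of the MMSE filter and `d` its mean square error computed from `H` and `Ψ`: `g = -log d +
|a|² - |a - u|²/d`. The integral condition holds because a density has mass one. The actual error,
averaged over channel, symbols and noise given `Θ`, is exactly `d` (`lintegral_norm_sq_error`), so
the last two terms cancel in the mean and `E g = E{-log d}`. Only second moments of the noise enter.

For a single stream the filter output is itself the observation. For the joint mutual information
the test functions of all streams are added; the estimate of a stream involves only symbols decoded
earlier, so the product of the posterior densities is triangular and still has integral at most one
(`lintegral_pi_prod_le_one`).

The errors are computed by the matrix determinant lemma: `d` is the quotient of the determinants of
the covariances after and before cancelling the stream. The quotients telescope along any decoding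
order, and with `det (Ψ + H Hᴴ) = det Ψ * det (I + Hᴴ Ψ⁻¹ H)` the stream rates add up to `log det (I
+ Υ)` (`log_det_eq_sum`).

Integrability is delicate at the CPU, where `Ψ` can be arbitrarily close to singular. There the
signal passes through the same combiners as the noise, so `A = G R` with `R` square integrable.
Cauchy-Schwarz then dominates `H` by `Ψ` and bounds `-log d` by a conditional second moment of `R`,
uniformly in `Ψ` (`norm_sq_dotProduct_matExp_le`, `neg_log_sicErr_le`). Where `Ψ` is singular, the
test function and the rate are set to zero. -/

set_option linter.unusedSectionVars false

/-! ### Variational lower bounds for the Kullback-Leibler divergence and the mutual information -/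

section Variational

/-- The Donsker-Varadhan lower bound. -/
lemma ofReal_integral_le_klDiv {α : Type*} [MeasurableSpace α] {μ ν : Measure α}
    [IsProbabilityMeasure μ] [IsProbabilityMeasure ν] {g : α → ℝ} (hgm : Measurable g)
    (hg : Integrable g μ) (hexp : ∫⁻ a, ENNReal.ofReal (Real.exp (g a)) ∂ν ≤ 1) :
    ENNReal.ofReal (∫ a, g a ∂μ) ≤ InformationTheory.klDiv μ ν := by
  by_cases htop : InformationTheory.klDiv μ ν = ∞
  · simp [htop]
  obtain ⟨hac, hint⟩ := InformationTheory.klDiv_ne_top_iff.1 htop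
  rw [InformationTheory.klDiv_of_ac_of_integrable hac hint]
  apply ENNReal.ofReal_le_ofReal
  simp only [probReal_univ, add_sub_cancel_right]
  -- Change of measure: `exp (-llr)` cancels the density of `μ` with respect to `ν`, so the
  -- exponential moment under `ν` controls this one.
  have hle : ∫⁻ a, ENNReal.ofReal (Real.exp (g a - llr μ ν a)) ∂μ ≤ 1 := by
    calc ∫⁻ a, ENNReal.ofReal (Real.exp (g a - llr μ ν a)) ∂μ
        = ∫⁻ a, (ν.rnDeriv μ * fun a => ENNReal.ofReal (Real.exp (g a))) a ∂μ := by
          apply lintegral_congr_ae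
          filter_upwards [exp_neg_llr hac, ν.rnDeriv_ne_top μ] with a ha hfin
          rw [sub_eq_add_neg, Real.exp_add, ha, ENNReal.ofReal_mul (Real.exp_pos _).le,
            ENNReal.ofReal_toReal hfin, Pi.mul_apply, mul_comm]
      _ = ∫⁻ a, ENNReal.ofReal (Real.exp (g a)) ∂(μ.withDensity (ν.rnDeriv μ)) := by
          rw [lintegral_withDensity_eq_lintegral_mul _ (Measure.measurable_rnDeriv _ _)
            (by fun_prop)]
      _ ≤ ∫⁻ a, ENNReal.ofReal (Real.exp (g a)) ∂ν :=
          lintegral_mono' (Measure.withDensity_rnDeriv_le _ _) le_rfl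
      _ ≤ 1 := hexp
  have hm : Measurable fun a => Real.exp (g a - llr μ ν a) :=
    Real.measurable_exp.comp (hgm.sub (measurable_llr _ _))
  have hei : Integrable (fun a => Real.exp (g a - llr μ ν a)) μ :=
    ⟨hm.aestronglyMeasurable, by
      rw [hasFiniteIntegral_iff_ofReal (ae_of_all _ fun _ => (Real.exp_pos _).le)]
      exact hle.trans_lt ENNReal.one_lt_top⟩
  have hone : ∫ a, Real.exp (g a - llr μ ν a) ∂μ ≤ 1 := by
    rw [integral_eq_lintegral_of_nonneg_ae (ae_of_all _ fun _ => (Real.exp_pos _).le)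
      hm.aestronglyMeasurable]
    exact ENNReal.toReal_le_of_le_ofReal zero_le_one (by simpa using hle)
  -- Integrate `s ≤ exp s - 1`; the right side is nonpositive by `hone`, which leaves `∫ g ≤ ∫ llr`.
  have hmono : ∫ a, (g a - llr μ ν a) ∂μ ≤ ∫ a, (Real.exp (g a - llr μ ν a) - 1) ∂μ :=
    integral_mono (hg.sub hint) (hei.sub (integrable_const _)) fun a => by
      have := Real.add_one_le_exp (g a - llr μ ν a)
      dsimp only
      linarith
  rw [integral_sub hg hint, integral_sub hei (integrable_const _)] at hmono
  simp only [integral_const, probReal_univ, smul_eq_mul, mul_one] at hmono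
  linarith

/-- Mismatched-decoding lower bound for the mutual information. -/
lemma ofReal_integral_le_mutualInfo {Ω 𝓧 𝓨 : Type*} [MeasurableSpace Ω] [MeasurableSpace 𝓧]
    [MeasurableSpace 𝓨] {P : Measure Ω} [IsProbabilityMeasure P] {X : Ω → 𝓧} {Y : Ω → 𝓨}
    (hX : Measurable X) (hY : Measurable Y) {g : 𝓧 → 𝓨 → ℝ}
    (hgm : Measurable fun q : 𝓧 × 𝓨 => g q.1 q.2)
    (hg : Integrable (fun ω => g (X ω) (Y ω)) P)
    (hexp : ∀ y, ∫⁻ x, ENNReal.ofReal (Real.exp (g x y)) ∂(P.map X) ≤ 1) :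
    ENNReal.ofReal (∫ ω, g (X ω) (Y ω) ∂P) ≤ mutualInfo P X Y := by
  have hXY : Measurable fun ω => (X ω, Y ω) := hX.prodMk hY
  have := Measure.isProbabilityMeasure_map (μ := P) hX.aemeasurable
  have := Measure.isProbabilityMeasure_map (μ := P) hY.aemeasurable
  have := Measure.isProbabilityMeasure_map (μ := P) hXY.aemeasurable
  have key := ofReal_integral_le_klDiv (μ := P.map fun ω => (X ω, Y ω))
    (ν := (P.map X).prod (P.map Y)) hgm
    ((integrable_map_measure hgm.aestronglyMeasurable hXY.aemeasurable).2 hg) (by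
      -- Under the product law the second component can be frozen, so the moment condition is needed
      -- only for each fixed `y`.
      rw [lintegral_prod_symm _ (by fun_prop)]
      calc _ ≤ ∫⁻ _, 1 ∂(P.map Y) := lintegral_mono fun y => hexp y
        _ = 1 := by simp)
  rwa [integral_map hXY.aemeasurable hgm.aestronglyMeasurable] at key

end Variational

/-! ### The standard complex Gaussian law -/

section ComplexGaussian

lemma measurable_complex_of_prod :
    Measurable fun q : ℝ × ℝ => (q.1 : ℂ) + (q.2 : ℂ) * Complex.I := by
  fun_prop

instance : IsProbabilityMeasure stdComplexGaussian :=
  Measure.isProbabilityMeasure_map measurable_complex_of_prod.aemeasurable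

lemma memLp_id_stdComplexGaussian (q : ℝ≥0) : MemLp id q stdComplexGaussian := by
  rw [stdComplexGaussian, memLp_map_measure_iff aestronglyMeasurable_id
    measurable_complex_of_prod.aemeasurable]
  have h : MemLp (fun a : ℝ => (a : ℂ)) q (gaussianReal 0 (1 / 2)) :=
    (memLp_id_gaussianReal (μ := 0) (v := 1 / 2) q).ofReal
  exact (h.comp_fst _).add ((h.comp_snd _).mul_const _)

lemma integral_id_stdComplexGaussian : ∫ z, z ∂stdComplexGaussian = 0 := by
  rw [stdComplexGaussian, integral_map measurable_complex_of_prod.aemeasurable (by fun_prop)]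
  have h : Integrable (fun a : ℝ => (a : ℂ)) (gaussianReal 0 (1 / 2)) :=
    ((memLp_id_gaussianReal (μ := 0) (v := 1 / 2) 1).integrable (by simp)).ofReal
  rw [integral_add (h.comp_fst _) ((h.comp_snd _).mul_const _), integral_mul_const,
    integral_fun_fst (fun a : ℝ => (a : ℂ)), integral_fun_snd (fun a : ℝ => (a : ℂ)),
    integral_complex_ofReal]
  simp

lemma integral_norm_sq_stdComplexGaussian : ∫ z : ℂ, ‖z‖ ^ 2 ∂stdComplexGaussian = 1 := by
  rw [stdComplexGaussian, integral_map measurable_complex_of_prod.aemeasurable (by fun_prop)]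
  have h : Integrable (fun a : ℝ => a ^ 2) (gaussianReal 0 (1 / 2)) :=
    (memLp_id_gaussianReal (μ := 0) (v := 1 / 2) 2).integrable_sq
  have hv : ∫ a, a ^ 2 ∂(gaussianReal 0 (1 / 2)) = 1 / 2 := by
    have := variance_id_gaussianReal (μ := 0) (v := 1 / 2)
    rw [variance_of_integral_eq_zero aemeasurable_id (by simp)] at this
    simpa using this
  have : ∀ q : ℝ × ℝ, ‖(q.1 : ℂ) + (q.2 : ℂ) * Complex.I‖ ^ 2 = q.1 ^ 2 + q.2 ^ 2 := fun q => by
    rw [Complex.sq_norm, Complex.normSq_add_mul_I]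
  simp_rw [this]
  rw [integral_add (h.comp_fst _) (h.comp_snd _), integral_fun_fst (fun a : ℝ => a ^ 2),
    integral_fun_snd (fun a : ℝ => a ^ 2), hv]
  simp
  norm_num

/-- The integrand is the quotient of the densities of `N(m, d/2)` and `N(0, 1/2)`; integrating it
against the latter gives the mass of the former. -/
lemma lintegral_gaussianReal_posterior {d : ℝ} (hd : 0 < d) (m : ℝ) :
    ∫⁻ a, ENNReal.ofReal (Real.exp (-(Real.log d / 2) + a ^ 2 - (a - m) ^ 2 / d))
      ∂(gaussianReal 0 (1 / 2)) = 1 := by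
  rw [gaussianReal_of_var_ne_zero _ (by norm_num),
    lintegral_withDensity_eq_lintegral_mul _ (measurable_gaussianPDF _ _) (by fun_prop)]
  have hne : (d / 2).toNNReal ≠ 0 := by
    simpa using hd
  rw [← lintegral_gaussianPDF_eq_one m hne]
  refine lintegral_congr fun a => ?_
  simp only [Pi.mul_apply, gaussianPDF_def]
  rw [← ENNReal.ofReal_mul (gaussianPDFReal_nonneg _ _ _)]
  congr 1
  simp only [gaussianPDFReal, Real.coe_toNNReal _ (half_pos hd).le]
  have h1 : Real.exp (-(Real.log d / 2)) = (√d)⁻¹ := by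
    rw [Real.exp_neg, ← Real.log_sqrt hd.le, Real.exp_log (Real.sqrt_pos.2 hd)]
  have h2 : √(2 * Real.pi * (d / 2)) = √Real.pi * √d := by
    rw [← Real.sqrt_mul Real.pi_pos.le]; congr 1; ring
  have h3 : √(2 * Real.pi * ((1 / 2 : ℝ≥0) : ℝ)) = √Real.pi := by
    congr 1; push_cast; ring
  rw [h2, h3, mul_inv, ← h1, mul_assoc, mul_assoc, ← Real.exp_add, ← Real.exp_add]
  congr 2
  push_cast
  field_simp
  ring

/-- Real and imaginary parts separate, each contributing `-(log d)/2` to the exponent. This is the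
normalization of the Gaussian posterior used as a test function. -/
lemma lintegral_stdComplexGaussian_posterior {d : ℝ} (hd : 0 < d) (u : ℂ) :
    ∫⁻ z, ENNReal.ofReal (Real.exp (-Real.log d + ‖z‖ ^ 2 - ‖z - u‖ ^ 2 / d))
      ∂stdComplexGaussian = 1 := by
  rw [stdComplexGaussian, lintegral_map (by fun_prop) measurable_complex_of_prod]
  have : ∀ q : ℝ × ℝ, ENNReal.ofReal (Real.exp (-Real.log d +
      ‖(q.1 : ℂ) + (q.2 : ℂ) * Complex.I‖ ^ 2 -
        ‖(q.1 : ℂ) + (q.2 : ℂ) * Complex.I - u‖ ^ 2 / d)) =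
      ENNReal.ofReal (Real.exp (-(Real.log d / 2) + q.1 ^ 2 - (q.1 - u.re) ^ 2 / d)) *
      ENNReal.ofReal (Real.exp (-(Real.log d / 2) + q.2 ^ 2 - (q.2 - u.im) ^ 2 / d)) := by
    intro q
    rw [← ENNReal.ofReal_mul (Real.exp_pos _).le, ← Real.exp_add]
    congr 2
    rw [Complex.sq_norm, Complex.sq_norm, Complex.normSq_add_mul_I, Complex.normSq_apply]
    simp
    ring
  simp_rw [this]
  rw [lintegral_prod_mul
    (f := fun a => ENNReal.ofReal (Real.exp (-(Real.log d / 2) + a ^ 2 - (a - u.re) ^ 2 / d)))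
    (g := fun a => ENNReal.ofReal (Real.exp (-(Real.log d / 2) + a ^ 2 - (a - u.im) ^ 2 / d)))
    (by fun_prop) (by fun_prop), lintegral_gaussianReal_posterior hd,
    lintegral_gaussianReal_posterior hd, one_mul]

end ComplexGaussian

/-! ### Products of triangularly coupled densities -/

section Triangular

variable {ι : Type*} [Fintype ι] [DecidableEq ι] {E : Type*} [MeasurableSpace E]

/-- If the factor `φ i` depends only on the coordinate `i` and on those of smaller rank, and has
integral at most one in the coordinate `i`, then so does the product. -/
lemma lintegral_pi_prod_le_one {γ : Measure E} [IsProbabilityMeasure γ] {r : ι → ℕ}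
    {φ : ι → (ι → E) → ℝ≥0∞} (hm : ∀ i, Measurable (φ i))
    (hdep : ∀ i x y, x i = y i → (∀ j, r j < r i → x j = y j) → φ i x = φ i y)
    (hint : ∀ i x, ∫⁻ z, φ i (Function.update x i z) ∂γ ≤ 1) :
    ∫⁻ x, ∏ i, φ i x ∂(Measure.pi fun _ => γ) ≤ 1 := by
  have key : ∀ s : Finset ι, ∀ x, (∫⋯∫⁻_s, (fun x => ∏ i ∈ s, φ i x) ∂fun _ => γ) x ≤ 1 := by
    intro s
    -- Coordinates are integrated out from the highest rank downwards: a coordinate of maximal rank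
    -- occurs in no factor of the remaining indices, so these factors are constants in its integral.
    induction s using Finset.induction_on_max_value r with
    | empty => simp
    | insert a s ha hmax ih =>
      intro x
      rw [lmarginal_insert' _ (Finset.measurable_fun_prod _ fun i _ => hm i) ha]
      refine le_trans (lmarginal_mono (fun y => ?_) x) (ih x)
      have hconst : ∀ z, ∏ i ∈ s, φ i (Function.update y a z) = ∏ i ∈ s, φ i y := by
        intro z
        refine Finset.prod_congr rfl fun i hi => hdep i _ _ ?_ fun j hj => ?_
        · rw [Function.update_of_ne]
          rintro rfl
          exact ha hi
        · rw [Function.update_of_ne]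
          rintro rfl
          exact absurd (hmax i hi) (not_le.2 hj)
      simp_rw [Finset.prod_insert ha, hconst]
      rw [lintegral_mul_const (f := fun z => φ a (Function.update y a z)) _
        ((hm a).comp (measurable_update y))]
      calc _ ≤ 1 * ∏ i ∈ s, φ i y := by gcongr; exact hint a y
        _ = _ := one_mul _
  rcases isEmpty_or_nonempty E with hE | ⟨⟨e⟩⟩
  · exact absurd (IsProbabilityMeasure.ne_zero γ) (by simp [Measure.eq_zero_of_isEmpty])
  rw [lintegral_eq_lmarginal_univ (fun _ => e)]
  exact key _ _

end Triangular

/-! ### Linear algebra of the MMSE-SIC receiver -/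

noncomputable section

section SICAlgebra

variable {ι : Type*} [Fintype ι] [DecidableEq ι] {n : ℕ}

/-- The rank-one positive semidefinite matrix `h hᴴ`, where `h` is the `j`-th column of `H`. -/
def colOuter (H : Matrix ι (Fin n) ℂ) (j : Fin n) : Matrix ι ι ℂ :=
  Matrix.vecMulVec (fun i => H i j) (star fun i => H i j)

/-- Covariance of the observation after cancellation of all streams decoded at stages before `l`. -/
def tailCov (H : Matrix ι (Fin n) ℂ) (Ψ : Matrix ι ι ℂ) (σ : Equiv.Perm (Fin n)) (l : ℕ) :
    Matrix ι ι ℂ :=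
  (∑ j with l ≤ (σ j : ℕ), colOuter H j) + Ψ

/-- Mean square error of the MMSE estimate of stream `k`. -/
def sicErr (H : Matrix ι (Fin n) ℂ) (Ψ : Matrix ι ι ℂ) (σ : Equiv.Perm (Fin n)) (k : Fin n) : ℝ :=
  1 - (star (sicFilter H Ψ σ k) ⬝ᵥ fun i => H i k).re

variable (H : Matrix ι (Fin n) ℂ) (Ψ : Matrix ι ι ℂ) (σ : Equiv.Perm (Fin n)) (k : Fin n)

lemma sicCov_eq_tailCov : sicCov H Ψ σ k = tailCov H Ψ σ (σ k) := rfl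

/-- Consecutive stages differ by a rank-one matrix, the input of the determinant lemma. Stages are
natural numbers, so that the stage after the last stream exists; there only `Ψ` is left. -/
lemma tailCov_apply_eq_add :
    tailCov H Ψ σ (σ k) = tailCov H Ψ σ (σ k + 1) + colOuter H k := by
  have : (Finset.univ.filter fun j => (σ k : ℕ) ≤ σ j) =
      insert k (Finset.univ.filter fun j => (σ k : ℕ) + 1 ≤ σ j) := by
    ext j
    simp only [Finset.mem_filter, Finset.mem_univ, true_and, Finset.mem_insert]
    rw [Nat.succ_le_iff, le_iff_eq_or_lt, Fin.val_inj, σ.injective.eq_iff, eq_comm]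
  rw [tailCov, tailCov, this, Finset.sum_insert (by simp)]
  abel

lemma tailCov_zero : tailCov H Ψ σ 0 = H * Hᴴ + Ψ := by
  rw [tailCov]
  congr 1
  ext a b
  simp [Matrix.sum_apply, colOuter, Matrix.vecMulVec_apply, Matrix.mul_apply]

lemma tailCov_last : tailCov H Ψ σ n = Ψ := by
  rw [tailCov, Finset.filter_false_of_mem fun j _ => not_le.2 (σ j).2]
  simp

lemma star_dotProduct_colOuter_mulVec (j : Fin n) (u : ι → ℂ) :
    star u ⬝ᵥ (colOuter H j *ᵥ u) = ((‖star u ⬝ᵥ fun i => H i j‖ ^ 2 : ℝ) : ℂ) := by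
  rw [colOuter, Matrix.vecMulVec_mulVec]
  have : (star fun i => H i j) ⬝ᵥ u = conj (star u ⬝ᵥ fun i => H i j) := by
    simp [dotProduct, map_sum, mul_comm]
  rw [this]
  simp only [dotProduct_smul, MulOpposite.smul_eq_mul_unop, MulOpposite.unop_op]
  rw [Complex.mul_conj, Complex.normSq_eq_norm_sq]

lemma star_dotProduct_tailCov_mulVec (l : ℕ) (u : ι → ℂ) :
    star u ⬝ᵥ (tailCov H Ψ σ l *ᵥ u) =
      ((∑ j with l ≤ (σ j : ℕ), ‖star u ⬝ᵥ fun i => H i j‖ ^ 2 : ℝ) : ℂ) +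
        star u ⬝ᵥ (Ψ *ᵥ u) := by
  rw [tailCov, Matrix.add_mulVec, dotProduct_add, Matrix.sum_mulVec, dotProduct_sum]
  simp_rw [star_dotProduct_colOuter_mulVec]
  push_cast
  rfl

variable {Ψ}

lemma tailCov_posDef (hΨ : Ψ.PosDef) (l : ℕ) : (tailCov H Ψ σ l).PosDef :=
  hΨ.posSemidef_add (Matrix.posSemidef_sum _ fun _ _ => Matrix.posSemidef_vecMulVec_self_star _)

lemma det_re_pos {A : Matrix ι ι ℂ} (hA : A.PosDef) : 0 < A.det.re :=
  (Complex.pos_iff.1 hA.det_pos).1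

lemma det_eq_ofReal_re {A : Matrix ι ι ℂ} (hA : A.PosDef) : A.det = (A.det.re : ℂ) :=
  Complex.ext rfl (by simpa using (Complex.pos_iff.1 hA.det_pos).2.symm)

/-- With `C` the covariance at the stage of stream `k` and `h` its column, the left side is `hᴴ C⁻¹
h`, and removing `h hᴴ` from `C` multiplies the determinant by `1 - hᴴ C⁻¹ h`. -/
lemma star_sicFilter_dotProduct (hΨ : Ψ.PosDef) :
    star (sicFilter H Ψ σ k) ⬝ᵥ (fun i => H i k) =
      ((1 - (tailCov H Ψ σ (σ k + 1)).det.re / (tailCov H Ψ σ (σ k)).det.re : ℝ) : ℂ) := by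
  set C := tailCov H Ψ σ (σ k) with hC
  have hCpd : C.PosDef := tailCov_posDef H σ hΨ _
  have hC'pd := tailCov_posDef H σ hΨ (σ k + 1)
  set h : ι → ℂ := fun i => H i k with hh
  have hunit : IsUnit C.det := hCpd.det_pos.ne'.isUnit
  have hs : star (sicFilter H Ψ σ k) ⬝ᵥ h = star h ⬝ᵥ (C⁻¹ *ᵥ h) := by
    rw [sicFilter, sicCov_eq_tailCov, ← hC, Matrix.star_mulVec, hCpd.inv.1,
      Matrix.dotProduct_mulVec]
  have hsub : tailCov H Ψ σ (σ k + 1) =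
      C + Matrix.replicateCol Unit (-h) * Matrix.replicateRow Unit (star h) := by
    rw [hC, tailCov_apply_eq_add, ← Matrix.vecMulVec_eq, Matrix.neg_vecMulVec]
    simp [colOuter, hh]
  have hdet := Matrix.det_add_replicateCol_mul_replicateRow (ι := Unit) hunit (-h) (star h)
  rw [← hsub, Matrix.det_unique (1 + _)] at hdet
  have hentry : (1 + Matrix.replicateRow Unit (star h) * C⁻¹ * Matrix.replicateCol Unit (-h) :
      Matrix Unit Unit ℂ)
      (default : Unit) default = 1 - star h ⬝ᵥ (C⁻¹ *ᵥ h) := by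
    rw [Matrix.dotProduct_mulVec]
    rw [Matrix.add_apply, Matrix.mul_apply]
    simp [Matrix.mul_apply, dotProduct, Matrix.vecMul, sub_eq_add_neg]
  rw [hentry, det_eq_ofReal_re hC'pd, det_eq_ofReal_re hCpd] at hdet
  rw [hs]
  have hne : (C.det.re : ℂ) ≠ 0 := by exact_mod_cast (det_re_pos hCpd).ne'
  push_cast
  rw [hdet, mul_div_cancel_left₀ _ hne]
  ring

lemma sicErr_eq_div (hΨ : Ψ.PosDef) : sicErr H Ψ σ k =
    (tailCov H Ψ σ (σ k + 1)).det.re / (tailCov H Ψ σ (σ k)).det.re := by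
  rw [sicErr, star_sicFilter_dotProduct H σ k hΨ, Complex.ofReal_re]
  ring

lemma star_sicFilter_dotProduct_col (hΨ : Ψ.PosDef) :
    star (sicFilter H Ψ σ k) ⬝ᵥ (fun i => H i k) = ((1 - sicErr H Ψ σ k : ℝ) : ℂ) := by
  rw [star_sicFilter_dotProduct H σ k hΨ, sicErr_eq_div H σ k hΨ]

lemma sicErr_pos (hΨ : Ψ.PosDef) : 0 < sicErr H Ψ σ k := by
  rw [sicErr_eq_div H σ k hΨ]
  exact div_pos (det_re_pos (tailCov_posDef H σ hΨ _)) (det_re_pos (tailCov_posDef H σ hΨ _))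

/-- The filter `f` solves `C f = h`, so total output power and signal gain coincide. -/
lemma star_sicFilter_dotProduct_tailCov_mulVec (hΨ : Ψ.PosDef) :
    star (sicFilter H Ψ σ k) ⬝ᵥ (tailCov H Ψ σ (σ k) *ᵥ sicFilter H Ψ σ k) =
      ((1 - sicErr H Ψ σ k : ℝ) : ℂ) := by
  have hCpd := tailCov_posDef H σ hΨ (σ k)
  rw [← star_sicFilter_dotProduct_col H σ k hΨ]
  congr 1
  rw [sicFilter, sicCov_eq_tailCov, Matrix.mulVec_mulVec,
    Matrix.mul_nonsing_inv _ hCpd.det_pos.ne'.isUnit, Matrix.one_mulVec]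

lemma sicErr_le_one (hΨ : Ψ.PosDef) : sicErr H Ψ σ k ≤ 1 := by
  have h := (tailCov_posDef H σ hΨ (σ k)).posSemidef.dotProduct_mulVec_nonneg (sicFilter H Ψ σ k)
  rw [star_sicFilter_dotProduct_tailCov_mulVec H σ k hΨ] at h
  have := (Complex.nonneg_iff.1 h).1
  rw [Complex.ofReal_re] at this
  linarith

/-- The output has gain and total power `1 - d`, hence signal power `(1 - d)²` and disturbance `(1 -
d) d`; their quotient is `1/d - 1`. -/
lemma one_add_sicSINR (hΨ : Ψ.PosDef) : 1 + sicSINR H Ψ σ k = (sicErr H Ψ σ k)⁻¹ := by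
  have hpos := sicErr_pos H σ k hΨ
  have hc : sicCov H Ψ σ k - Matrix.vecMulVec (fun i => H i k) (star fun i => H i k) =
      tailCov H Ψ σ (σ k) - colOuter H k := rfl
  rw [sicSINR, hc, Matrix.sub_mulVec, dotProduct_sub,
    star_sicFilter_dotProduct_tailCov_mulVec H σ k hΨ, star_dotProduct_colOuter_mulVec,
    star_sicFilter_dotProduct_col H σ k hΨ, Complex.norm_real, Real.norm_eq_abs, sq_abs,
    ← Complex.ofReal_sub, Complex.ofReal_re]
  set d := sicErr H Ψ σ k
  rcases eq_or_ne d 1 with h | h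
  -- The filter output has power zero and the ratio reads `0 / 0 = 0`, which is the right value.
  · simp [h]
  · have : 1 - d ≠ 0 := sub_ne_zero.2 h.symm
    have h3 : (1 - d) - (1 - d) ^ 2 = (1 - d) * d := by ring
    rw [h3]
    field_simp
    ring

/-- The error of the filter output, as a quadratic form. -/
lemma sum_norm_sq_add_sicFilter (hΨ : Ψ.PosDef) :
    (∑ j, ‖(if j = k then 1 else 0) + (if σ j < σ k then star (sicFilter H Ψ σ k) ⬝ᵥ
        (fun i => H i j) else 0) - star (sicFilter H Ψ σ k) ⬝ᵥ (fun i => H i j)‖ ^ 2) +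
      (star (sicFilter H Ψ σ k) ⬝ᵥ (Ψ *ᵥ sicFilter H Ψ σ k)).re = sicErr H Ψ σ k := by
  have h1 := star_sicFilter_dotProduct_tailCov_mulVec H σ k hΨ
  have h2 := star_sicFilter_dotProduct_col H σ k hΨ
  rw [star_dotProduct_tailCov_mulVec] at h1
  have h1' := congrArg Complex.re h1
  rw [Complex.add_re, Complex.ofReal_re, Complex.ofReal_re] at h1'
  set c : Fin n → ℂ := fun j => star (sicFilter H Ψ σ k) ⬝ᵥ fun i => H i j with hcdef
  -- Earlier streams are cancelled and later ones leave `-c j`. For `j = k` the gain is real, so `|1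
  -- - c|² = c² + 1 - 2c`. The squares together with the `Ψ` term form the total output power `1 -
  -- d`, and the correction `1 - 2(1 - d)` turns it into `d`.
  have hterm : ∀ j, ‖(if j = k then 1 else 0) + (if σ j < σ k then c j else 0) - c j‖ ^ 2 =
      (if (σ k : ℕ) ≤ σ j then ‖c j‖ ^ 2 else 0) +
        if j = k then 1 - 2 * (1 - sicErr H Ψ σ k) else 0 := by
    intro j
    by_cases hj : j = k
    · subst hj
      rw [if_pos rfl, if_neg (lt_irrefl _), if_pos le_rfl, if_pos rfl]
      have : c j = ((1 - sicErr H Ψ σ j : ℝ) : ℂ) := h2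
      rw [this, add_zero, ← Complex.ofReal_one, ← Complex.ofReal_sub, Complex.norm_real,
        Complex.norm_real, Real.norm_eq_abs, Real.norm_eq_abs, sq_abs, sq_abs]
      ring
    · rw [if_neg hj, if_neg hj]
      by_cases hlt : σ j < σ k
      · rw [if_pos hlt, if_neg (not_le.2 (Fin.lt_def.1 hlt))]
        simp
      · rw [if_neg hlt, if_pos (Fin.le_def.1 (not_lt.1 hlt))]
        simp
  rw [Finset.sum_congr rfl fun j _ => hterm j, Finset.sum_add_distrib, ← Finset.sum_filter,
    Finset.sum_ite_eq' Finset.univ k, if_pos (Finset.mem_univ _)]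
  linarith

/-- Reindexed by the decoding order, the quotients of determinants telescope from the full
covariance down to `Ψ`; the order itself drops out. -/
lemma prod_sicErr (hΨ : Ψ.PosDef) :
    ∏ k, sicErr H Ψ σ k = Ψ.det.re / (H * Hᴴ + Ψ).det.re := by
  have hpos : ∀ l, (tailCov H Ψ σ l).det.re ≠ 0 := fun l =>
    (det_re_pos (tailCov_posDef H σ hΨ l)).ne'
  simp_rw [sicErr_eq_div H σ _ hΨ]
  rw [Equiv.prod_comp σ fun i : Fin n =>
      (tailCov H Ψ σ ((i : ℕ) + 1)).det.re / (tailCov H Ψ σ i).det.re,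
    Fin.prod_univ_eq_prod_range
      (fun i => (tailCov H Ψ σ (i + 1)).det.re / (tailCov H Ψ σ i).det.re) n]
  have : ∀ m, ∏ i ∈ Finset.range m, (tailCov H Ψ σ (i + 1)).det.re / (tailCov H Ψ σ i).det.re =
      (tailCov H Ψ σ m).det.re / (tailCov H Ψ σ 0).det.re := by
    intro m
    induction m with
    | zero => simp [hpos]
    | succ m ih => rw [Finset.prod_range_succ, ih]; field_simp [hpos]
  rw [this, tailCov_last, tailCov_zero]

/-- Sylvester's identity moves the determinant from the antenna side to the stream side. -/
lemma det_one_add_conjTranspose_mul (hΨ : Ψ.PosDef) :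
    (1 + Hᴴ * Ψ⁻¹ * H).det.re = (∏ k, sicErr H Ψ σ k)⁻¹ := by
  have hunit : IsUnit Ψ.det := hΨ.det_pos.ne'.isUnit
  have h := Matrix.det_add_mul H Hᴴ hunit
  have hpd : (H * Hᴴ + Ψ).PosDef := by
    rw [← tailCov_zero H Ψ σ]
    exact tailCov_posDef H σ hΨ 0
  rw [prod_sicErr H σ hΨ, inv_div, eq_div_iff (det_re_pos hΨ).ne', add_comm (H * Hᴴ), h]
  conv_rhs => rw [det_eq_ofReal_re hΨ]
  rw [Complex.re_ofReal_mul, mul_comm]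

lemma log_det_eq_sum (hΨ : Ψ.PosDef) :
    Real.log (1 + Hᴴ * Ψ⁻¹ * H).det.re = ∑ k, -Real.log (sicErr H Ψ σ k) := by
  rw [det_one_add_conjTranspose_mul H σ hΨ, Real.log_inv,
    Real.log_prod fun k _ => (sicErr_pos H σ k hΨ).ne', Finset.sum_neg_distrib]

lemma logDet_eq_sum_sicSINR (hΨ : Ψ.PosDef) :
    logDet (Hᴴ * Ψ⁻¹ * H) = ∑ k, Real.logb 2 (1 + sicSINR H Ψ σ k) := by
  simp_rw [one_add_sicSINR H σ _ hΨ, logDet, Real.logb, log_det_eq_sum H σ hΨ, Real.log_inv,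
    Finset.sum_div]

/-- Let `q` be the noise power at the filter output. Total power is `1 - d`, signal power `(1 -
d)²`, so `q ≤ (1 - d) d`; the hypothesis at the filter gives `(1 - d)² ≤ q r`. For `d < 1` this
yields `1 - d ≤ d r`, hence `-log d ≤ 1/d - 1 ≤ r`. The bound sees `Ψ` only through `r`, so it
survives as `Ψ` degenerates. -/
lemma neg_log_sicErr_le (hΨ : Ψ.PosDef) {r : ℝ} (hr0 : 0 ≤ r)
    (hr : ∀ u : ι → ℂ, ‖star u ⬝ᵥ fun i => H i k‖ ^ 2 ≤ (star u ⬝ᵥ (Ψ *ᵥ u)).re * r) :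
    -Real.log (sicErr H Ψ σ k) ≤ r := by
  have hpos := sicErr_pos H σ k hΨ
  have hle := sicErr_le_one H σ k hΨ
  have h1 := star_sicFilter_dotProduct_tailCov_mulVec H σ k hΨ
  have h2 := star_sicFilter_dotProduct_col H σ k hΨ
  have h3 := hr (sicFilter H Ψ σ k)
  rw [tailCov_apply_eq_add, Matrix.add_mulVec, dotProduct_add, star_dotProduct_colOuter_mulVec,
    star_dotProduct_tailCov_mulVec] at h1
  have h1' := congrArg Complex.re h1
  simp only [Complex.add_re, Complex.ofReal_re] at h1'
  rw [h2] at h1' h3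
  rw [Complex.norm_real, Real.norm_eq_abs, sq_abs] at h1' h3
  have hsum : 0 ≤ ∑ j with (σ k : ℕ) + 1 ≤ (σ j : ℕ),
      ‖star (sicFilter H Ψ σ k) ⬝ᵥ fun i => H i j‖ ^ 2 :=
    Finset.sum_nonneg fun _ _ => by positivity
  have hq := hΨ.posSemidef.re_dotProduct_nonneg (sicFilter H Ψ σ k)
  simp only [RCLike.re_to_complex] at hq
  set d := sicErr H Ψ σ k
  set q := (star (sicFilter H Ψ σ k) ⬝ᵥ (Ψ *ᵥ sicFilter H Ψ σ k)).re
  have hqle : q ≤ (1 - d) * d := by nlinarith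
  have hlog : -Real.log d ≤ d⁻¹ - 1 := by
    rw [← Real.log_inv]
    exact Real.log_le_sub_one_of_pos (inv_pos.2 hpos)
  refine hlog.trans ?_
  rcases eq_or_lt_of_le hle with h | h
  · simpa [h] using hr0
  · have h1d : 0 < 1 - d := by linarith
    have : (1 - d) * (1 - d) ≤ (1 - d) * (d * r) := by nlinarith
    have := le_of_mul_le_mul_left this h1d
    rw [inv_eq_one_div, sub_le_iff_le_add, div_le_iff₀ hpos]
    nlinarith

end SICAlgebra


/-! ### Second moments of random matrices -/

section SecondMoments

variable {E : Type*} [MeasurableSpace E] {Q : Measure E} [IsProbabilityMeasure Q]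

/-- Squared bias plus variance. -/
lemma integral_norm_sub_sq {X : E → ℂ} (hX : MemLp X 2 Q) (b : ℂ) :
    ∫ e, ‖b - X e‖ ^ 2 ∂Q = ‖b - ∫ e, X e ∂Q‖ ^ 2 + ∫ e, ‖X e‖ ^ 2 ∂Q - ‖∫ e, X e ∂Q‖ ^ 2 := by
  have hX1 : Integrable X Q := hX.integrable one_le_two
  have hX2 : Integrable (fun e => ‖X e‖ ^ 2) Q := hX.integrable_norm_pow two_ne_zero
  have hexp : ∀ w : ℂ, ‖b - w‖ ^ 2 = ‖b‖ ^ 2 - 2 * (b * conj w).re + ‖w‖ ^ 2 := fun w => by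
    simp only [Complex.sq_norm, Complex.normSq_sub]
    ring
  have hc : Integrable (fun e => b * conj (X e)) Q :=
    ((Complex.conjLIE.integrable_comp_iff).2 hX1).const_mul b
  have hre : ∫ e, (b * conj (X e)).re ∂Q = (b * conj (∫ e, X e ∂Q)).re := by
    rw [← integral_conj, ← integral_const_mul]
    exact integral_re hc
  simp_rw [hexp]
  have h1 : Integrable (fun e => 2 * (b * conj (X e)).re) Q := hc.re.const_mul 2
  have h2 : Integrable (fun e => ‖b‖ ^ 2 - 2 * (b * conj (X e)).re) Q :=
    (integrable_const _).sub h1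
  rw [integral_add h2 hX2, integral_sub (integrable_const _) h1,
    integral_const_mul, hre]
  simp
  ring

variable {ι κ : Type*} [Fintype ι] [Fintype κ] {n : ℕ}

/-- Second moment matrix `E{A Aᴴ + G Gᴴ}`. -/
def secondMoment (Q : Measure E) (A : E → Matrix ι (Fin n) ℂ) (G : E → Matrix ι κ ℂ) :
    Matrix ι ι ℂ :=
  matExp Q fun e => A e * (A e)ᴴ + G e * (G e)ᴴ

/-- Covariance `E{A Aᴴ + G Gᴴ} - E{A} E{A}ᴴ` of interference plus noise. -/
def noiseCov (Q : Measure E) (A : E → Matrix ι (Fin n) ℂ) (G : E → Matrix ι κ ℂ) :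
    Matrix ι ι ℂ :=
  secondMoment Q A G - matExp Q A * (matExp Q A)ᴴ

variable {A : E → Matrix ι (Fin n) ℂ} {G : E → Matrix ι κ ℂ} {R : E → Matrix κ (Fin n) ℂ}

lemma star_dotProduct_mul_conjTranspose_mulVec {m : Type*} [Fintype m] (B : Matrix ι m ℂ)
    (u : ι → ℂ) : star u ⬝ᵥ ((B * Bᴴ) *ᵥ u) = ((∑ j, ‖(star u ᵥ* B) j‖ ^ 2 : ℝ) : ℂ) := by
  rw [← Matrix.mulVec_mulVec, Matrix.dotProduct_mulVec]
  have : Bᴴ *ᵥ u = star (star u ᵥ* B) := by rw [Matrix.star_vecMul, star_star]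
  rw [this]
  simp only [dotProduct, Pi.star_apply, RCLike.star_def]
  push_cast
  simp_rw [Complex.mul_conj, Complex.normSq_eq_norm_sq]
  push_cast
  rfl

lemma memLp_vecMul {m : Type*} {B : E → Matrix ι m ℂ} (hB : ∀ i j, MemLp (fun e => B e i j) 2 Q)
    (u : ι → ℂ) (j : m) : MemLp (fun e => (u ᵥ* B e) j) 2 Q := by
  simp only [Matrix.vecMul, dotProduct]
  exact memLp_finsetSum _ fun i _ => (hB i j).const_mul (u i)

lemma integrable_mul_conj {X Y : E → ℂ} (hX : MemLp X 2 Q) (hY : MemLp Y 2 Q) :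
    Integrable (fun e => X e * conj (Y e)) Q :=
  hX.integrable_mul hY.star

lemma integrable_mul_conjTranspose {m : Type*} [Fintype m] {B : E → Matrix ι m ℂ}
    (hB : ∀ i j, MemLp (fun e => B e i j) 2 Q) (i i' : ι) :
    Integrable (fun e => (B e * (B e)ᴴ) i i') Q := by
  simp only [Matrix.mul_apply, Matrix.conjTranspose_apply]
  exact integrable_finsetSum _ fun j _ => integrable_mul_conj (hB i j) (hB i' j)

lemma integral_vecMul {m : Type*} {B : E → Matrix ι m ℂ}
    (hB : ∀ i j, MemLp (fun e => B e i j) 2 Q) (u : ι → ℂ) (j : m) :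
    ∫ e, (u ᵥ* B e) j ∂Q = (u ᵥ* matExp Q B) j := by
  simp only [Matrix.vecMul, dotProduct, matExp, Matrix.of_apply]
  rw [integral_finsetSum _ fun i _ => ((hB i j).integrable one_le_two).const_mul (u i)]
  simp_rw [integral_const_mul]

lemma integral_star_dotProduct_mulVec {B : E → Matrix ι ι ℂ}
    (hB : ∀ i j, Integrable (fun e => B e i j) Q) (u : ι → ℂ) :
    ∫ e, star u ⬝ᵥ (B e *ᵥ u) ∂Q = star u ⬝ᵥ (matExp Q B *ᵥ u) := by
  simp only [Matrix.mulVec, dotProduct, matExp, Matrix.of_apply, Finset.mul_sum]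
  rw [integral_finsetSum _ fun i _ => integrable_finsetSum _ fun j _ =>
    ((hB i j).mul_const _).const_mul _]
  refine Finset.sum_congr rfl fun i _ => ?_
  rw [integral_finsetSum _ fun j _ => ((hB i j).mul_const _).const_mul _]
  simp_rw [integral_const_mul, integral_mul_const]

lemma star_dotProduct_secondMoment (hA : ∀ i j, MemLp (fun e => A e i j) 2 Q)
    (hG : ∀ i j, MemLp (fun e => G e i j) 2 Q) (u : ι → ℂ) :
    star u ⬝ᵥ (secondMoment Q A G *ᵥ u) = ((∑ j, ∫ e, ‖(star u ᵥ* A e) j‖ ^ 2 ∂Q +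
      ∑ l, ∫ e, ‖(star u ᵥ* G e) l‖ ^ 2 ∂Q : ℝ) : ℂ) := by
  have hAi : ∀ j, Integrable (fun e => ‖(star u ᵥ* A e) j‖ ^ 2) Q := fun j =>
    (memLp_vecMul hA _ j).integrable_norm_pow two_ne_zero
  have hGi : ∀ j, Integrable (fun e => ‖(star u ᵥ* G e) j‖ ^ 2) Q := fun j =>
    (memLp_vecMul hG _ j).integrable_norm_pow two_ne_zero
  have hi : ∀ i j, Integrable (fun e => (A e * (A e)ᴴ + G e * (G e)ᴴ) i j) Q := fun i j =>
    (integrable_mul_conjTranspose hA i j).add (integrable_mul_conjTranspose hG i j)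
  rw [secondMoment, ← integral_star_dotProduct_mulVec hi]
  simp_rw [Matrix.add_mulVec, dotProduct_add, star_dotProduct_mul_conjTranspose_mulVec,
    ← Complex.ofReal_add]
  rw [integral_complex_ofReal, integral_add (integrable_finsetSum _ fun j _ => hAi j)
    (integrable_finsetSum _ fun j _ => hGi j), integral_finsetSum _ fun j _ => hAi j,
    integral_finsetSum _ fun j _ => hGi j]

/-- Bias and variance in each column: the random channel `A` may be replaced by its mean provided
that its variance is charged to the noise. This makes the receiver designed for the mean channel
have exactly the error it predicts. -/
lemma sum_integral_add_eq (hA : ∀ i j, MemLp (fun e => A e i j) 2 Q)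
    (hG : ∀ i j, MemLp (fun e => G e i j) 2 Q) (u : ι → ℂ) (b : Fin n → ℂ) :
    ∑ j, ∫ e, ‖b j - (star u ᵥ* A e) j‖ ^ 2 ∂Q + ∑ l, ∫ e, ‖(star u ᵥ* G e) l‖ ^ 2 ∂Q =
      ∑ j, ‖b j - (star u ᵥ* matExp Q A) j‖ ^ 2 +
        (star u ⬝ᵥ (noiseCov Q A G *ᵥ u)).re := by
  rw [noiseCov, Matrix.sub_mulVec, dotProduct_sub, star_dotProduct_secondMoment hA hG,
    star_dotProduct_mul_conjTranspose_mulVec, ← Complex.ofReal_sub, Complex.ofReal_re]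
  simp_rw [integral_norm_sub_sq (memLp_vecMul hA _ _), integral_vecMul hA]
  rw [Finset.sum_sub_distrib, Finset.sum_add_distrib]
  ring

lemma noiseCov_isHermitian : (noiseCov Q A G).IsHermitian := by
  refine Matrix.IsHermitian.sub ?_ (Matrix.isHermitian_mul_conjTranspose_self _)
  ext i j
  simp only [secondMoment, matExp, Matrix.conjTranspose_apply, Matrix.of_apply, RCLike.star_def]
  rw [← integral_conj]
  congr 1
  ext e
  have : (A e * (A e)ᴴ + G e * (G e)ᴴ).IsHermitian :=
    (Matrix.isHermitian_mul_conjTranspose_self _).add (Matrix.isHermitian_mul_conjTranspose_self _)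
  exact this.apply i j

lemma noise_le_star_dotProduct_noiseCov (hA : ∀ i j, MemLp (fun e => A e i j) 2 Q)
    (hG : ∀ i j, MemLp (fun e => G e i j) 2 Q) (u : ι → ℂ) :
    ∑ l, ∫ e, ‖(star u ᵥ* G e) l‖ ^ 2 ∂Q ≤ (star u ⬝ᵥ (noiseCov Q A G *ᵥ u)).re := by
  -- With the target equal to the mean the bias vanishes, and `noiseCov` exceeds the second moment
  -- of `G` by the covariance of `A`.
  have h := sum_integral_add_eq hA hG u (star u ᵥ* matExp Q A)
  simp only [sub_self, norm_zero, ne_eq, OfNat.ofNat_ne_zero, not_false_eq_true, zero_pow,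
    Finset.sum_const_zero, zero_add] at h
  rw [← h]
  exact le_add_of_nonneg_left (Finset.sum_nonneg fun j _ => integral_nonneg fun e => by positivity)

lemma noiseCov_dotProduct_eq_re (u : ι → ℂ) :
    star u ⬝ᵥ (noiseCov Q A G *ᵥ u) = ((star u ⬝ᵥ (noiseCov Q A G *ᵥ u)).re : ℂ) :=
  Complex.ext rfl (by simpa using noiseCov_isHermitian.im_star_dotProduct_mulVec_self u)

lemma noiseCov_posSemidef (hA : ∀ i j, MemLp (fun e => A e i j) 2 Q)
    (hG : ∀ i j, MemLp (fun e => G e i j) 2 Q) : (noiseCov Q A G).PosSemidef := by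
  refine .of_dotProduct_mulVec_nonneg noiseCov_isHermitian fun u => ?_
  rw [noiseCov_dotProduct_eq_re]
  refine Complex.zero_le_real.2 (le_trans ?_ (noise_le_star_dotProduct_noiseCov hA hG u))
  exact Finset.sum_nonneg fun j _ => integral_nonneg fun e => by positivity

/-- If the noise channel `G` contains white noise of unit power, `noiseCov` is positive definite. -/
lemma noiseCov_posDef (hA : ∀ i j, MemLp (fun e => A e i j) 2 Q)
    (hG : ∀ i j, MemLp (fun e => G e i j) 2 Q)
    (hGone : ∀ᵐ e ∂Q, ∀ u : ι → ℂ, ∑ i, ‖u i‖ ^ 2 ≤ ∑ l, ‖(star u ᵥ* G e) l‖ ^ 2) :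
    (noiseCov Q A G).PosDef := by
  refine .of_dotProduct_mulVec_pos noiseCov_isHermitian fun u hu => ?_
  rw [noiseCov_dotProduct_eq_re]
  refine Complex.zero_lt_real.2 (lt_of_lt_of_le ?_ (noise_le_star_dotProduct_noiseCov hA hG u))
  have hGi : ∀ j, Integrable (fun e => ‖(star u ᵥ* G e) j‖ ^ 2) Q := fun j =>
    (memLp_vecMul hG _ j).integrable_norm_pow two_ne_zero
  rw [← integral_finsetSum _ fun l _ => hGi l]
  have hpos : 0 < ∑ i, ‖u i‖ ^ 2 := by
    obtain ⟨i, hi⟩ := Function.ne_iff.1 hu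
    exact Finset.sum_pos' (fun _ _ => by positivity)
      ⟨i, Finset.mem_univ _, by have := norm_pos_iff.2 hi; positivity⟩
  calc 0 < ∫ _, ∑ i, ‖u i‖ ^ 2 ∂Q := by simpa using hpos
    _ ≤ _ := integral_mono_ae (integrable_const _) (integrable_finsetSum _ fun l _ => hGi l)
      (hGone.mono fun e he => he u)

/-- Optimizing the weight `t` in the arithmetic-geometric mean inequality yields Cauchy-Schwarz. The
weighted form can be applied pointwise under a sum and an integral at once. -/
lemma sq_le_mul_of_forall {c g r : ℝ} (hc : 0 ≤ c) (hg : 0 ≤ g) (hr : 0 ≤ r)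
    (h : ∀ t : ℝ, 0 < t → 2 * c ≤ t * g + t⁻¹ * r) : c ^ 2 ≤ g * r := by
  rcases eq_or_lt_of_le hc with h0 | h0
  · rw [← h0, zero_pow two_ne_zero]
    positivity
  have hr1 : 0 < r := by
    by_contra hcon
    have hr0 : r = 0 := le_antisymm (not_lt.1 hcon) hr
    -- If `r = 0`, this small `t` gives `2 c ≤ c g / (g + 1)`, impossible for `c > 0`. Otherwise `t
    -- = r / c` below balances the bound.
    have := h (c / (g + 1)) (by positivity)
    rw [hr0, mul_zero, add_zero, div_mul_eq_mul_div, le_div_iff₀ (by positivity)] at this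
    nlinarith
  have := h (r / c) (by positivity)
  rw [inv_div, div_mul_cancel₀ _ hr1.ne', div_mul_eq_mul_div] at this
  have h3 : c ≤ r * g / c := by linarith
  rw [le_div_iff₀ h0] at h3
  nlinarith

/-- Cauchy-Schwarz: if the signal channel factors through the noise channel, then the effective
channel is dominated by the noise covariance. -/
lemma norm_sq_dotProduct_matExp_le (hA : ∀ i j, MemLp (fun e => A e i j) 2 Q)
    (hG : ∀ i j, MemLp (fun e => G e i j) 2 Q) (hR : ∀ i j, MemLp (fun e => R e i j) 2 Q)
    (hAGR : ∀ᵐ e ∂Q, A e = G e * R e) (k : Fin n) (u : ι → ℂ) :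
    ‖star u ⬝ᵥ fun i => matExp Q A i k‖ ^ 2 ≤
      (star u ⬝ᵥ (noiseCov Q A G *ᵥ u)).re * ∑ l, ∫ e, ‖R e l k‖ ^ 2 ∂Q := by
  have hGm := fun l => memLp_vecMul hG (star u) l
  have hGi : ∀ j, Integrable (fun e => ‖(star u ᵥ* G e) j‖ ^ 2) Q := fun j =>
    (hGm j).integrable_norm_pow two_ne_zero
  have hRi : ∀ j, Integrable (fun e => ‖R e j k‖ ^ 2) Q := fun j =>
    (hR j k).integrable_norm_pow two_ne_zero
  set a := (star u ⬝ᵥ (noiseCov Q A G *ᵥ u)).re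
  set r := ∑ l, ∫ e, ‖R e l k‖ ^ 2 ∂Q with hrdef
  set c := ‖star u ⬝ᵥ fun i => matExp Q A i k‖ with hcdef
  set g := ∑ l, ∫ e, ‖(star u ᵥ* G e) l‖ ^ 2 ∂Q with hgdef
  have hga : g ≤ a := noise_le_star_dotProduct_noiseCov hA hG u
  have hr0 : 0 ≤ r := Finset.sum_nonneg fun j _ => integral_nonneg fun e => by positivity
  -- The factorization `uᴴ A = (uᴴ G) R` exhibits the effective channel as an inner product of the
  -- filtered noise channel with a column of `R`.
  have hc : (star u ⬝ᵥ fun i => matExp Q A i k) =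
      ∫ e, ∑ l, (star u ᵥ* G e) l * R e l k ∂Q := by
    have h1 := integral_vecMul hA (star u) k
    refine Eq.trans h1.symm (integral_congr_ae ?_)
    filter_upwards [hAGR] with e he
    rw [he, ← Matrix.vecMul_vecMul]
    rfl
  have hmulint : ∀ l, Integrable (fun e => (star u ᵥ* G e) l * R e l k) Q := fun l =>
    (hGm l).integrable_mul (hR l k)
  have hle : ∀ t : ℝ, 0 < t → 2 * c ≤ t * g + t⁻¹ * r := by
    intro t ht
    have hnorm : c ≤ ∫ e, ∑ l, ‖(star u ᵥ* G e) l‖ * ‖R e l k‖ ∂Q := by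
      rw [hcdef, hc]
      refine (norm_integral_le_integral_norm _).trans (integral_mono_of_nonneg
        (ae_of_all _ fun _ => norm_nonneg _)
        (integrable_finsetSum _ fun l _ => by simpa using (hmulint l).norm)
        (ae_of_all _ fun e => ?_))
      exact (norm_sum_le _ _).trans_eq (Finset.sum_congr rfl fun l _ => norm_mul _ _)
    have hint2 : ∫ e, ∑ l, ‖(star u ᵥ* G e) l‖ * ‖R e l k‖ ∂Q ≤
        ∫ e, ∑ l, (t / 2 * ‖(star u ᵥ* G e) l‖ ^ 2 + t⁻¹ / 2 * ‖R e l k‖ ^ 2) ∂Q := by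
      refine integral_mono (integrable_finsetSum _ fun l _ => by simpa using (hmulint l).norm)
        (integrable_finsetSum _ fun l _ => ((hGi l).const_mul _).add ((hRi l).const_mul _))
        fun e => Finset.sum_le_sum fun l _ => ?_
      have h := two_mul_le_add_sq (√t * ‖(star u ᵥ* G e) l‖) (√t⁻¹ * ‖R e l k‖)
      rw [mul_pow, mul_pow, Real.sq_sqrt ht.le, Real.sq_sqrt (inv_pos.2 ht).le] at h
      have h2 : √t * √t⁻¹ = 1 := by
        rw [← Real.sqrt_mul ht.le, mul_inv_cancel₀ ht.ne', Real.sqrt_one]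
      have h3 : 2 * (√t * ‖(star u ᵥ* G e) l‖) * (√t⁻¹ * ‖R e l k‖) =
        2 * (√t * √t⁻¹) * (‖(star u ᵥ* G e) l‖ * ‖R e l k‖) := by ring
      rw [h3, h2] at h
      linarith
    have hi : ∀ l, Integrable (fun e => t / 2 * ‖(star u ᵥ* G e) l‖ ^ 2 +
        t⁻¹ / 2 * ‖R e l k‖ ^ 2) Q := fun l => ((hGi l).const_mul _).add ((hRi l).const_mul _)
    rw [integral_finsetSum _ fun l _ => hi l,
      Finset.sum_congr rfl fun l _ => integral_add ((hGi l).const_mul _) ((hRi l).const_mul _)]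
      at hint2
    simp_rw [integral_const_mul] at hint2
    rw [Finset.sum_add_distrib, ← Finset.mul_sum, ← Finset.mul_sum, ← hgdef, ← hrdef] at hint2
    linarith
  have hg0 : 0 ≤ g := Finset.sum_nonneg fun j _ => integral_nonneg fun e => by positivity
  exact (sq_le_mul_of_forall (norm_nonneg _) hg0 hr0 hle).trans (by gcongr)

end SecondMoments


/-! ### Measurability of random matrices -/

section MatrixMeasurability

variable {α : Type*} {mα : MeasurableSpace α} {ι κ μ : Type*} [Fintype ι] [Fintype κ] [Fintype μ]

lemma measurable_matrix_mul {X : α → Matrix ι κ ℂ} {Y : α → Matrix κ μ ℂ}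
    (hX : ∀ i j, Measurable fun a => X a i j) (hY : ∀ i j, Measurable fun a => Y a i j) (i : ι)
    (j : μ) : Measurable fun a => (X a * Y a) i j := by
  simp only [Matrix.mul_apply]
  exact Finset.measurable_fun_sum _ fun l _ => (hX i l).mul (hY l j)

lemma measurable_matrix_conjTranspose {X : α → Matrix ι κ ℂ}
    (hX : ∀ i j, Measurable fun a => X a i j) (i : κ) (j : ι) :
    Measurable fun a => (X a)ᴴ i j :=
  Complex.continuous_conj.measurable.comp (hX j i)

lemma measurable_matrix_smul (c : ℂ) {X : α → Matrix ι κ ℂ}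
    (hX : ∀ i j, Measurable fun a => X a i j) (i : ι) (j : κ) :
    Measurable fun a => (c • X a) i j :=
  (hX i j).const_mul c

lemma measurable_matrix_add {X Y : α → Matrix ι κ ℂ} (hX : ∀ i j, Measurable fun a => X a i j)
    (hY : ∀ i j, Measurable fun a => Y a i j) (i : ι) (j : κ) :
    Measurable fun a => (X a + Y a) i j :=
  (hX i j).add (hY i j)

lemma measurable_matrix_mul_const {X : α → Matrix ι κ ℂ} (hX : ∀ i j, Measurable fun a => X a i j)
    (B : Matrix κ μ ℂ) (i : ι) (j : μ) : Measurable fun a => (X a * B) i j :=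
  measurable_matrix_mul hX (Y := fun _ => B) (fun _ _ => measurable_const) i j

lemma measurable_matrix_const_mul (B : Matrix ι κ ℂ) {Y : α → Matrix κ μ ℂ}
    (hY : ∀ i j, Measurable fun a => Y a i j) (i : ι) (j : μ) :
    Measurable fun a => (B * Y a) i j :=
  measurable_matrix_mul (X := fun _ => B) (fun _ _ => measurable_const) hY i j

lemma measurable_matrix_sum {δ : Type*} (s : Finset δ) {X : δ → α → Matrix ι κ ℂ}
    (hX : ∀ d i j, Measurable fun a => X d a i j) (i : ι) (j : κ) :
    Measurable fun a => (∑ d ∈ s, X d a) i j := by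
  simp only [Matrix.sum_apply]
  exact Finset.measurable_fun_sum _ fun d _ => hX d i j

lemma measurable_det [DecidableEq ι] {X : α → Matrix ι ι ℂ}
    (hX : ∀ i j, Measurable fun a => X a i j) : Measurable fun a => (X a).det := by
  simp only [Matrix.det_apply']
  exact Finset.measurable_fun_sum _ fun π _ =>
    (Finset.measurable_fun_prod _ fun i _ => hX _ _).const_mul _

/-- The adjugate formula, with `0⁻¹ = 0` for the determinant, is valid for singular matrices too. -/
lemma measurable_matrix_inv [DecidableEq ι] {X : α → Matrix ι ι ℂ}
    (hX : ∀ i j, Measurable fun a => X a i j) (i j : ι) : Measurable fun a => (X a)⁻¹ i j := by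
  simp only [Matrix.inv_def, Matrix.smul_apply, Ring.inverse_eq_inv', smul_eq_mul,
    Matrix.adjugate_apply]
  refine (measurable_det hX).inv.mul (measurable_det fun i' j' => ?_)
  simp only [Matrix.updateRow_apply]
  split_ifs
  · exact measurable_const
  · exact hX _ _

variable {n : ℕ}

lemma measurable_sicFilter [DecidableEq ι] {H : α → Matrix ι (Fin n) ℂ} {Ψ : α → Matrix ι ι ℂ}
    (hH : ∀ i j, Measurable fun a => H a i j) (hΨ : ∀ i j, Measurable fun a => Ψ a i j)
    (σ : Equiv.Perm (Fin n)) (k : Fin n) (i : ι) :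
    Measurable fun a => sicFilter (H a) (Ψ a) σ k i := by
  simp only [sicFilter, Matrix.mulVec, dotProduct]
  refine Finset.measurable_fun_sum _ fun l _ => (measurable_matrix_inv (fun i' j' => ?_) i l).mul
    (hH l k)
  simp only [sicCov, Matrix.add_apply, Matrix.sum_apply, Matrix.vecMulVec_apply]
  exact (Finset.measurable_fun_sum _ fun j _ => (hH i' j).mul
    (Complex.continuous_conj.measurable.comp (hH j' j))).add (hΨ i' j')

lemma measurable_sicErr [DecidableEq ι] {H : α → Matrix ι (Fin n) ℂ} {Ψ : α → Matrix ι ι ℂ}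
    (hH : ∀ i j, Measurable fun a => H a i j) (hΨ : ∀ i j, Measurable fun a => Ψ a i j)
    (σ : Equiv.Perm (Fin n)) (k : Fin n) :
    Measurable fun a => sicErr (H a) (Ψ a) σ k := by
  simp only [sicErr, dotProduct]
  exact measurable_const.sub (Complex.measurable_re.comp (Finset.measurable_fun_sum _ fun i _ =>
    (Complex.continuous_conj.measurable.comp (measurable_sicFilter hH hΨ σ k i)).mul (hH i k)))

lemma measurable_sicOutput [DecidableEq ι] {H : α → Matrix ι (Fin n) ℂ} {Ψ : α → Matrix ι ι ℂ}
    {x : α → Fin n → ℂ} {y : α → ι → ℂ}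
    (hH : ∀ i j, Measurable fun a => H a i j) (hΨ : ∀ i j, Measurable fun a => Ψ a i j)
    (hx : ∀ j, Measurable fun a => x a j) (hy : ∀ i, Measurable fun a => y a i)
    (σ : Equiv.Perm (Fin n)) (k : Fin n) :
    Measurable fun a => sicOutput (H a) (Ψ a) σ k (x a) (y a) := by
  simp only [sicOutput, dotProduct, Pi.sub_apply, Finset.sum_apply, Pi.smul_apply, smul_eq_mul]
  exact Finset.measurable_fun_sum _ fun i _ =>
    (Complex.continuous_conj.measurable.comp (measurable_sicFilter hH hΨ σ k i)).mul
      ((hy i).sub (Finset.measurable_fun_sum _ fun j _ => (hx j).mul (hH i j)))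

end MatrixMeasurability

/-! ### Integration against independent and conditionally distributed variables -/

section Disintegration

variable {Ω : Type*} [MeasurableSpace Ω] {P : Measure Ω} [IsProbabilityMeasure P]

lemma lintegral_comp_of_indepFun {α β : Type*} [MeasurableSpace α] [MeasurableSpace β]
    {X : Ω → α} {Y : Ω → β} (hX : Measurable X) (hY : Measurable Y) (h : IndepFun X Y P)
    {Φ : α → β → ℝ≥0∞} (hΦ : Measurable fun q : α × β => Φ q.1 q.2) :
    ∫⁻ ω, Φ (X ω) (Y ω) ∂P = ∫⁻ ω, ∫⁻ ω', Φ (X ω) (Y ω') ∂P ∂P := by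
  have hmap := (indepFun_iff_map_prod_eq_prod_map_map hX.aemeasurable hY.aemeasurable).1 h
  have := Measure.isProbabilityMeasure_map (μ := P) hY.aemeasurable
  calc ∫⁻ ω, Φ (X ω) (Y ω) ∂P
      = ∫⁻ q, Φ q.1 q.2 ∂(P.map fun ω => (X ω, Y ω)) := by
        rw [lintegral_map hΦ (hX.prodMk hY)]
    _ = ∫⁻ a, ∫⁻ b, Φ a b ∂(P.map Y) ∂(P.map X) := by
        rw [hmap, lintegral_prod _ hΦ.aemeasurable]
    _ = ∫⁻ ω, ∫⁻ b, Φ (X ω) b ∂(P.map Y) ∂P := by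
        rw [lintegral_map hΦ.lintegral_prod_right' hX]
    _ = _ := by
        refine lintegral_congr fun ω => ?_
        rw [lintegral_map (f := Φ (X ω)) (hΦ.comp measurable_prodMk_left) hY]

variable {𝓣 E : Type*} [MeasurableSpace 𝓣] [MeasurableSpace E] [StandardBorelSpace E] [Nonempty E]

lemma lintegral_comp_condDistrib {Θ : Ω → 𝓣} {Z : Ω → E} (hΘ : Measurable Θ) (hZ : Measurable Z)
    {Φ : 𝓣 → E → ℝ≥0∞} (hΦ : Measurable fun q : 𝓣 × E => Φ q.1 q.2) :
    ∫⁻ ω, Φ (Θ ω) (Z ω) ∂P = ∫⁻ ω, ∫⁻ e, Φ (Θ ω) e ∂(condDistrib Z Θ P (Θ ω)) ∂P := by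
  calc ∫⁻ ω, Φ (Θ ω) (Z ω) ∂P
      = ∫⁻ q, Φ q.1 q.2 ∂(P.map fun ω => (Θ ω, Z ω)) := by
        rw [lintegral_map hΦ (hΘ.prodMk hZ)]
    _ = ∫⁻ θ, ∫⁻ e, Φ θ e ∂(condDistrib Z Θ P θ) ∂(P.map Θ) := by
        rw [← compProd_map_condDistrib hZ.aemeasurable, Measure.lintegral_compProd hΦ]
    _ = _ := by
        rw [lintegral_map (Measurable.lintegral_kernel_prod_right' hΦ) hΘ]

/-- A regular conditional law of the state turns conditional expectations into integrals over a
probability measure for each value of the side information, so that the moment identities and the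
linear algebra apply for each such value. -/
lemma matCondExp_ae_eq_matExp_condDistrib {Θ : Ω → 𝓣} {Z : Ω → E} (hΘ : Measurable Θ)
    (hZ : Measurable Z) {ι κ : Type*} [Finite ι] [Finite κ] {B : E → Matrix ι κ ℂ}
    (hB : ∀ i j, Measurable fun e => B e i j)
    (hint : ∀ i j, Integrable (fun ω => B (Z ω) i j) P) :
    ∀ᵐ ω ∂P, matCondExp P Θ (fun ω' => B (Z ω')) ω = matExp (condDistrib Z Θ P (Θ ω)) B := by
  have h : ∀ i j, ∀ᵐ ω ∂P, (P[fun ω' => B (Z ω') i j | MeasurableSpace.comap Θ inferInstance]) ω =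
      ∫ e, B e i j ∂(condDistrib Z Θ P (Θ ω)) := fun i j =>
    condExp_prod_ae_eq_integral_condDistrib' (f := fun q : 𝓣 × E => B q.2 i j) hΘ hZ.aemeasurable
      (((integrable_map_measure (f := fun ω => (Θ ω, Z ω)) (μ := P)
        (g := fun q : 𝓣 × E => B q.2 i j) ((hB i j).comp measurable_snd).aestronglyMeasurable
          (hΘ.prodMk hZ).aemeasurable)).2 (hint i j))
  have h' : ∀ᵐ ω ∂P, ∀ i j, (P[fun ω' => B (Z ω') i j |
      MeasurableSpace.comap Θ inferInstance]) ω =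
      ∫ e, B e i j ∂(condDistrib Z Θ P (Θ ω)) := ae_all_iff.2 fun i => ae_all_iff.2 fun j => h i j
  filter_upwards [h'] with ω hω
  ext i j
  exact hω i j

lemma measurable_matExp_condDistrib {Θ : Ω → 𝓣} {Z : Ω → E} {ι κ : Type*} {B : E → Matrix ι κ ℂ}
    (hB : ∀ i j, Measurable fun e => B e i j) (i : ι) (j : κ) :
    Measurable fun θ => matExp (condDistrib Z Θ P θ) B i j :=
  (StronglyMeasurable.integral_condDistrib (f := fun q : 𝓣 × E => B q.2 i j)
    ((hB i j).comp measurable_snd).stronglyMeasurable).measurable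

lemma memLp_two_condDistrib {Θ : Ω → 𝓣} {Z : Ω → E} (hΘ : Measurable Θ)
    (hZ : Measurable Z) {f : E → ℂ} (hf : Measurable f) (hint : MemLp (fun ω => f (Z ω)) 2 P) :
    ∀ᵐ ω ∂P, MemLp f 2 (condDistrib Z Θ P (Θ ω)) := by
  have h := Integrable.condDistrib_ae (μ := P) (X := Θ) (Y := Z)
    (f := fun q : 𝓣 × E => ‖f q.2‖ ^ 2) hΘ.aemeasurable hZ.aemeasurable
    ((integrable_map_measure ((hf.comp measurable_snd).norm.pow_const 2).aestronglyMeasurable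
      (hΘ.prodMk hZ).aemeasurable).2 (hint.integrable_norm_pow two_ne_zero))
  filter_upwards [h] with ω hω
  exact (memLp_two_iff_integrable_sq_norm hf.aestronglyMeasurable).2 hω

end Disintegration


/-! ### Fading channels with side information -/

section FadingChannel

variable {Ω 𝓣 E : Type*} [MeasurableSpace Ω] [MeasurableSpace 𝓣] [MeasurableSpace E]
  {ι κ : Type*} [Fintype ι] [Fintype κ] [DecidableEq κ]
  {n T : ℕ}

/-- The error of the filter output is linear in the symbols and the noise. -/
lemma sub_sicOutput_eq [DecidableEq ι] (H : Matrix ι (Fin n) ℂ) (Ψ : Matrix ι ι ℂ)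
    (σ : Equiv.Perm (Fin n))
    (k : Fin n) (B : Matrix ι (Fin n) ℂ) (C : Matrix ι κ ℂ) (a : Fin n → ℂ) (c : κ → ℂ) :
    a k - sicOutput H Ψ σ k a (B *ᵥ a + C *ᵥ c) =
      ∑ j, ((if j = k then 1 else 0) + (if σ j < σ k then star (sicFilter H Ψ σ k) ⬝ᵥ
        (fun i => H i j) else 0) - (star (sicFilter H Ψ σ k) ᵥ* B) j) * a j -
      ∑ l, (star (sicFilter H Ψ σ k) ᵥ* C) l * c l := by
  rw [sicOutput, dotProduct_sub, dotProduct_add, Matrix.dotProduct_mulVec,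
    Matrix.dotProduct_mulVec, dotProduct_sum]
  simp_rw [dotProduct_smul, sub_mul, add_mul, Finset.sum_sub_distrib, Finset.sum_add_distrib]
  rw [Finset.sum_filter]
  simp only [ite_mul, one_mul, zero_mul, Finset.sum_ite_eq', Finset.mem_univ, if_true, smul_eq_mul]
  simp only [dotProduct, mul_comm]
  ring

/-- The block fading channel `y t = A x t + G v t`, whose matrices are functions of a random state
`Z`, with side information `Θ`, Gaussian symbols `x` and noise `v`. The signal channel factors
through the noise channel as `A = G R`. -/
structure IsFadingChannel (P : Measure Ω) (Θ : Ω → 𝓣) (Z : Ω → E) (A : E → Matrix ι (Fin n) ℂ)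
    (G : E → Matrix ι κ ℂ) (R : E → Matrix κ (Fin n) ℂ) (x : Fin T → Ω → Fin n → ℂ)
    (v : Fin T → Ω → κ → ℂ) : Prop where
  measurable_side : Measurable Θ
  measurable_state : Measurable Z
  measurable_signal : ∀ i j, Measurable fun e => A e i j
  measurable_noise : ∀ i j, Measurable fun e => G e i j
  measurable_factor : ∀ i j, Measurable fun e => R e i j
  memLp_signal : ∀ i j, MemLp (fun ω => A (Z ω) i j) 2 P
  memLp_noise : ∀ i j, MemLp (fun ω => G (Z ω) i j) 2 P
  memLp_factor : ∀ i j, MemLp (fun ω => R (Z ω) i j) 2 P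
  signal_eq : ∀ e, A e = G e * R e
  measurable_x : ∀ t j, Measurable fun ω => x t ω j
  measurable_v : ∀ t l, Measurable fun ω => v t ω l
  law_x : P.map (fun ω (q : Fin T × Fin n) => x q.1 ω q.2) = Measure.pi fun _ => stdComplexGaussian
  memLp_v : ∀ t l, MemLp (fun ω => v t ω l) 2 P
  cov_v : ∀ t l l', ∫ ω, v t ω l * conj (v t ω l') ∂P = if l = l' then 1 else 0
  cov_xv : ∀ t j l, ∫ ω, x t ω j * conj (v t ω l) ∂P = 0
  indep : IndepFun (fun ω => (Z ω, Θ ω)) (fun ω => ((fun t => x t ω), (fun t => v t ω))) P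

namespace IsFadingChannel

variable {P : Measure Ω} [IsProbabilityMeasure P] {Θ : Ω → 𝓣} {Z : Ω → E}
  {A : E → Matrix ι (Fin n) ℂ} {G : E → Matrix ι κ ℂ} {R : E → Matrix κ (Fin n) ℂ}
  {x : Fin T → Ω → Fin n → ℂ} {v : Fin T → Ω → κ → ℂ}

/-! ### Second moments of symbols and noise -/

section Moments

variable (h : IsFadingChannel P Θ Z A G R x v)
include h

lemma map_x_apply (t : Fin T) (j : Fin n) : P.map (fun ω => x t ω j) = stdComplexGaussian := by
  have hm : Measurable fun ω (q : Fin T × Fin n) => x q.1 ω q.2 :=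
    measurable_pi_lambda _ fun q => h.measurable_x q.1 q.2
  have h1 := (measurePreserving_eval (fun _ : Fin T × Fin n => stdComplexGaussian) (t, j)).map_eq
  rw [← h.law_x, Measure.map_map (measurable_pi_apply _) hm] at h1
  exact h1

lemma memLp_x (t : Fin T) (j : Fin n) : MemLp (fun ω => x t ω j) 2 P := by
  have h1 := memLp_id_stdComplexGaussian 2
  rw [← h.map_x_apply t j, memLp_map_measure_iff aestronglyMeasurable_id
    (h.measurable_x t j).aemeasurable] at h1
  exact h1

lemma integral_norm_sq_x (t : Fin T) (j : Fin n) : ∫ ω, ‖x t ω j‖ ^ 2 ∂P = 1 := by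
  rw [← integral_norm_sq_stdComplexGaussian, ← h.map_x_apply t j,
    integral_map (h.measurable_x t j).aemeasurable (by fun_prop)]

lemma iIndepFun_x : iIndepFun (fun (q : Fin T × Fin n) ω => x q.1 ω q.2) P := by
  rw [iIndepFun_iff_map_fun_eq_pi_map (f := fun (q : Fin T × Fin n) ω => x q.1 ω q.2) fun q =>
    (h.measurable_x q.1 q.2).aemeasurable, h.law_x]
  congr 1
  ext1 q
  exact (h.map_x_apply q.1 q.2).symm

lemma map_stream (k : Fin n) :
    P.map (fun ω t => x t ω k) = Measure.pi fun _ : Fin T => stdComplexGaussian := by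
  have h1 := h.iIndepFun_x.precomp (g := fun t : Fin T => (t, k)) fun t t' ht => by simpa using ht
  rw [iIndepFun_iff_map_fun_eq_pi_map (f := fun (t : Fin T) ω => x t ω k) fun t =>
    (h.measurable_x t k).aemeasurable] at h1
  rw [h1]
  congr 1
  ext1 t
  exact h.map_x_apply t k

lemma cov_x (t : Fin T) (j j' : Fin n) :
    ∫ ω, x t ω j * conj (x t ω j') ∂P = if j = j' then 1 else 0 := by
  split_ifs with hj
  · subst hj
    simp_rw [Complex.mul_conj, Complex.normSq_eq_norm_sq]
    rw [integral_complex_ofReal, h.integral_norm_sq_x, Complex.ofReal_one]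
  · have h2 : IndepFun (fun ω => x t ω j) (fun ω => conj (x t ω j')) P :=
      (h.iIndepFun_x.indepFun (i := (t, j)) (j := (t, j')) (by simpa using hj)).comp measurable_id
        Complex.continuous_conj.measurable
    rw [h2.integral_fun_mul_eq_mul_integral (h.measurable_x t j).aestronglyMeasurable
      (Complex.continuous_conj.measurable.comp (h.measurable_x t j')).aestronglyMeasurable]
    have h3 : ∫ ω, x t ω j ∂P = 0 := by
      rw [← integral_id_stdComplexGaussian, ← h.map_x_apply t j,
        integral_map (h.measurable_x t j).aemeasurable (by fun_prop)]
    rw [h3, zero_mul]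

/-- The stacked vector of symbols and noise is white. Neither independence nor Gaussianity of the
noise is used. -/
lemma integral_norm_sq_comb (t : Fin T) (a : Fin n → ℂ) (c : κ → ℂ) :
    ∫ ω, ‖∑ j, a j * x t ω j - ∑ l, c l * v t ω l‖ ^ 2 ∂P =
      ∑ j, ‖a j‖ ^ 2 + ∑ l, ‖c l‖ ^ 2 := by
  set z : Fin n ⊕ κ → Ω → ℂ := Sum.elim (fun j ω => x t ω j) (fun l ω => v t ω l) with hz
  set b : Fin n ⊕ κ → ℂ := Sum.elim a (-c) with hb
  have hzm : ∀ i, MemLp (z i) 2 P := by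
    rintro (j | l)
    · exact h.memLp_x t j
    · exact h.memLp_v t l
  have hcov : ∀ i i', ∫ ω, z i ω * conj (z i' ω) ∂P = if i = i' then 1 else 0 := by
    rintro (j | l) (j' | l')
    · simpa [hz] using h.cov_x t j j'
    · simpa [hz] using h.cov_xv t j l'
    · have h1 := h.cov_xv t j' l
      have h2 : ∫ ω, conj (x t ω j' * conj (v t ω l)) ∂P = 0 := by
        rw [integral_conj, h1, map_zero]
      simpa [hz, mul_comm] using h2
    · simpa [hz] using h.cov_v t l l'
  have hsum : ∀ ω, ∑ j, a j * x t ω j - ∑ l, c l * v t ω l = ∑ i, b i * z i ω := fun ω => by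
    simp [Fintype.sum_sum_type, hb, hz, sub_eq_add_neg]
  have hnorm : ∀ ω, ((‖∑ i, b i * z i ω‖ ^ 2 : ℝ) : ℂ) =
      ∑ i, ∑ i', b i * conj (b i') * (z i ω * conj (z i' ω)) := fun ω => by
    rw [← Complex.normSq_eq_norm_sq, ← Complex.mul_conj, map_sum, Finset.sum_mul_sum]
    refine Finset.sum_congr rfl fun i _ => Finset.sum_congr rfl fun i' _ => ?_
    rw [map_mul]
    ring
  have hC : ((∫ ω, ‖∑ i, b i * z i ω‖ ^ 2 ∂P : ℝ) : ℂ) = ((∑ i, ‖b i‖ ^ 2 : ℝ) : ℂ) := by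
    rw [← integral_complex_ofReal]
    simp_rw [hnorm]
    have hi : ∀ i i', Integrable (fun ω => b i * conj (b i') * (z i ω * conj (z i' ω))) P :=
      fun i i' => (integrable_mul_conj (hzm i) (hzm i')).const_mul _
    rw [integral_finsetSum _ fun i _ => integrable_finsetSum _ fun i' _ => hi i i']
    push_cast
    refine Finset.sum_congr rfl fun i _ => ?_
    rw [integral_finsetSum _ fun i' _ => hi i i']
    simp_rw [integral_const_mul, hcov]
    simp [Complex.mul_conj, Complex.normSq_eq_norm_sq]
  simp_rw [hsum]
  rw [Complex.ofReal_inj.1 hC, Fintype.sum_sum_type]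
  simp [hb]

lemma lintegral_norm_sq_comb (t : Fin T) (a : Fin n → ℂ) (c : κ → ℂ) :
    ∫⁻ ω, ENNReal.ofReal (‖∑ j, a j * x t ω j - ∑ l, c l * v t ω l‖ ^ 2) ∂P =
      ENNReal.ofReal (∑ j, ‖a j‖ ^ 2 + ∑ l, ‖c l‖ ^ 2) := by
  rw [← h.integral_norm_sq_comb t a c, ofReal_integral_eq_lintegral_ofReal _
    (ae_of_all _ fun _ => by positivity)]
  exact ((memLp_finsetSum _ fun j _ => (h.memLp_x t j).const_mul (a j)).sub
    (memLp_finsetSum _ fun l _ => (h.memLp_v t l).const_mul (c l))).integrable_norm_pow two_ne_zero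

end Moments

/-! ### The receiver as a function of the side information -/

section Receiver

variable [StandardBorelSpace E] [Nonempty E] [DecidableEq ι]

variable (P Θ Z A G) in
/-- Effective channel given the value `θ` of the side information. -/
def effChannel (θ : 𝓣) : Matrix ι (Fin n) ℂ := matExp (condDistrib Z Θ P θ) A

variable (P Θ Z A G) in
/-- Interference-plus-noise covariance given the value `θ` of the side information. -/
def effCov (θ : 𝓣) : Matrix ι ι ℂ := noiseCov (condDistrib Z Θ P θ) A G

variable (P Θ Z A G) in
/-- Mean square error of stream `k` given the value `θ` of the side information. -/
def effErr (σ : Equiv.Perm (Fin n)) (k : Fin n) (θ : 𝓣) : ℝ :=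
  sicErr (effChannel P Θ Z A θ) (effCov P Θ Z A G θ) σ k

variable (P Θ Z A G) in
/-- Values of the side information at which the MMSE-SIC receiver is nondegenerate. -/
def regularSet (σ : Equiv.Perm (Fin n)) : Set 𝓣 :=
  {θ | (effCov P Θ Z A G θ).det ≠ 0 ∧ ∀ k, 0 < effErr P Θ Z A G σ k θ}

variable (h : IsFadingChannel P Θ Z A G R x v)
include h

lemma measurable_effChannel (i : ι) (j : Fin n) :
    Measurable fun θ => effChannel P Θ Z A θ i j :=
  measurable_matExp_condDistrib h.measurable_signal i j

lemma measurable_effCov (i j : ι) : Measurable fun θ => effCov P Θ Z A G θ i j := by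
  have h1 := measurable_matrix_mul h.measurable_effChannel
    (measurable_matrix_conjTranspose h.measurable_effChannel) i j
  refine Measurable.sub (measurable_matExp_condDistrib (fun i j => ?_) i j) h1
  exact (measurable_matrix_mul h.measurable_signal
    (measurable_matrix_conjTranspose h.measurable_signal) i j).add
    (measurable_matrix_mul h.measurable_noise
    (measurable_matrix_conjTranspose h.measurable_noise) i j)

lemma measurable_effErr (σ : Equiv.Perm (Fin n)) (k : Fin n) :
    Measurable (effErr P Θ Z A G σ k) :=
  measurable_sicErr h.measurable_effChannel h.measurable_effCov σ k

lemma measurableSet_regularSet (σ : Equiv.Perm (Fin n)) :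
    MeasurableSet (regularSet P Θ Z A G σ) :=
  ((measurable_det h.measurable_effCov) (measurableSet_singleton 0).compl).inter
    (MeasurableSet.congr (s := ⋂ k, effErr P Θ Z A G σ k ⁻¹' Set.Ioi 0)
      (MeasurableSet.iInter fun k => h.measurable_effErr σ k measurableSet_Ioi)
      (by ext; simp; rfl))

lemma ae_memLp_signal : ∀ᵐ ω ∂P, ∀ i j, MemLp (fun e => A e i j) 2 (condDistrib Z Θ P (Θ ω)) :=
  ae_all_iff.2 fun i => ae_all_iff.2 fun j =>
    memLp_two_condDistrib h.measurable_side h.measurable_state (h.measurable_signal i j)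
      (h.memLp_signal i j)

lemma ae_memLp_noise : ∀ᵐ ω ∂P, ∀ i j, MemLp (fun e => G e i j) 2 (condDistrib Z Θ P (Θ ω)) :=
  ae_all_iff.2 fun i => ae_all_iff.2 fun j =>
    memLp_two_condDistrib h.measurable_side h.measurable_state (h.measurable_noise i j)
      (h.memLp_noise i j)

lemma ae_memLp_factor : ∀ᵐ ω ∂P, ∀ i j, MemLp (fun e => R e i j) 2 (condDistrib Z Θ P (Θ ω)) :=
  ae_all_iff.2 fun i => ae_all_iff.2 fun j =>
    memLp_two_condDistrib h.measurable_side h.measurable_state (h.measurable_factor i j)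
      (h.memLp_factor i j)

lemma ae_effCov_posSemidef : ∀ᵐ ω ∂P, (effCov P Θ Z A G (Θ ω)).PosSemidef := by
  filter_upwards [h.ae_memLp_signal, h.ae_memLp_noise] with ω hA hG
  exact noiseCov_posSemidef hA hG

lemma ae_effCov_posDef (hG : ∀ e (u : ι → ℂ), ∑ i, ‖u i‖ ^ 2 ≤ ∑ l, ‖(star u ᵥ* G e) l‖ ^ 2) :
    ∀ᵐ ω ∂P, (effCov P Θ Z A G (Θ ω)).PosDef := by
  filter_upwards [h.ae_memLp_signal, h.ae_memLp_noise] with ω hA hG'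
  exact noiseCov_posDef hA hG' (ae_of_all _ hG)

/-- A positive semidefinite matrix is definite iff invertible. The regular set is cut out by
determinant and errors rather than by definiteness, so that it is measurable and the errors are
positive at every point of it, not just almost everywhere: the moment condition on the test function
is required for every value of the side information. -/
lemma ae_posDef_of_mem (σ : Equiv.Perm (Fin n)) :
    ∀ᵐ ω ∂P, (Θ ω ∈ regularSet P Θ Z A G σ ↔ (effCov P Θ Z A G (Θ ω)).PosDef) := by
  filter_upwards [h.ae_effCov_posSemidef] with ω hω
  refine ⟨fun hmem => ?_, fun hpd => ⟨hpd.det_pos.ne', fun k => sicErr_pos _ σ k hpd⟩⟩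
  exact hω.posDef_iff_isUnit.2 ((Matrix.isUnit_iff_isUnit_det _).2 hmem.1.isUnit)

end Receiver

end IsFadingChannel

end FadingChannel


/-! ### Rates of the MMSE-SIC receiver over a fading channel -/

namespace IsFadingChannel

variable {Ω 𝓣 E : Type*} [MeasurableSpace Ω] [MeasurableSpace 𝓣] [MeasurableSpace E]
  [StandardBorelSpace E] [Nonempty E]
  {ι κ : Type*} [Fintype ι] [Fintype κ] [DecidableEq ι] [DecidableEq κ] {n T : ℕ}
  {P : Measure Ω} [IsProbabilityMeasure P] {Θ : Ω → 𝓣} {Z : Ω → E}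
  {A : E → Matrix ι (Fin n) ℂ} {G : E → Matrix ι κ ℂ} {R : E → Matrix κ (Fin n) ℂ}
  {x : Fin T → Ω → Fin n → ℂ} {v : Fin T → Ω → κ → ℂ}

variable (Z A G x v) in
/-- Received signal. -/
def received (t : Fin T) (ω : Ω) : ι → ℂ := A (Z ω) *ᵥ x t ω + G (Z ω) *ᵥ v t ω

variable (P Θ Z A G x v) in
/-- Output of the filter of stream `k`. -/
def filterOutput (σ : Equiv.Perm (Fin n)) (k : Fin n) (t : Fin T) (ω : Ω) : ℂ :=
  sicOutput (effChannel P Θ Z A (Θ ω)) (effCov P Θ Z A G (Θ ω)) σ k (x t ω)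
    (received Z A G x v t ω)

variable (P Θ Z A G) in
/-- Log-likelihood ratio of the Gaussian posterior and the prior of a symbol of stream `k`, for the
estimate `u`. -/
def posteriorLLR (σ : Equiv.Perm (Fin n)) (k : Fin n) (θ : 𝓣) (a u : ℂ) : ℝ :=
  (regularSet P Θ Z A G σ).indicator (fun θ => -Real.log (effErr P Θ Z A G σ k θ) + ‖a‖ ^ 2 -
    ‖a - u‖ ^ 2 / effErr P Θ Z A G σ k θ) θ

variable (P Θ Z A G) in
/-- Rate (in nats) of stream `k` given the value `θ` of the side information. -/
def streamRate (σ : Equiv.Perm (Fin n)) (k : Fin n) (θ : 𝓣) : ℝ :=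
  (regularSet P Θ Z A G σ).indicator (fun θ => -Real.log (effErr P Θ Z A G σ k θ)) θ

/-- On the regular set this is the mass of a Gaussian posterior; off it the test function is zero
and the integrand is `1`. -/
lemma lintegral_exp_posteriorLLR_le_one (σ : Equiv.Perm (Fin n)) (k : Fin n) (θ : 𝓣) (u : ℂ) :
    ∫⁻ a, ENNReal.ofReal (Real.exp (posteriorLLR P Θ Z A G σ k θ a u)) ∂stdComplexGaussian ≤ 1 := by
  by_cases hθ : θ ∈ regularSet P Θ Z A G σ
  · simp only [posteriorLLR, Set.indicator_of_mem hθ]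
    exact (lintegral_stdComplexGaussian_posterior (hθ.2 k) u).le
  · simp [posteriorLLR, Set.indicator_of_notMem hθ]

variable (h : IsFadingChannel P Θ Z A G R x v)
include h

lemma measurable_posteriorLLR (σ : Equiv.Perm (Fin n)) (k : Fin n) :
    Measurable fun q : 𝓣 × ℂ × ℂ => posteriorLLR P Θ Z A G σ k q.1 q.2.1 q.2.2 := by
  have hd : Measurable fun q : 𝓣 × ℂ × ℂ => effErr P Θ Z A G σ k q.1 :=
    (h.measurable_effErr σ k).comp measurable_fst
  have hm : Measurable fun q : 𝓣 × ℂ × ℂ => -Real.log (effErr P Θ Z A G σ k q.1) + ‖q.2.1‖ ^ 2 -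
      ‖q.2.1 - q.2.2‖ ^ 2 / effErr P Θ Z A G σ k q.1 := by
    refine ((Real.measurable_log.comp hd).neg.add (by fun_prop)).sub
      (Measurable.div (by fun_prop) hd)
  exact hm.indicator (measurable_fst (h.measurableSet_regularSet σ))

lemma measurable_posteriorLLR_comp {α : Type*} [MeasurableSpace α] {θ : α → 𝓣} {a u : α → ℂ}
    (σ : Equiv.Perm (Fin n)) (k : Fin n) (hθ : Measurable θ) (ha : Measurable a)
    (hu : Measurable u) : Measurable fun r => posteriorLLR P Θ Z A G σ k (θ r) (a r) (u r) := by
  have hc := (h.measurable_posteriorLLR σ k).comp (hθ.prodMk (ha.prodMk hu))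
  exact hc

lemma measurable_received (t : Fin T) (i : ι) :
    Measurable fun ω => received Z A G x v t ω i := by
  simp only [received, Pi.add_apply, Matrix.mulVec, dotProduct]
  exact (Finset.measurable_fun_sum _ fun j _ =>
    ((h.measurable_signal i j).comp h.measurable_state).mul (h.measurable_x t j)).add
    (Finset.measurable_fun_sum _ fun l _ =>
    ((h.measurable_noise i l).comp h.measurable_state).mul (h.measurable_v t l))

lemma measurable_filterOutput (σ : Equiv.Perm (Fin n)) (k : Fin n) (t : Fin T) :
    Measurable (filterOutput P Θ Z A G x v σ k t) :=
  measurable_sicOutput (fun i j => (h.measurable_effChannel i j).comp h.measurable_side)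
    (fun i j => (h.measurable_effCov i j).comp h.measurable_side) (h.measurable_x t)
    (h.measurable_received t) σ k

/-- The mean square error of the filter output, weighted with its inverse. -/
lemma lintegral_norm_sq_error (σ : Equiv.Perm (Fin n)) (k : Fin n) (t : Fin T) :
    ∫⁻ ω, (regularSet P Θ Z A G σ).indicator
        (fun θ => ENNReal.ofReal (effErr P Θ Z A G σ k θ)⁻¹) (Θ ω) *
      ENNReal.ofReal (‖x t ω k - filterOutput P Θ Z A G x v σ k t ω‖ ^ 2) ∂P =
      P (Θ ⁻¹' regularSet P Θ Z A G σ) := by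
  set S := regularSet P Θ Z A G σ
  set f : 𝓣 → ι → ℂ := fun θ => sicFilter (effChannel P Θ Z A θ) (effCov P Θ Z A G θ) σ k with hf
  set w : 𝓣 → ℝ≥0∞ := S.indicator (fun θ => ENNReal.ofReal (effErr P Θ Z A G σ k θ)⁻¹) with hw
  -- The part of the error coefficients known given the side information: the wanted symbol and the
  -- cancelled streams.
  set b : 𝓣 → Fin n → ℂ := fun θ j => (if j = k then 1 else 0) +
    (if σ j < σ k then star (f θ) ⬝ᵥ (fun i => effChannel P Θ Z A θ i j) else 0) with hb
  have hS : MeasurableSet S := h.measurableSet_regularSet σ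
  have hwm : Measurable w := (h.measurable_effErr σ k).inv.ennreal_ofReal.indicator hS
  have hfm : ∀ i, Measurable fun θ => star (f θ) i := fun i =>
    Complex.continuous_conj.measurable.comp
      (measurable_sicFilter h.measurable_effChannel h.measurable_effCov σ k i)
  have hbm : ∀ j, Measurable fun θ => b θ j := fun j => by
    refine measurable_const.add ?_
    split_ifs
    · exact Finset.measurable_fun_sum _ fun i _ => (hfm i).mul (h.measurable_effChannel i j)
    · exact measurable_const
  have hfA : ∀ j, Measurable fun q : 𝓣 × E => (star (f q.1) ᵥ* A q.2) j := fun j =>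
    Finset.measurable_fun_sum _ fun i _ => ((hfm i).comp measurable_fst).mul
      ((h.measurable_signal i j).comp measurable_snd)
  have hfG : ∀ l, Measurable fun q : 𝓣 × E => (star (f q.1) ᵥ* G q.2) l := fun l =>
    Finset.measurable_fun_sum _ fun i _ => ((hfm i).comp measurable_fst).mul
      ((h.measurable_noise i l).comp measurable_snd)
  have ha : ∀ j, Measurable fun q : 𝓣 × E => b q.1 j - (star (f q.1) ᵥ* A q.2) j := fun j =>
    ((hbm j).comp measurable_fst).sub (hfA j)
  have hΦ : Measurable fun q : 𝓣 × E =>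
      w q.1 * ENNReal.ofReal (∑ j, ‖b q.1 j - (star (f q.1) ᵥ* A q.2) j‖ ^ 2 +
        ∑ l, ‖(star (f q.1) ᵥ* G q.2) l‖ ^ 2) :=
    (hwm.comp measurable_fst).mul (Measurable.ennreal_ofReal
      ((Finset.measurable_fun_sum _ fun j _ => (ha j).norm.pow_const 2).add
        (Finset.measurable_fun_sum _ fun l _ => (hfG l).norm.pow_const 2)))
  have hΨ : Measurable fun q : (E × 𝓣) × (Fin n → ℂ) × (κ → ℂ) =>
      w q.1.2 * ENNReal.ofReal (‖∑ j, (b q.1.2 j - (star (f q.1.2) ᵥ* A q.1.1) j) * q.2.1 j -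
        ∑ l, (star (f q.1.2) ᵥ* G q.1.1) l * q.2.2 l‖ ^ 2) := by
    have hswap : Measurable fun q : (E × 𝓣) × (Fin n → ℂ) × (κ → ℂ) => (q.1.2, q.1.1) := by fun_prop
    refine (hwm.comp (measurable_snd.comp measurable_fst)).mul (Measurable.ennreal_ofReal
      (Measurable.norm (Measurable.sub ?_ ?_) |>.pow_const 2))
    · exact Finset.measurable_fun_sum _ fun j _ => ((ha j).comp hswap).mul (by fun_prop)
    · exact Finset.measurable_fun_sum _ fun l _ => ((hfG l).comp hswap).mul (by fun_prop)
  have hind : IndepFun (fun ω => (Z ω, Θ ω)) (fun ω => (x t ω, v t ω)) P :=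
    h.indep.comp measurable_id
      (ψ := fun r : (Fin T → Fin n → ℂ) × (Fin T → κ → ℂ) => (r.1 t, r.2 t)) (by fun_prop)
  have hxv : Measurable fun ω => (x t ω, v t ω) :=
    (measurable_pi_lambda _ (h.measurable_x t)).prodMk (measurable_pi_lambda _ (h.measurable_v t))
  calc _ = ∫⁻ ω, w (Θ ω) * ENNReal.ofReal (‖∑ j, (b (Θ ω) j - (star (f (Θ ω)) ᵥ* A (Z ω)) j) *
          x t ω j - ∑ l, (star (f (Θ ω)) ᵥ* G (Z ω)) l * v t ω l‖ ^ 2) ∂P := by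
        refine lintegral_congr fun ω => ?_
        rw [filterOutput, received, sub_sicOutput_eq]
    -- Freeze state and side information and average over symbols and noise, which are jointly
    -- independent of them.
    _ = ∫⁻ ω, ∫⁻ ω', w (Θ ω) * ENNReal.ofReal (‖∑ j, (b (Θ ω) j -
          (star (f (Θ ω)) ᵥ* A (Z ω)) j) * x t ω' j -
            ∑ l, (star (f (Θ ω)) ᵥ* G (Z ω)) l * v t ω' l‖ ^ 2) ∂P ∂P :=
        lintegral_comp_of_indepFun (Φ := fun (q : E × 𝓣) (r : (Fin n → ℂ) × (κ → ℂ)) =>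
          w q.2 * ENNReal.ofReal (‖∑ j, (b q.2 j - (star (f q.2) ᵥ* A q.1) j) * r.1 j -
            ∑ l, (star (f q.2) ᵥ* G q.1) l * r.2 l‖ ^ 2))
          (h.measurable_state.prodMk h.measurable_side) hxv hind hΨ
    _ = ∫⁻ ω, w (Θ ω) * ENNReal.ofReal (∑ j, ‖b (Θ ω) j - (star (f (Θ ω)) ᵥ* A (Z ω)) j‖ ^ 2 +
          ∑ l, ‖(star (f (Θ ω)) ᵥ* G (Z ω)) l‖ ^ 2) ∂P := by
        refine lintegral_congr fun ω => ?_
        rw [← h.lintegral_norm_sq_comb t, lintegral_const_mul]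
        refine Measurable.ennreal_ofReal (Measurable.norm (Measurable.sub ?_ ?_) |>.pow_const 2)
        · exact Finset.measurable_fun_sum _ fun j _ => (h.measurable_x t j).const_mul _
        · exact Finset.measurable_fun_sum _ fun l _ => (h.measurable_v t l).const_mul _
    -- Average over the state given the side information; the filter stays fixed.
    _ = ∫⁻ ω, ∫⁻ e, w (Θ ω) * ENNReal.ofReal (∑ j, ‖b (Θ ω) j - (star (f (Θ ω)) ᵥ* A e) j‖ ^ 2 +
          ∑ l, ‖(star (f (Θ ω)) ᵥ* G e) l‖ ^ 2) ∂(condDistrib Z Θ P (Θ ω)) ∂P :=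
        lintegral_comp_condDistrib (Φ := fun θ e => w θ * ENNReal.ofReal
          (∑ j, ‖b θ j - (star (f θ) ᵥ* A e) j‖ ^ 2 + ∑ l, ‖(star (f θ) ᵥ* G e) l‖ ^ 2))
          h.measurable_side h.measurable_state hΦ
    -- Bias and variance turn the conditional average into the error of the filter for the mean
    -- channel, which cancels against the weight.
    _ = ∫⁻ ω, (Θ ⁻¹' S).indicator 1 ω ∂P := by
        refine lintegral_congr_ae ?_
        filter_upwards [h.ae_memLp_signal, h.ae_memLp_noise, h.ae_posDef_of_mem σ]
          with ω hA hG hpd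
        by_cases hmem : Θ ω ∈ S
        · have hΨpd := hpd.1 hmem
          have hAi : ∀ j, Integrable (fun e => ‖b (Θ ω) j - (star (f (Θ ω)) ᵥ* A e) j‖ ^ 2)
              (condDistrib Z Θ P (Θ ω)) := fun j =>
            ((memLp_const _).sub (memLp_vecMul hA _ j)).integrable_norm_pow two_ne_zero
          have hGi : ∀ l, Integrable (fun e => ‖(star (f (Θ ω)) ᵥ* G e) l‖ ^ 2)
              (condDistrib Z Θ P (Θ ω)) := fun l =>
            (memLp_vecMul hG _ l).integrable_norm_pow two_ne_zero
          have hpos : 0 < effErr P Θ Z A G σ k (Θ ω) := hmem.2 k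
          have hAGi : Integrable (fun e => ∑ j, ‖b (Θ ω) j - (star (f (Θ ω)) ᵥ* A e) j‖ ^ 2 +
              ∑ l, ‖(star (f (Θ ω)) ᵥ* G e) l‖ ^ 2) (condDistrib Z Θ P (Θ ω)) :=
            (integrable_finsetSum _ fun j _ => hAi j).add (integrable_finsetSum _ fun l _ => hGi l)
          have hwval : w (Θ ω) = ENNReal.ofReal (effErr P Θ Z A G σ k (Θ ω))⁻¹ :=
            Set.indicator_of_mem hmem _
          rw [lintegral_const_mul' _ _ (by rw [hwval]; exact ENNReal.ofReal_ne_top),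
            ← ofReal_integral_eq_lintegral_ofReal hAGi (ae_of_all _ fun _ => by positivity),
            integral_add (integrable_finsetSum _ fun j _ => hAi j)
              (integrable_finsetSum _ fun l _ => hGi l), integral_finsetSum _ fun j _ => hAi j,
            integral_finsetSum _ fun l _ => hGi l, sum_integral_add_eq hA hG]
          have hsic := sum_norm_sq_add_sicFilter (effChannel P Θ Z A (Θ ω)) σ k hΨpd
          have hval : ∑ j, ‖b (Θ ω) j - (star (f (Θ ω)) ᵥ* effChannel P Θ Z A (Θ ω)) j‖ ^ 2 +
              (star (f (Θ ω)) ⬝ᵥ (effCov P Θ Z A G (Θ ω) *ᵥ f (Θ ω))).re =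
              effErr P Θ Z A G σ k (Θ ω) := hsic
          rw [Set.indicator_of_mem (show ω ∈ Θ ⁻¹' S from hmem), hwval]
          refine (congrArg (fun c => _ * ENNReal.ofReal c) hval).trans ?_
          rw [← ENNReal.ofReal_mul (inv_pos.2 hpos).le, inv_mul_cancel₀ hpos.ne']
          simp
        · simp [hw, hmem]
    _ = P (Θ ⁻¹' S) := by
        rw [lintegral_indicator_one (h.measurable_side hS)]

lemma streamRate_nonneg (σ : Equiv.Perm (Fin n)) (k : Fin n) :
    ∀ᵐ ω ∂P, 0 ≤ streamRate P Θ Z A G σ k (Θ ω) := by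
  filter_upwards [h.ae_posDef_of_mem σ] with ω hpd
  by_cases hmem : Θ ω ∈ regularSet P Θ Z A G σ
  · rw [streamRate, Set.indicator_of_mem hmem, Left.nonneg_neg_iff]
    exact Real.log_nonpos (hmem.2 k).le (sicErr_le_one _ σ k (hpd.1 hmem))
  · rw [streamRate, Set.indicator_of_notMem hmem]

/-- The rate of stream `k` is dominated by the conditional second moment of the `k`-th column of the
factor `R`, which has finite mean. -/
lemma integrable_streamRate (σ : Equiv.Perm (Fin n)) (k : Fin n) :
    Integrable (fun ω => streamRate P Θ Z A G σ k (Θ ω)) P := by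
  have hbound : Integrable (fun ω => ∑ l, ∫ e, ‖R e l k‖ ^ 2 ∂(condDistrib Z Θ P (Θ ω))) P := by
    refine integrable_finsetSum _ fun l _ => ?_
    refine Integrable.integral_condDistrib (f := fun q : 𝓣 × E => ‖R q.2 l k‖ ^ 2)
      h.measurable_side.aemeasurable h.measurable_state.aemeasurable ?_
    exact (integrable_map_measure (((h.measurable_factor l k).comp
      measurable_snd).norm.pow_const 2).aestronglyMeasurable
      (h.measurable_side.prodMk h.measurable_state).aemeasurable).2
      ((h.memLp_factor l k).integrable_norm_pow two_ne_zero)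
  refine hbound.mono' ?_ ?_
  · exact (((Real.measurable_log.comp (h.measurable_effErr σ k)).neg.indicator
      (h.measurableSet_regularSet σ)).comp h.measurable_side).aestronglyMeasurable
  · filter_upwards [h.ae_memLp_signal, h.ae_memLp_noise, h.ae_memLp_factor, h.ae_posDef_of_mem σ,
      h.streamRate_nonneg σ k] with ω hA hG hR hpd hnn
    have hr0 : 0 ≤ ∑ l, ∫ e, ‖R e l k‖ ^ 2 ∂(condDistrib Z Θ P (Θ ω)) :=
      Finset.sum_nonneg fun j _ => integral_nonneg fun e => by positivity
    rw [Real.norm_eq_abs, abs_of_nonneg hnn]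
    by_cases hmem : Θ ω ∈ regularSet P Θ Z A G σ
    · rw [streamRate, Set.indicator_of_mem hmem]
      exact neg_log_sicErr_le _ σ k (hpd.1 hmem) hr0 fun u =>
        norm_sq_dotProduct_matExp_le hA hG hR (ae_of_all _ h.signal_eq) k u
    · rwa [streamRate, Set.indicator_of_notMem hmem]

lemma posteriorLLR_filterOutput_eq (σ : Equiv.Perm (Fin n)) (k : Fin n) (t : Fin T) (ω : Ω) :
    posteriorLLR P Θ Z A G σ k (Θ ω) (x t ω k) (filterOutput P Θ Z A G x v σ k t ω) =
      streamRate P Θ Z A G σ k (Θ ω) +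
      (regularSet P Θ Z A G σ).indicator (fun _ => (1 : ℝ)) (Θ ω) * ‖x t ω k‖ ^ 2 -
      (regularSet P Θ Z A G σ).indicator (fun θ => (effErr P Θ Z A G σ k θ)⁻¹) (Θ ω) *
        ‖x t ω k - filterOutput P Θ Z A G x v σ k t ω‖ ^ 2 := by
  by_cases hmem : Θ ω ∈ regularSet P Θ Z A G σ
  · simp only [posteriorLLR, streamRate, Set.indicator_of_mem hmem]
    ring
  · simp only [posteriorLLR, streamRate, Set.indicator_of_notMem hmem]
    ring

/-- Besides the rate, the test function contains the symbol energy and the weighted squared error,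
both restricted to the regular set. Each has mean equal to the probability of that set, the first by
independence and unit power, the second by `lintegral_norm_sq_error`, so they cancel. -/
lemma integrable_and_integral_posteriorLLR (σ : Equiv.Perm (Fin n)) (k : Fin n) (t : Fin T) :
    Integrable (fun ω => posteriorLLR P Θ Z A G σ k (Θ ω) (x t ω k)
      (filterOutput P Θ Z A G x v σ k t ω)) P ∧
    ∫ ω, posteriorLLR P Θ Z A G σ k (Θ ω) (x t ω k) (filterOutput P Θ Z A G x v σ k t ω) ∂P =
      ∫ ω, streamRate P Θ Z A G σ k (Θ ω) ∂P := by
  set S := regularSet P Θ Z A G σ with hSdef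
  have hS : MeasurableSet S := h.measurableSet_regularSet σ
  have hx2 : Integrable (fun ω => ‖x t ω k‖ ^ 2) P :=
    (h.memLp_x t k).integrable_norm_pow two_ne_zero
  have hindm : Measurable fun ω => S.indicator (fun _ => (1 : ℝ)) (Θ ω) :=
    (measurable_const.indicator hS).comp h.measurable_side
  have hind : IndepFun (fun ω => S.indicator (fun _ => (1 : ℝ)) (Θ ω))
      (fun ω => ‖x t ω k‖ ^ 2) P :=
    h.indep.comp (φ := fun q : E × 𝓣 => S.indicator (fun _ => (1 : ℝ)) q.2)
      (ψ := fun r : (Fin T → Fin n → ℂ) × (Fin T → κ → ℂ) => ‖r.1 t k‖ ^ 2)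
      ((measurable_const.indicator hS).comp measurable_snd) (by fun_prop)
  have hindint : Integrable (fun ω => S.indicator (fun _ => (1 : ℝ)) (Θ ω)) P :=
    Integrable.of_bound hindm.aestronglyMeasurable 1 (ae_of_all _ fun ω => by
      by_cases hm : Θ ω ∈ S <;> simp [hm])
  have h1 : Integrable (fun ω => S.indicator (fun _ => (1 : ℝ)) (Θ ω) * ‖x t ω k‖ ^ 2) P :=
    hind.integrable_mul hindint hx2
  have hone : ∫ ω, S.indicator (fun _ => (1 : ℝ)) (Θ ω) ∂P = P.real (Θ ⁻¹' S) :=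
    integral_indicator_one (h.measurable_side hS)
  have h1v : ∫ ω, S.indicator (fun _ => (1 : ℝ)) (Θ ω) * ‖x t ω k‖ ^ 2 ∂P =
      P.real (Θ ⁻¹' S) := by
    rw [hind.integral_fun_mul_eq_mul_integral hindm.aestronglyMeasurable
      hx2.aestronglyMeasurable, h.integral_norm_sq_x, mul_one, hone]
  have herr := h.lintegral_norm_sq_error σ k t
  rw [← hSdef] at herr
  have hwpos : ∀ ω, 0 ≤ S.indicator (fun θ => (effErr P Θ Z A G σ k θ)⁻¹) (Θ ω) := fun ω =>
    Set.indicator_nonneg (fun θ hθ => (inv_pos.2 (hθ.2 k)).le) _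
  have hofReal : ∀ ω, ENNReal.ofReal (S.indicator (fun θ => (effErr P Θ Z A G σ k θ)⁻¹) (Θ ω) *
        ‖x t ω k - filterOutput P Θ Z A G x v σ k t ω‖ ^ 2) =
      S.indicator (fun θ => ENNReal.ofReal (effErr P Θ Z A G σ k θ)⁻¹) (Θ ω) *
      ENNReal.ofReal (‖x t ω k - filterOutput P Θ Z A G x v σ k t ω‖ ^ 2) := fun ω => by
    rw [ENNReal.ofReal_mul (hwpos ω)]
    congr 1
    by_cases hm : Θ ω ∈ S <;> simp [hm]
  have hem : Measurable fun ω => S.indicator (fun θ => (effErr P Θ Z A G σ k θ)⁻¹) (Θ ω) *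
      ‖x t ω k - filterOutput P Θ Z A G x v σ k t ω‖ ^ 2 :=
    (((h.measurable_effErr σ k).inv.indicator hS).comp h.measurable_side).mul
      (((h.measurable_x t k).sub (h.measurable_filterOutput σ k t)).norm.pow_const 2)
  have hnn : ∀ ω, 0 ≤ S.indicator (fun θ => (effErr P Θ Z A G σ k θ)⁻¹) (Θ ω) *
      ‖x t ω k - filterOutput P Θ Z A G x v σ k t ω‖ ^ 2 := fun ω =>
    mul_nonneg (hwpos ω) (by positivity)
  have h2 : Integrable (fun ω => S.indicator (fun θ => (effErr P Θ Z A G σ k θ)⁻¹) (Θ ω) *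
      ‖x t ω k - filterOutput P Θ Z A G x v σ k t ω‖ ^ 2) P := by
    refine ⟨hem.aestronglyMeasurable, ?_⟩
    rw [hasFiniteIntegral_iff_ofReal (ae_of_all _ hnn)]
    simp_rw [hofReal]
    rw [herr]
    exact measure_lt_top _ _
  have h2v : ∫ ω, S.indicator (fun θ => (effErr P Θ Z A G σ k θ)⁻¹) (Θ ω) *
      ‖x t ω k - filterOutput P Θ Z A G x v σ k t ω‖ ^ 2 ∂P = P.real (Θ ⁻¹' S) := by
    rw [integral_eq_lintegral_of_nonneg_ae (ae_of_all _ hnn) hem.aestronglyMeasurable]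
    simp_rw [hofReal]
    rw [herr]
    rfl
  have h3 := h.integrable_streamRate σ k
  simp_rw [h.posteriorLLR_filterOutput_eq σ k t]
  refine ⟨(h3.add h1).sub h2, ?_⟩
  have h31 : Integrable (fun ω => streamRate P Θ Z A G σ k (Θ ω) +
      S.indicator (fun _ => (1 : ℝ)) (Θ ω) * ‖x t ω k‖ ^ 2) P := h3.add h1
  rw [integral_sub h31 h2, integral_add h3 h1, h1v, h2v]
  ring

lemma streamRate_le_mutualInfo (σ : Equiv.Perm (Fin n)) (k : Fin n) :
    ENNReal.ofReal (T * ∫ ω, streamRate P Θ Z A G σ k (Θ ω) ∂P) ≤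
      mutualInfo P (fun ω t => x t ω k)
        (fun ω => ((fun t => filterOutput P Θ Z A G x v σ k t ω), Θ ω)) := by
  have hpost := fun t => h.integrable_and_integral_posteriorLLR σ k t
  have hX : Measurable fun ω t => x t ω k := measurable_pi_lambda _ fun t => h.measurable_x t k
  have hY : Measurable fun ω => ((fun t => filterOutput P Θ Z A G x v σ k t ω), Θ ω) :=
    (measurable_pi_lambda _ fun t => h.measurable_filterOutput σ k t).prodMk h.measurable_side
  have key := ofReal_integral_le_mutualInfo (P := P) hX hY
    (g := fun a q => ∑ t, posteriorLLR P Θ Z A G σ k q.2 (a t) (q.1 t)) ?_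
    (integrable_finsetSum _ fun t _ => (hpost t).1) ?_
  · rw [integral_finsetSum _ fun t _ => (hpost t).1,
      Finset.sum_congr rfl fun t _ => (hpost t).2] at key
    simpa using key
  · refine Finset.measurable_fun_sum _ fun t _ => ?_
    exact (h.measurable_posteriorLLR σ k).comp
      (f := fun q : (Fin T → ℂ) × (Fin T → ℂ) × 𝓣 => (q.2.2, q.1 t, q.2.1 t)) (by fun_prop)
  · rintro ⟨u, θ⟩
    rw [h.map_stream k]
    simp_rw [Real.exp_sum, ENNReal.ofReal_prod_of_nonneg fun _ _ => (Real.exp_pos _).le]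
    -- Once the filter outputs are fixed, the factors of different channel uses involve separate
    -- coordinates, so a constant rank will do.
    refine lintegral_pi_prod_le_one (r := fun _ => 0)
      (φ := fun t a => ENNReal.ofReal (Real.exp (posteriorLLR P Θ Z A G σ k θ (a t) (u t))))
      (fun t => ?_) (fun t a b hab _ => by rw [hab]) fun t a => ?_
    · refine (Real.measurable_exp.comp ?_).ennreal_ofReal
      exact (h.measurable_posteriorLLR σ k).comp
        (f := fun a : Fin T → ℂ => (θ, a t, u t)) (by fun_prop)
    · simp only [Function.update_self]
      exact lintegral_exp_posteriorLLR_le_one σ k θ (u t)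

lemma measurable_posteriorLLR_sicOutput (σ : Equiv.Perm (Fin n)) (q : Fin T × Fin n) :
    Measurable fun r : (Fin T → Fin n → ℂ) × (Fin T → ι → ℂ) × 𝓣 =>
      posteriorLLR P Θ Z A G σ q.2 r.2.2 (r.1 q.1 q.2)
        (sicOutput (effChannel P Θ Z A r.2.2) (effCov P Θ Z A G r.2.2) σ q.2 (r.1 q.1)
          (r.2.1 q.1)) := by
  have hθ : Measurable fun r : (Fin T → Fin n → ℂ) × (Fin T → ι → ℂ) × 𝓣 => r.2.2 :=
    measurable_snd.comp measurable_snd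
  have hx : ∀ j, Measurable fun r : (Fin T → Fin n → ℂ) × (Fin T → ι → ℂ) × 𝓣 => r.1 q.1 j :=
    fun j => (measurable_pi_apply j).comp ((measurable_pi_apply q.1).comp measurable_fst)
  have hy : ∀ i, Measurable fun r : (Fin T → Fin n → ℂ) × (Fin T → ι → ℂ) × 𝓣 => r.2.1 q.1 i :=
    fun i => (measurable_pi_apply i).comp
      ((measurable_pi_apply q.1).comp (measurable_fst.comp measurable_snd))
  have hH : ∀ i j, Measurable fun r : (Fin T → Fin n → ℂ) × (Fin T → ι → ℂ) × 𝓣 =>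
      effChannel P Θ Z A r.2.2 i j := fun i j => (h.measurable_effChannel i j).comp hθ
  have hΨ : ∀ i j, Measurable fun r : (Fin T → Fin n → ℂ) × (Fin T → ι → ℂ) × 𝓣 =>
      effCov P Θ Z A G r.2.2 i j := fun i j => (h.measurable_effCov i j).comp hθ
  have hout := measurable_sicOutput hH hΨ hx hy σ q.2
  exact h.measurable_posteriorLLR_comp σ q.2 hθ (hx q.2) hout

omit h in
lemma sicOutput_congr (H : Matrix ι (Fin n) ℂ) (Ψ : Matrix ι ι ℂ) (σ : Equiv.Perm (Fin n))
    (k : Fin n) {a b : Fin n → ℂ} (y : ι → ℂ) (hab : ∀ j, σ j < σ k → a j = b j) :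
    sicOutput H Ψ σ k a y = sicOutput H Ψ σ k b y := by
  rw [sicOutput, sicOutput]
  congr 2
  refine Finset.sum_congr rfl fun j hj => ?_
  rw [hab j (Finset.mem_filter.1 hj).2]

/-- Ranked by decoding stage, each posterior density has a centre that depends only on symbols of
smaller rank, in the same channel use. Equal ranks in different channel uses do not interact. -/
lemma lintegral_exp_sum_posteriorLLR_le_one (σ : Equiv.Perm (Fin n)) (y : Fin T → ι → ℂ) (θ : 𝓣) :
    ∫⁻ a : Fin T × Fin n → ℂ, ∏ q, ENNReal.ofReal (Real.exp (posteriorLLR P Θ Z A G σ q.2 θ (a q)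
      (sicOutput (effChannel P Θ Z A θ) (effCov P Θ Z A G θ) σ q.2 (fun k => a (q.1, k))
        (y q.1)))) ∂(Measure.pi fun _ => stdComplexGaussian) ≤ 1 := by
  refine lintegral_pi_prod_le_one (r := fun q : Fin T × Fin n => σ q.2)
    (φ := fun q a => ENNReal.ofReal (Real.exp (posteriorLLR P Θ Z A G σ q.2 θ (a q)
      (sicOutput (effChannel P Θ Z A θ) (effCov P Θ Z A G θ) σ q.2 (fun k => a (q.1, k))
        (y q.1))))) (fun q => ?_) (fun q a b hab hlt => ?_) fun q a => ?_
  · have hm : Measurable fun a : Fin T × Fin n → ℂ =>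
        ((fun t k => a (t, k), y, θ) : (Fin T → Fin n → ℂ) × (Fin T → ι → ℂ) × 𝓣) := by fun_prop
    exact (Real.measurable_exp.comp ((h.measurable_posteriorLLR_sicOutput σ q).comp
      hm)).ennreal_ofReal
  · rw [sicOutput_congr _ _ σ q.2 (y q.1) fun j hj => hlt (q.1, j) hj, hab]
  -- A stream is not cancelled from its own observation, so the centre of the density is constant in
  -- the integration variable.
  · have hupd : ∀ z, sicOutput (effChannel P Θ Z A θ) (effCov P Θ Z A G θ) σ q.2
        (fun k => Function.update a q z (q.1, k)) (y q.1) =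
        sicOutput (effChannel P Θ Z A θ) (effCov P Θ Z A G θ) σ q.2
        (fun k => a (q.1, k)) (y q.1) := fun z =>
      sicOutput_congr _ _ σ q.2 (y q.1) fun j hj => Function.update_of_ne
        (fun hq => by rw [← hq] at hj; exact lt_irrefl _ hj) _ _
    simp_rw [hupd]
    simp only [Function.update_self]
    exact lintegral_exp_posteriorLLR_le_one σ q.2 θ _

/-- The test function is evaluated at a candidate for all symbols, so it may cancel earlier streams
using that candidate. This plays the role of the chain rule. -/
lemma sum_streamRate_le_mutualInfo (σ : Equiv.Perm (Fin n)) :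
    ENNReal.ofReal (T * ∑ k, ∫ ω, streamRate P Θ Z A G σ k (Θ ω) ∂P) ≤
      mutualInfo P (fun ω t => x t ω)
        (fun ω => ((fun t => received Z A G x v t ω), Θ ω)) := by
  have hpost := fun (q : Fin T × Fin n) => h.integrable_and_integral_posteriorLLR σ q.2 q.1
  have hX : Measurable fun ω t => x t ω :=
    measurable_pi_lambda _ fun t => measurable_pi_lambda _ (h.measurable_x t)
  have hY : Measurable fun ω => ((fun t => received Z A G x v t ω), Θ ω) :=
    (measurable_pi_lambda _ fun t => measurable_pi_lambda _ (h.measurable_received t)).prodMk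
      h.measurable_side
  have hflat : Measurable fun ω (q : Fin T × Fin n) => x q.1 ω q.2 :=
    measurable_pi_lambda _ fun q => h.measurable_x q.1 q.2
  have hcurry : Measurable fun (a : Fin T × Fin n → ℂ) (t : Fin T) (k : Fin n) => a (t, k) := by
    fun_prop
  have hsum : ∫ ω, ∑ q : Fin T × Fin n, posteriorLLR P Θ Z A G σ q.2 (Θ ω) (x q.1 ω q.2)
      (filterOutput P Θ Z A G x v σ q.2 q.1 ω) ∂P =
      T * ∑ k, ∫ ω, streamRate P Θ Z A G σ k (Θ ω) ∂P := by
    rw [integral_finsetSum _ fun q _ => (hpost q).1,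
      Finset.sum_congr rfl fun q _ => (hpost q).2, Fintype.sum_prod_type]
    simp
  rw [← hsum]
  refine ofReal_integral_le_mutualInfo (P := P) hX hY
    (g := fun a r => ∑ q : Fin T × Fin n, posteriorLLR P Θ Z A G σ q.2 r.2 (a q.1 q.2)
      (sicOutput (effChannel P Θ Z A r.2) (effCov P Θ Z A G r.2) σ q.2 (a q.1) (r.1 q.1)))
    (Finset.measurable_fun_sum _ fun q _ => h.measurable_posteriorLLR_sicOutput σ q)
    (integrable_finsetSum _ fun q _ => (hpost q).1) ?_
  rintro ⟨y, θ⟩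
  have hmap : P.map (fun ω t => x t ω) = (Measure.pi fun _ : Fin T × Fin n =>
      stdComplexGaussian).map fun a t k => a (t, k) := by
    rw [← h.law_x, Measure.map_map hcurry hflat]
    rfl
  have hm : Measurable fun a : Fin T → Fin n → ℂ =>
      ((a, y, θ) : (Fin T → Fin n → ℂ) × (Fin T → ι → ℂ) × 𝓣) := by fun_prop
  have hF : Measurable fun a : Fin T → Fin n → ℂ => ENNReal.ofReal (Real.exp
      (∑ q : Fin T × Fin n, posteriorLLR P Θ Z A G σ q.2 θ (a q.1 q.2)
        (sicOutput (effChannel P Θ Z A θ) (effCov P Θ Z A G θ) σ q.2 (a q.1) (y q.1)))) :=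
    (Real.measurable_exp.comp (Finset.measurable_fun_sum _ fun q _ =>
      (h.measurable_posteriorLLR_sicOutput σ q).comp hm)).ennreal_ofReal
  rw [hmap, lintegral_map hF hcurry]
  simp_rw [Real.exp_sum, ENNReal.ofReal_prod_of_nonneg fun _ _ => (Real.exp_pos _).le]
  exact h.lintegral_exp_sum_posteriorLLR_le_one σ y θ

lemma ae_sum_streamRate (σ : Equiv.Perm (Fin n)) :
    ∀ᵐ ω ∂P, ∑ k, streamRate P Θ Z A G σ k (Θ ω) =
      Real.log 2 * logDet ((effChannel P Θ Z A (Θ ω))ᴴ * (effCov P Θ Z A G (Θ ω))⁻¹ *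
        effChannel P Θ Z A (Θ ω)) := by
  filter_upwards [h.ae_posDef_of_mem σ, h.ae_effCov_posSemidef] with ω hpd hpsd
  have hlog2 : Real.log 2 ≠ 0 := (Real.log_pos one_lt_two).ne'
  by_cases hmem : Θ ω ∈ regularSet P Θ Z A G σ
  · rw [logDet, Real.logb, mul_div_cancel₀ _ hlog2, log_det_eq_sum _ σ (hpd.1 hmem)]
    exact Finset.sum_congr rfl fun k _ => Set.indicator_of_mem hmem _
  -- Off the regular set the covariance is singular, its matrix inverse is zero by convention, and
  -- both sides vanish.
  · have hns : ¬ IsUnit (effCov P Θ Z A G (Θ ω)).det := fun hu =>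
      hmem (hpd.2 (hpsd.posDef_iff_isUnit.2 ((Matrix.isUnit_iff_isUnit_det _).2 hu)))
    rw [Matrix.nonsing_inv_apply_not_isUnit _ hns]
    simp [streamRate, hmem, logDet]

end IsFadingChannel


/-! ### Conditional expectations of random matrices -/

section MatCondExp

variable {Ω 𝓣 : Type*} [MeasurableSpace Ω] [MeasurableSpace 𝓣] {P : Measure Ω}
  [IsProbabilityMeasure P] {Θ : Ω → 𝓣} {ι κ : Type*} [Fintype ι] [Fintype κ]
  {X Y : Ω → Matrix ι κ ℂ}

lemma matCondExp_add (hX : ∀ i j, Integrable (fun ω => X ω i j) P)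
    (hY : ∀ i j, Integrable (fun ω => Y ω i j) P) :
    ∀ᵐ ω ∂P, matCondExp P Θ (fun ω' => X ω' + Y ω') ω =
      matCondExp P Θ X ω + matCondExp P Θ Y ω := by
  have h : ∀ᵐ ω ∂P, ∀ i j, (P[(fun ω' => X ω' i j) + fun ω' => Y ω' i j |
      MeasurableSpace.comap Θ inferInstance]) ω =
      (P[fun ω' => X ω' i j | MeasurableSpace.comap Θ inferInstance] +
        P[fun ω' => Y ω' i j | MeasurableSpace.comap Θ inferInstance]) ω :=
    ae_all_iff.2 fun i => ae_all_iff.2 fun j => condExp_add (hX i j) (hY i j) _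
  filter_upwards [h] with ω hω
  ext i j
  exact hω i j

lemma matCondExp_smul (c : ℂ) :
    ∀ᵐ ω ∂P, matCondExp P Θ (fun ω' => c • X ω') ω = c • matCondExp P Θ X ω := by
  have h : ∀ᵐ ω ∂P, ∀ i j, (P[c • (fun ω' => X ω' i j) |
      MeasurableSpace.comap Θ inferInstance]) ω =
      (c • P[fun ω' => X ω' i j | MeasurableSpace.comap Θ inferInstance]) ω :=
    ae_all_iff.2 fun i => ae_all_iff.2 fun j => condExp_smul c _ _
  filter_upwards [h] with ω hω
  ext i j
  exact hω i j

lemma matCondExp_const (hΘ : Measurable Θ) (B : Matrix ι κ ℂ) (ω : Ω) :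
    matCondExp P Θ (fun _ => B) ω = B := by
  ext i j
  simp only [matCondExp, Matrix.of_apply]
  rw [condExp_const hΘ.comap_le]

lemma matCondExp_conjTranspose (hΘ : Measurable Θ) (hXm : ∀ i j, Measurable fun ω => X ω i j)
    (hX : ∀ i j, Integrable (fun ω => X ω i j) P) :
    ∀ᵐ ω ∂P, matCondExp P Θ (fun ω' => (X ω')ᴴ) ω = (matCondExp P Θ X ω)ᴴ := by
  have hZ : Measurable fun ω i j => X ω i j :=
    measurable_pi_lambda _ fun i => measurable_pi_lambda _ fun j => hXm i j
  have hB : ∀ i j, Measurable fun e : ι → κ → ℂ => Matrix.of e i j := fun i j => by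
    simp only [Matrix.of_apply]
    fun_prop
  have h1 := matCondExp_ae_eq_matExp_condDistrib (P := P) hΘ hZ (B := Matrix.of) hB hX
  have h2 := matCondExp_ae_eq_matExp_condDistrib (P := P) hΘ hZ
    (B := fun e : ι → κ → ℂ => (Matrix.of e)ᴴ) (measurable_matrix_conjTranspose hB)
    (fun i j => Complex.conjLIE.integrable_comp_iff.2 (hX j i))
  filter_upwards [h1, h2] with ω hω1 hω2
  refine hω2.trans ?_
  refine Eq.trans ?_ (congrArg Matrix.conjTranspose hω1.symm)
  ext i j
  simp only [matExp, Matrix.of_apply, Matrix.conjTranspose_apply, RCLike.star_def]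
  exact integral_conj

end MatCondExp

/-! ### Summary for fading channels -/

section Summary

variable {Ω 𝓣 E : Type*} [MeasurableSpace Ω] [MeasurableSpace 𝓣] [MeasurableSpace E]
  [StandardBorelSpace E] [Nonempty E]
  {ι κ : Type*} [Fintype ι] [Fintype κ] [DecidableEq ι] [DecidableEq κ] {n T : ℕ}
  {P : Measure Ω} [IsProbabilityMeasure P] {Θ : Ω → 𝓣} {Z : Ω → E}
  {A : E → Matrix ι (Fin n) ℂ} {G : E → Matrix ι κ ℂ} {R : E → Matrix κ (Fin n) ℂ}
  {x : Fin T → Ω → Fin n → ℂ} {v : Fin T → Ω → κ → ℂ}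

lemma mutualInfo_congr_right {𝓧 𝓨 : Type*} [MeasurableSpace 𝓧] [MeasurableSpace 𝓨] {X : Ω → 𝓧}
    {Y Y' : Ω → 𝓨} (h : Y =ᵐ[P] Y') : mutualInfo P X Y = mutualInfo P X Y' := by
  have h2 : (fun ω => (X ω, Y ω)) =ᵐ[P] fun ω => (X ω, Y' ω) := by
    filter_upwards [h] with ω hω
    rw [hω]
  rw [mutualInfo, mutualInfo, Measure.map_congr h, Measure.map_congr h2]

namespace IsFadingChannel

variable (h : IsFadingChannel P Θ Z A G R x v)
include h

lemma ae_matCondExp_signal : ∀ᵐ ω ∂P,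
    matCondExp P Θ (fun ω' => A (Z ω')) ω = effChannel P Θ Z A (Θ ω) :=
  matCondExp_ae_eq_matExp_condDistrib h.measurable_side h.measurable_state h.measurable_signal
    fun i j => (h.memLp_signal i j).integrable one_le_two

lemma ae_matCondExp_secondMoment : ∀ᵐ ω ∂P,
    matCondExp P Θ (fun ω' => A (Z ω') * (A (Z ω'))ᴴ + G (Z ω') * (G (Z ω'))ᴴ) ω -
      matCondExp P Θ (fun ω' => A (Z ω')) ω * (matCondExp P Θ (fun ω' => A (Z ω')) ω)ᴴ =
      effCov P Θ Z A G (Θ ω) := by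
  have h1 := matCondExp_ae_eq_matExp_condDistrib (P := P) h.measurable_side h.measurable_state
    (B := fun e => A e * (A e)ᴴ + G e * (G e)ᴴ) (fun i j =>
      (measurable_matrix_mul h.measurable_signal
        (measurable_matrix_conjTranspose h.measurable_signal) i j).add
        (measurable_matrix_mul h.measurable_noise
        (measurable_matrix_conjTranspose h.measurable_noise) i j))
    (fun i j => (integrable_mul_conjTranspose h.memLp_signal i j).add
      (integrable_mul_conjTranspose h.memLp_noise i j))
  filter_upwards [h1, h.ae_matCondExp_signal] with ω hω1 hω2
  rw [hω1, hω2]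
  rfl

variable {H : Ω → Matrix ι (Fin n) ℂ} {Ψ : Ω → Matrix ι ι ℂ} {Υ : Ω → Matrix (Fin n) (Fin n) ℂ}

/-- Conditional expectations are determined only up to null sets, so the receiver matrices are
compared with functions of the side information almost everywhere; mutual information does not
notice the difference. -/
lemma achievable (hH : ∀ᵐ ω ∂P, H ω = effChannel P Θ Z A (Θ ω))
    (hΨ : ∀ᵐ ω ∂P, Ψ ω = effCov P Θ Z A G (Θ ω))
    (hΥ : ∀ᵐ ω ∂P, Υ ω = (H ω)ᴴ * (Ψ ω)⁻¹ * H ω) (σ : Equiv.Perm (Fin n)) :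
    (∀ᵐ ω ∂P, (Ψ ω).PosSemidef) ∧ Integrable (fun ω => logDet (Υ ω)) P ∧
    (∀ᵐ ω ∂P, IsUnit (Ψ ω) →
      logDet (Υ ω) = ∑ k, Real.logb 2 (1 + sicSINR (H ω) (Ψ ω) σ k)) ∧
    ENNReal.ofReal (T * (Real.log 2 * ∫ ω, logDet (Υ ω) ∂P)) ≤
      ∑ k, mutualInfo P (fun ω t => x t ω k)
        (fun ω => ((fun t => sicOutput (H ω) (Ψ ω) σ k (x t ω) (received Z A G x v t ω)), Θ ω)) ∧
    ENNReal.ofReal (T * (Real.log 2 * ∫ ω, logDet (Υ ω) ∂P)) ≤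
      mutualInfo P (fun ω t => x t ω) (fun ω => ((fun t => received Z A G x v t ω), Θ ω)) := by
  have hlog2 : Real.log 2 ≠ 0 := (Real.log_pos one_lt_two).ne'
  have hpsd : ∀ᵐ ω ∂P, (Ψ ω).PosSemidef := by
    filter_upwards [hΨ, h.ae_effCov_posSemidef] with ω h1 h2
    rwa [h1]
  have hrate : ∀ᵐ ω ∂P, ∑ k, streamRate P Θ Z A G σ k (Θ ω) = Real.log 2 * logDet (Υ ω) := by
    filter_upwards [hH, hΨ, hΥ, h.ae_sum_streamRate σ] with ω h1 h2 h3 h4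
    rw [h3, h1, h2, h4]
  have hint : Integrable (fun ω => ∑ k, streamRate P Θ Z A G σ k (Θ ω)) P :=
    integrable_finsetSum _ fun k _ => h.integrable_streamRate σ k
  have hsum : Real.log 2 * ∫ ω, logDet (Υ ω) ∂P =
      ∑ k, ∫ ω, streamRate P Θ Z A G σ k (Θ ω) ∂P := by
    rw [← integral_const_mul, ← integral_congr_ae hrate,
      integral_finsetSum _ fun k _ => h.integrable_streamRate σ k]
  refine ⟨hpsd, ?_, ?_, ?_, ?_⟩
  · refine (hint.const_mul (Real.log 2)⁻¹).congr ?_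
    filter_upwards [hrate] with ω hω
    rw [hω, inv_mul_cancel_left₀ hlog2]
  · filter_upwards [hpsd, hΥ] with ω h1 h2 hu
    rw [h2]
    exact logDet_eq_sum_sicSINR _ σ (h1.posDef_iff_isUnit.2 hu)
  · rw [hsum, Finset.mul_sum, ENNReal.ofReal_sum_of_nonneg fun k _ => mul_nonneg T.cast_nonneg
      (integral_nonneg_of_ae (h.streamRate_nonneg σ k))]
    refine Finset.sum_le_sum fun k _ => (h.streamRate_le_mutualInfo σ k).trans_eq ?_
    refine mutualInfo_congr_right ?_
    filter_upwards [hH, hΨ] with ω h1 h2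
    rw [h1, h2]
    rfl
  · rw [hsum]
    exact h.sum_streamRate_le_mutualInfo σ

end IsFadingChannel

end Summary

/-! ### Integrability of products of random matrices -/

section MatrixMemLp

variable {Ω : Type*} [MeasurableSpace Ω] {P : Measure Ω} {ι κ μ : Type*} [Fintype ι] [Fintype κ]
  [Fintype μ] {X : Ω → Matrix ι κ ℂ} {Y : Ω → Matrix κ μ ℂ} {p q r : ℝ≥0∞}

lemma memLp_matrix_mul [ENNReal.HolderTriple p q r] (hX : ∀ i j, MemLp (fun ω => X ω i j) p P)
    (hY : ∀ i j, MemLp (fun ω => Y ω i j) q P) (i : ι) (j : μ) :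
    MemLp (fun ω => (X ω * Y ω) i j) r P := by
  simp only [Matrix.mul_apply]
  exact memLp_finsetSum _ fun l _ => (hY l j).mul (hX i l)

lemma memLp_matrix_conjTranspose (hX : ∀ i j, MemLp (fun ω => X ω i j) p P) (i : κ) (j : ι) :
    MemLp (fun ω => (X ω)ᴴ i j) p P :=
  (hX j i).star

lemma memLp_matrix_smul (c : ℂ) (hX : ∀ i j, MemLp (fun ω => X ω i j) p P) (i : ι) (j : κ) :
    MemLp (fun ω => (c • X ω) i j) p P :=
  (hX i j).const_mul c

lemma memLp_matrix_add {X' : Ω → Matrix ι κ ℂ} (hX : ∀ i j, MemLp (fun ω => X ω i j) p P)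
    (hX' : ∀ i j, MemLp (fun ω => X' ω i j) p P) (i : ι) (j : κ) :
    MemLp (fun ω => (X ω + X' ω) i j) p P :=
  (hX i j).add (hX' i j)

lemma memLp_matrix_sum {δ : Type*} (s : Finset δ) {X : δ → Ω → Matrix ι κ ℂ}
    (hX : ∀ d i j, MemLp (fun ω => X d ω i j) p P) (i : ι) (j : κ) :
    MemLp (fun ω => (∑ d ∈ s, X d ω) i j) p P := by
  simp only [Matrix.sum_apply]
  exact memLp_finsetSum _ fun d _ => hX d i j

lemma memLp_matrix_mul_const [IsFiniteMeasure P] (hX : ∀ i j, MemLp (fun ω => X ω i j) p P)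
    (B : Matrix κ μ ℂ) (i : ι) (j : μ) : MemLp (fun ω => (X ω * B) i j) p P := by
  simp only [Matrix.mul_apply]
  exact memLp_finsetSum _ fun l _ => (hX i l).mul_const _

/-- The jamming channels are products of two matrices with Gaussian-type moments; fourth moments of
the factors give second moments of the product. -/
instance holderTriple_four_four_two : ENNReal.HolderTriple 4 4 2 where
  inv_add_inv_eq_inv := by
    rw [← two_mul, show (4 : ℝ≥0∞) = 2 * 2 by norm_num, ENNReal.mul_inv (by simp) (by simp),
      ← mul_assoc, ENNReal.mul_inv_cancel (by simp) (by simp), one_mul]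

end MatrixMemLp


/-! ### Regularity of the channels, precoders and combiners -/

namespace Signals

section Measurability

variable {Ω : Type*} {m₀ : MeasurableSpace Ω} {M N Nt Nr τ τr τt : ℕ}
  {S : Signals Ω M N Nt Nr τ τr τt} (p : SystemParams M N Nt Nr τ τr τt)

lemma measurable_Grt (hS : ∀ i, Measurable (S.train i)) (i : Fin Nt) (j : Fin Nr) :
    Measurable fun ω => S.Grt p ω i j :=
  (hS _).const_mul _

lemma measurable_Gmr (hS : ∀ i, Measurable (S.train i)) (m : Fin M) (i : Fin N) (j : Fin Nr) :
    Measurable fun ω => S.Gmr p m ω i j :=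
  (hS _).const_mul _

lemma measurable_Gtm (hS : ∀ i, Measurable (S.train i)) (m : Fin M) (i : Fin Nt) (j : Fin N) :
    Measurable fun ω => S.Gtm p m ω i j :=
  (hS _).const_mul _

lemma measurable_Gmm (hS : ∀ i, Measurable (S.train i)) (m m' : Fin M) (i j : Fin N) :
    Measurable fun ω => S.Gmm p m m' ω i j := by
  simp only [Gmm, Matrix.of_apply]
  split_ifs
  · exact measurable_const
  · exact (hS _).const_mul _

lemma measurable_GrtHat (hS : ∀ i, Measurable (S.train i)) (i : Fin Nt) (j : Fin Nr) :
    Measurable fun ω => S.GrtHat p ω i j :=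
  measurable_matrix_smul _ (measurable_matrix_mul_const (measurable_matrix_add
    (measurable_matrix_smul _ (measurable_matrix_mul_const (measurable_Grt p hS) _))
    (Y := fun ω => Matrix.of fun i s => S.train (.noiseUT i s) ω) fun _ _ => hS _) _) i j

lemma measurable_GmrHat (hS : ∀ i, Measurable (S.train i)) (m : Fin M) (i : Fin N) (j : Fin Nr) :
    Measurable fun ω => S.GmrHat p m ω i j :=
  measurable_matrix_smul _ (measurable_matrix_mul_const (measurable_matrix_add
    (measurable_matrix_smul _ (measurable_matrix_mul_const (measurable_Gmr p hS m) _))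
    (Y := fun ω => Matrix.of fun i s => S.train (.noiseULMN m i s) ω) fun _ _ => hS _) _) i j

lemma measurable_W (hS : ∀ i, Measurable (S.train i)) (i : Fin Nt) (j : Fin Nr) :
    Measurable fun ω => S.W p ω i j := by
  have hG : Measurable fun ω (i : Fin Nt) (j : Fin Nr) => S.GrtHat p ω i j :=
    measurable_pi_lambda _ fun i => measurable_pi_lambda _ fun j => measurable_GrtHat p hS i j
  have hp : ∀ i j, Measurable fun ω => p.precoder (S.GrtHat p ω) i j := fun i j =>
    (p.precoder_measurable i j).comp hG
  refine (hp i j).div (Complex.measurable_ofReal.comp (Real.continuous_sqrt.measurable.comp ?_))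
  exact Finset.measurable_fun_sum _ fun i' _ => (hp i' j).norm.pow_const 2

lemma measurable_A (hS : ∀ i, Measurable (S.train i)) (i j : Fin Nr) :
    Measurable fun ω => S.A p ω i j :=
  measurable_matrix_mul (measurable_matrix_conjTranspose (measurable_Grt p hS))
    (measurable_W p hS) i j

lemma measurable_B (hS : ∀ i, Measurable (S.train i)) (m : Fin M) (i : Fin N) (j : Fin Nr) :
    Measurable fun ω => S.B p m ω i j :=
  measurable_matrix_mul (measurable_matrix_conjTranspose (measurable_Gtm p hS m))
    (measurable_W p hS) i j

lemma measurable_YtildeMN (hS : ∀ i, Measurable (S.train i)) (m : Fin M) (i : Fin N)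
    (j : Fin Nr) : Measurable fun ω => S.YtildeMN p m ω i j :=
  measurable_matrix_mul_const (measurable_matrix_add
    (measurable_matrix_smul _ (measurable_matrix_mul_const (measurable_B p hS m) _))
    (Y := fun ω => Matrix.of fun i s => S.train (.noiseBFMN m i s) ω) fun _ _ => hS _) _ i j

lemma measurable_FJr (hS : ∀ i, Measurable (S.train i)) (i j : Fin Nr) :
    Measurable fun ω => S.FJr p ω i j :=
  measurable_matrix_sum _ (fun m => measurable_matrix_smul _ (measurable_matrix_mul_const
    (measurable_matrix_mul (measurable_matrix_conjTranspose (measurable_Gmr p hS m))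
      (measurable_GmrHat p hS m)) _)) i j

lemma measurable_FJ (hS : ∀ i, Measurable (S.train i)) (m : Fin M) (i : Fin N) (j : Fin Nr) :
    Measurable fun ω => S.FJ p m ω i j :=
  measurable_matrix_sum _ (fun m' => measurable_matrix_smul _ (measurable_matrix_mul_const
    (measurable_matrix_mul (measurable_matrix_conjTranspose (measurable_Gmm p hS m m'))
      (measurable_GmrHat p hS m')) _)) i j

end Measurability

section CombinerMeasurability

variable {Ω : Type*} {m₁ : MeasurableSpace Ω} [MeasurableSpace Ω] {M N Nt Nr τ τr τt : ℕ}
  {S : Signals Ω M N Nt Nr τ τr τt} (p : SystemParams M N Nt Nr τ τr τt) (P : Measure Ω)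

/-- The measure enters only through deterministic moments, so `m₁` may differ from the sigma-algebra
that carries `P`. It is taken to be the ambient one as well as the one generated by the training
variables. -/
lemma measurable_bHat (hS : ∀ i, Measurable[m₁] (S.train i)) (m : Fin M) (a : Fin N)
    (i : Fin Nr) (j : Fin 1) : Measurable[m₁] fun ω => S.bHat p P m a ω i j := by
  have hy : ∀ (i : Fin Nr) (j : Fin 1), Measurable[m₁] fun ω => (S.ycol p m a ω -
      (Real.sqrt (τt * p.ρt) : ℂ) • matExp P (S.bcol p m a)) i j := fun i _ =>
    (Complex.continuous_conj.measurable.comp (measurable_YtildeMN p hS m a i)).sub measurable_const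
  exact measurable_matrix_add (X := fun _ => matExp P (S.bcol p m a))
    (fun _ _ => measurable_const) (measurable_matrix_smul _ (measurable_matrix_const_mul _ hy)) i j

lemma measurable_BHat (hS : ∀ i, Measurable[m₁] (S.train i)) (m : Fin M)
    (i : Fin N) (j : Fin Nr) : Measurable[m₁] fun ω => S.BHat p P m ω i j :=
  Complex.continuous_conj.measurable.comp (measurable_bHat p P hS m i j 0)

lemma measurable_V (hS : ∀ i, Measurable[m₁] (S.train i)) (m : Fin M)
    (i : Fin N) (j : Fin Nr) : Measurable[m₁] fun ω => S.V p P m ω i j :=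
  measurable_matrix_mul (measurable_BHat p P hS m) (measurable_matrix_inv
    (measurable_matrix_add (measurable_matrix_mul
      (measurable_matrix_conjTranspose (measurable_BHat p P hS m)) (measurable_BHat p P hS m))
      (Y := fun _ => (p.ϱ : ℂ) • 1) fun _ _ => measurable_const)) i j

end CombinerMeasurability

/-! ### Boundedness of precoder and combiner -/

section Bounds

/-- The entries of a regularized pseudoinverse are bounded. -/
lemma norm_sq_regularized_inverse_le {ι κ : Type*} [Fintype ι] [Fintype κ] [DecidableEq κ]
    (B : Matrix ι κ ℂ) {r : ℝ} (hr : 0 < r) (i : ι) (j : κ) :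
    ‖(B * (Bᴴ * B + (r : ℂ) • (1 : Matrix κ κ ℂ))⁻¹) i j‖ ^ 2 ≤ 1 / (4 * r) := by
  set Q := Bᴴ * B + (r : ℂ) • (1 : Matrix κ κ ℂ) with hQ
  have hQpd : Q.PosDef :=
    (Matrix.PosDef.one.smul (by exact_mod_cast hr : (0 : ℂ) < (r : ℂ))).posSemidef_add
    (Matrix.posSemidef_conjTranspose_mul_self B)
  set w : κ → ℂ := fun l => Q⁻¹ l j with hw
  have hQw : Q *ᵥ w = Pi.single j 1 := by
    have h1 : Q *ᵥ (Q⁻¹ *ᵥ Pi.single j 1) = Pi.single j 1 := by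
      rw [Matrix.mulVec_mulVec, Matrix.mul_nonsing_inv _ hQpd.det_pos.ne'.isUnit, Matrix.one_mulVec]
    rwa [Matrix.mulVec_single_one] at h1
  have hquad : star w ⬝ᵥ (Q *ᵥ w) = ((∑ a, ‖(B *ᵥ w) a‖ ^ 2 + r * ∑ l, ‖w l‖ ^ 2 : ℝ) : ℂ) := by
    rw [hQ, Matrix.add_mulVec, dotProduct_add, ← Matrix.mulVec_mulVec, Matrix.dotProduct_mulVec,
      ← Matrix.star_mulVec, Matrix.smul_mulVec, Matrix.one_mulVec, dotProduct_smul]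
    simp only [dotProduct, Pi.star_apply, RCLike.star_def, smul_eq_mul]
    push_cast
    congr 1
    · exact Finset.sum_congr rfl fun a _ => by
        rw [mul_comm, Complex.mul_conj, Complex.normSq_eq_norm_sq]; push_cast; rfl
    · congr 1
      exact Finset.sum_congr rfl fun a _ => by
        rw [mul_comm, Complex.mul_conj, Complex.normSq_eq_norm_sq]; push_cast; rfl
  rw [hQw] at hquad
  have hre := congrArg Complex.re hquad
  rw [Complex.ofReal_re, dotProduct_single, mul_one] at hre
  have hwj : (star w j).re ≤ ‖w j‖ := by
    rw [Pi.star_apply, RCLike.star_def, Complex.conj_re]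
    exact Complex.re_le_norm _
  have h1 : ‖(B *ᵥ w) i‖ ^ 2 ≤ ∑ a, ‖(B *ᵥ w) a‖ ^ 2 :=
    Finset.single_le_sum (f := fun a => ‖(B *ᵥ w) a‖ ^ 2) (fun _ _ => by positivity)
      (Finset.mem_univ i)
  have h2 : ‖w j‖ ^ 2 ≤ ∑ l, ‖w l‖ ^ 2 :=
    Finset.single_le_sum (f := fun l => ‖w l‖ ^ 2) (fun _ _ => by positivity) (Finset.mem_univ j)
  have h3 : (B * Q⁻¹) i j = (B *ᵥ w) i := rfl
  rw [h3, le_div_iff₀ (by positivity)]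
  -- From `wᴴ Q w = conj (w j)`. The maximum of `s - r s²` is `1 / (4 r)`, at `s = 1 / (2 r)`, which
  -- explains the square in the last line.
  have h4 : ‖(B *ᵥ w) i‖ ^ 2 ≤ ‖w j‖ - r * ‖w j‖ ^ 2 := by nlinarith
  nlinarith [sq_nonneg (2 * r * ‖w j‖ - 1)]

variable {Ω : Type*} [MeasurableSpace Ω] {M N Nt Nr τ τr τt : ℕ}
  {S : Signals Ω M N Nt Nr τ τr τt} (p : SystemParams M N Nt Nr τ τr τt) {P : Measure Ω}

/-- A vanishing precoding vector is included: its normalization is `0 / 0 = 0`. -/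
lemma norm_W_le_one (ω : Ω) (i : Fin Nt) (j : Fin Nr) : ‖S.W p ω i j‖ ≤ 1 := by
  simp only [W, Matrix.of_apply]
  rw [norm_div, Complex.norm_real, Real.norm_eq_abs, abs_of_nonneg (Real.sqrt_nonneg _)]
  refine div_le_one_of_le₀ (Real.le_sqrt_of_sq_le ?_) (Real.sqrt_nonneg _)
  exact Finset.single_le_sum (f := fun i' => ‖p.precoder (S.GrtHat p ω) i' j‖ ^ 2)
    (fun _ _ => by positivity) (Finset.mem_univ i)

lemma norm_V_le (m : Fin M) (ω : Ω) (i : Fin N) (j : Fin Nr) :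
    ‖S.V p P m ω i j‖ ≤ √(1 / (4 * p.ϱ)) :=
  Real.le_sqrt_of_sq_le (norm_sq_regularized_inverse_le _ p.ϱ_pos i j)

end Bounds

section Moments

variable {Ω : Type*} [MeasurableSpace Ω] {M N Nt Nr τ τr τt : ℕ}
  {S : Signals Ω M N Nt Nr τ τr τt} (p : SystemParams M N Nt Nr τ τr τt) {P : Measure Ω}
  [IsProbabilityMeasure P] (hS : S.IsModel P)
include hS

lemma memLp_train (i : TrainIdx M N Nt Nr τr τt) (q : ℝ≥0) : MemLp (S.train i) q P := by
  have h1 := memLp_id_stdComplexGaussian q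
  rw [← hS.train_law i, memLp_map_measure_iff aestronglyMeasurable_id
    (hS.train_measurable i).aemeasurable] at h1
  exact h1

lemma memLp_Grt (q : ℝ≥0) (i : Fin Nt) (j : Fin Nr) : MemLp (fun ω => S.Grt p ω i j) q P :=
  (memLp_train hS _ q).const_mul _

lemma memLp_Gmr (q : ℝ≥0) (m : Fin M) (i : Fin N) (j : Fin Nr) :
    MemLp (fun ω => S.Gmr p m ω i j) q P :=
  (memLp_train hS _ q).const_mul _

lemma memLp_Gtm (q : ℝ≥0) (m : Fin M) (i : Fin Nt) (j : Fin N) :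
    MemLp (fun ω => S.Gtm p m ω i j) q P :=
  (memLp_train hS _ q).const_mul _

lemma memLp_Gmm (q : ℝ≥0) (m m' : Fin M) (i j : Fin N) :
    MemLp (fun ω => S.Gmm p m m' ω i j) q P := by
  simp only [Gmm, Matrix.of_apply]
  split_ifs
  · exact memLp_const 0
  · exact (memLp_train hS _ q).const_mul _

lemma memLp_GmrHat (q : ℝ≥0) (m : Fin M) (i : Fin N) (j : Fin Nr) :
    MemLp (fun ω => S.GmrHat p m ω i j) q P := by
  refine memLp_matrix_smul _ (memLp_matrix_mul_const (memLp_matrix_add (memLp_matrix_smul _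
    (memLp_matrix_mul_const (memLp_Gmr p hS q m) _)) fun i j => ?_) _) i j
  exact memLp_train hS _ q

lemma memLp_W (i : Fin Nt) (j : Fin Nr) : MemLp (fun ω => S.W p ω i j) ∞ P :=
  memLp_top_of_bound (measurable_W p hS.train_measurable i j).aestronglyMeasurable 1
    (ae_of_all _ fun ω => norm_W_le_one p ω i j)

/-- The combiner is a nonlinear function of estimates correlated with the channel; boundedness, due
to the positive regularization, makes products such as `D` square integrable regardless of this
dependence. -/
lemma memLp_V (m : Fin M) (i : Fin N) (j : Fin Nr) : MemLp (fun ω => S.V p P m ω i j) ∞ P :=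
  memLp_top_of_bound (measurable_V p P hS.train_measurable m i j).aestronglyMeasurable _
    (ae_of_all _ fun ω => norm_V_le p m ω i j)

lemma memLp_A (i j : Fin Nr) : MemLp (fun ω => S.A p ω i j) 2 P :=
  memLp_matrix_mul (p := 2) (q := ∞) (memLp_matrix_conjTranspose (memLp_Grt p hS 2))
    (memLp_W p hS) i j

lemma memLp_B (m : Fin M) (i : Fin N) (j : Fin Nr) : MemLp (fun ω => S.B p m ω i j) 2 P :=
  memLp_matrix_mul (p := 2) (q := ∞) (memLp_matrix_conjTranspose (memLp_Gtm p hS 2 m))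
    (memLp_W p hS) i j

lemma memLp_FJr (i j : Fin Nr) : MemLp (fun ω => S.FJr p ω i j) 2 P :=
  memLp_matrix_sum _ (fun m => memLp_matrix_smul _ (memLp_matrix_mul_const
    (memLp_matrix_mul (p := 4) (q := 4) (memLp_matrix_conjTranspose (memLp_Gmr p hS 4 m))
      (memLp_GmrHat p hS 4 m)) _)) i j

lemma memLp_FJ (m : Fin M) (i : Fin N) (j : Fin Nr) : MemLp (fun ω => S.FJ p m ω i j) 2 P :=
  memLp_matrix_sum _ (fun m' => memLp_matrix_smul _ (memLp_matrix_mul_const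
    (memLp_matrix_mul (p := 4) (q := 4) (memLp_matrix_conjTranspose (memLp_Gmm p hS 4 m m'))
      (memLp_GmrHat p hS 4 m')) _)) i j

lemma memLp_D (i j : Fin Nr) : MemLp (fun ω => S.D p P ω i j) 2 P :=
  memLp_matrix_sum _ (fun m => memLp_matrix_smul _ (memLp_matrix_mul_const
    (memLp_matrix_mul (p := ∞) (q := 2) (memLp_matrix_conjTranspose (memLp_V p hS m))
      (memLp_B p hS m)) _)) i j

/-! #### Data-phase variables -/

lemma memLp_data (i : DataIdx M N Nr (τ - (τt + τr))) : MemLp (S.data i) 2 P := by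
  have h1 := memLp_id_stdComplexGaussian 2
  rw [← hS.data_law i, memLp_map_measure_iff aestronglyMeasurable_id
    (hS.data_measurable i).aemeasurable] at h1
  exact h1

lemma integral_data (i : DataIdx M N Nr (τ - (τt + τr))) : ∫ ω, S.data i ω ∂P = 0 := by
  rw [← integral_id_stdComplexGaussian, ← hS.data_law i,
    integral_map (hS.data_measurable i).aemeasurable (by fun_prop)]

lemma integral_data_mul_conj_self (i : DataIdx M N Nr (τ - (τt + τr))) :
    ∫ ω, S.data i ω * conj (S.data i ω) ∂P = 1 := by
  simp_rw [Complex.mul_conj, Complex.normSq_eq_norm_sq]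
  rw [integral_complex_ofReal, ← Complex.ofReal_one, ← integral_norm_sq_stdComplexGaussian,
    ← hS.data_law i, integral_map (hS.data_measurable i).aemeasurable (by fun_prop)]

lemma integral_data_mul_conj_of_ne {i i' : DataIdx M N Nr (τ - (τt + τr))} (hi : i ≠ i') :
    ∫ ω, S.data i ω * conj (S.data i' ω) ∂P = 0 := by
  have h2 : IndepFun (S.data i) (fun ω => conj (S.data i' ω)) P :=
    (hS.data_indep.indepFun hi).comp measurable_id Complex.continuous_conj.measurable
  rw [h2.integral_fun_mul_eq_mul_integral (hS.data_measurable i).aestronglyMeasurable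
    (Complex.continuous_conj.measurable.comp (hS.data_measurable i')).aestronglyMeasurable,
    integral_data hS, zero_mul]

lemma integral_data_mul_conj_jam (i : DataIdx M N Nr (τ - (τt + τr)))
    (t : Fin (τ - (τt + τr))) (n : Fin Nr) :
    ∫ ω, S.data i ω * conj (S.jam t n ω) ∂P = 0 := by
  have h2 : IndepFun (S.data i) (fun ω => conj (S.jam t n ω)) P :=
    hS.data_jam_indep.comp (φ := fun d : DataIdx M N Nr (τ - (τt + τr)) → ℂ => d i)
      (ψ := fun z : Fin (τ - (τt + τr)) → Fin Nr → ℂ => conj (z t n)) (by fun_prop)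
      (Complex.continuous_conj.measurable.comp (by fun_prop))
  rw [h2.integral_fun_mul_eq_mul_integral (hS.data_measurable i).aestronglyMeasurable
    (Complex.continuous_conj.measurable.comp (hS.jam_measurable t n)).aestronglyMeasurable,
    integral_data hS, zero_mul]

lemma integral_jam_mul_conj_data (i : DataIdx M N Nr (τ - (τt + τr)))
    (t : Fin (τ - (τt + τr))) (n : Fin Nr) :
    ∫ ω, S.jam t n ω * conj (S.data i ω) ∂P = 0 := by
  have h1 : ∫ ω, conj (S.data i ω * conj (S.jam t n ω)) ∂P = 0 := by
    rw [integral_conj, integral_data_mul_conj_jam hS, map_zero]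
  simpa [mul_comm] using h1

lemma map_symbols : P.map (fun ω (q : Fin (τ - (τt + τr)) × Fin Nr) => S.x q.1 ω q.2) =
    Measure.pi fun _ => stdComplexGaussian := by
  have h1 := hS.data_indep.precomp
    (g := fun q : Fin (τ - (τt + τr)) × Fin Nr => DataIdx.sym q.1 q.2)
    fun q q' hq => by
      simp only [DataIdx.sym.injEq] at hq
      exact Prod.ext hq.1 hq.2
  rw [iIndepFun_iff_map_fun_eq_pi_map
    (f := fun (q : Fin (τ - (τt + τr)) × Fin Nr) ω => S.data (.sym q.1 q.2) ω)
    fun q => (hS.data_measurable _).aemeasurable] at h1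
  refine h1.trans ?_
  congr 1
  ext1 q
  exact hS.data_law _

end Moments

end Signals


/-! ### The receivers of the monitoring system as fading channels -/

namespace Signals

variable {Ω 𝓣 : Type*} [MeasurableSpace Ω] [MeasurableSpace 𝓣] {M N Nt Nr τ τr τt : ℕ}
  {S : Signals Ω M N Nt Nr τ τr τt} (p : SystemParams M N Nt Nr τ τr τt) {P : Measure Ω}
  [IsProbabilityMeasure P] {Θ : Ω → 𝓣}

/-- The sigma-algebra generated by fading and training noise. -/
abbrev trainAlgebra (S : Signals Ω M N Nt Nr τ τr τt) : MeasurableSpace Ω :=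
  MeasurableSpace.comap (fun ω i => S.train i ω) inferInstance

lemma measurable_train_trainAlgebra (i : TrainIdx M N Nt Nr τr τt) :
    Measurable[S.trainAlgebra] (S.train i) :=
  (measurable_pi_apply i).comp (comap_measurable fun ω i => S.train i ω)

/-! ### From the system model to the abstract fading channel -/

section State

variable {E : Type*} [MeasurableSpace E] {Z : Ω → E}

/-- The sigma-algebra of state and side information lies in that of training variables and side
information, which is independent of the data phase. -/
lemma IsSideInfo.indepFun_state (hΘ : S.IsSideInfo P Θ) (hZ : Measurable[S.trainAlgebra] Z)
    {β : Type*} [MeasurableSpace β]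
    {ψ : (DataIdx M N Nr (τ - (τt + τr)) → ℂ) × (Fin (τ - (τt + τr)) → Fin Nr → ℂ) → β}
    (hψ : Measurable ψ) :
    IndepFun (fun ω => (Z ω, Θ ω))
      (fun ω => ψ ((fun i => S.data i ω), (fun t n => S.jam t n ω))) P := by
  have h1 := hΘ.indep.comp measurable_id hψ
  rw [IndepFun_iff_Indep] at h1 ⊢
  refine indep_of_indep_of_le_left h1 ?_
  rw [← measurable_iff_comap_le]
  set F : Ω → (TrainIdx M N Nt Nr τr τt → ℂ) × 𝓣 := fun ω => ((fun i => S.train i ω), Θ ω)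
  have hF : Measurable[MeasurableSpace.comap F inferInstance] F := comap_measurable F
  have hle : S.trainAlgebra ≤ MeasurableSpace.comap F inferInstance :=
    measurable_iff_comap_le.1 (measurable_fst.comp hF)
  exact (hZ.mono hle le_rfl).prodMk (measurable_snd.comp hF)

/-- The noise vector joins the jamming symbols with the noise samples picked by `idx`. Injectivity
of `idx` makes the picked samples white, and avoiding the symbol indices makes them uncorrelated
with the data. -/
lemma isFadingChannel_of_isModel (hS : S.IsModel P) (hΘ : S.IsSideInfo P Θ)
    {ι ν : Type*} [Fintype ι] [Fintype ν] [DecidableEq ν]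
    {A : E → Matrix ι (Fin Nr) ℂ} {G : E → Matrix ι (Fin Nr ⊕ ν) ℂ}
    {R : E → Matrix (Fin Nr ⊕ ν) (Fin Nr) ℂ}
    (idx : Fin (τ - (τt + τr)) → ν → DataIdx M N Nr (τ - (τt + τr)))
    (hinj : ∀ t, Function.Injective (idx t)) (hne : ∀ t t' j l, DataIdx.sym t' j ≠ idx t l)
    (hZ : Measurable Z) (hZt : Measurable[S.trainAlgebra] Z)
    (hA : ∀ i j, Measurable fun e => A e i j)
    (hG : ∀ i j, Measurable fun e => G e i j) (hR : ∀ i j, Measurable fun e => R e i j)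
    (hA2 : ∀ i j, MemLp (fun ω => A (Z ω) i j) 2 P)
    (hG2 : ∀ i j, MemLp (fun ω => G (Z ω) i j) 2 P)
    (hR2 : ∀ i j, MemLp (fun ω => R (Z ω) i j) 2 P) (hAGR : ∀ e, A e = G e * R e) :
    IsFadingChannel P Θ Z A G R (fun t ω => S.x t ω)
      (fun t ω => Sum.elim (S.xJ t ω) fun l => S.data (idx t l) ω) where
  measurable_side := hΘ.measurable
  measurable_state := hZ
  measurable_signal := hA
  measurable_noise := hG
  measurable_factor := hR
  memLp_signal := hA2
  memLp_noise := hG2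
  memLp_factor := hR2
  signal_eq := hAGR
  measurable_x t j := hS.data_measurable _
  measurable_v t l := by
    rcases l with l | l
    · exact hS.jam_measurable t l
    · exact hS.data_measurable _
  law_x := map_symbols hS
  memLp_v t l := by
    rcases l with l | l
    · exact hS.jam_memLp t l
    · exact memLp_data hS _
  cov_v t l l' := by
    rcases l with l | l <;> rcases l' with l' | l'
    · simpa [xJ] using hS.jam_cov t l l'
    · simpa [xJ] using integral_jam_mul_conj_data hS (idx t l') t l
    · simpa [xJ] using integral_data_mul_conj_jam hS (idx t l) t l'
    · by_cases h : l = l'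
      · subst h
        simpa using integral_data_mul_conj_self hS (idx t l)
      · simpa [h] using integral_data_mul_conj_of_ne hS fun he => h (hinj t he)
  cov_xv t j l := by
    rcases l with l | l
    · simpa [xJ, x] using integral_data_mul_conj_jam hS (.sym t j) t l
    · simpa [x] using integral_data_mul_conj_of_ne hS (hne t t j l)
  indep := by
    refine hΘ.indepFun_state hZt
      (ψ := fun q => ((fun t j => q.1 (.sym t j)),
        (fun t => Sum.elim (q.2 t) fun l => q.1 (idx t l)))) ?_
    refine Measurable.prodMk (by fun_prop) (measurable_pi_lambda _ fun t =>
      measurable_pi_lambda _ fun l => ?_)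
    rcases l with l | l
    · simp only [Sum.elim_inl]
      fun_prop
    · simp only [Sum.elim_inr]
      fun_prop

end State

lemma lamSqrt_conjTranspose : p.lamSqrtᴴ = p.lamSqrt := by
  rw [SystemParams.lamSqrt, Matrix.diagonal_conjTranspose]
  congr 1
  ext n
  simp

lemma lamSqrt_mul_lamSqrt : p.lamSqrt * p.lamSqrt = p.Lam := by
  rw [SystemParams.lamSqrt, Matrix.diagonal_mul_diagonal, SystemParams.Lam]
  congr 1
  ext n
  rw [← Complex.ofReal_mul, Real.mul_self_sqrt (p.lam_nonneg n)]

lemma ofReal_sqrt_mul_self {r : ℝ} (hr : 0 ≤ r) : (Real.sqrt r : ℂ) * (Real.sqrt r : ℂ) = r := by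
  rw [← Complex.ofReal_mul, Real.mul_self_sqrt hr]

lemma smul_mul_conjTranspose_smul {ι κ : Type*} [Fintype κ] {r : ℝ} (hr : 0 ≤ r)
    (B C : Matrix ι κ ℂ) :
    ((Real.sqrt r : ℂ) • B) * ((Real.sqrt r : ℂ) • C)ᴴ = (r : ℂ) • (B * Cᴴ) := by
  rw [Matrix.conjTranspose_smul, RCLike.star_def, Complex.conj_ofReal, Matrix.smul_mul,
    Matrix.mul_smul, smul_smul, ofReal_sqrt_mul_self hr]

/-! #### The untrusted receiver -/

section UR

/-- State space of the channel to the UR: the jamming channel and the signal channel. -/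
abbrev StateUR (Nr : ℕ) := (Fin Nr → Fin Nr → ℂ) × (Fin Nr → Fin Nr → ℂ)

instance standardBorelSpace_stateUR : StandardBorelSpace (StateUR Nr) :=
  have _ : StandardBorelSpace (Fin Nr → Fin Nr → ℂ) := inferInstance
  StandardBorelSpace.prod

variable (S) in
/-- State of the channel to the UR. -/
def stateUR (ω : Ω) : StateUR Nr := (fun i j => S.FJr p ω i j, fun i j => S.A p ω i j)

/-- Signal channel to the UR. -/
def signalUR (e : StateUR Nr) : Matrix (Fin Nr) (Fin Nr) ℂ :=
  (Real.sqrt p.ρt : ℂ) • (Matrix.of e.2 * p.lamSqrt)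

/-- Noise channel to the UR. -/
def noiseUR (e : StateUR Nr) : Matrix (Fin Nr) (Fin Nr ⊕ Fin Nr) ℂ :=
  Matrix.fromCols ((Real.sqrt p.ρJ : ℂ) • Matrix.of e.1) 1

/-- The noise channel contains an identity block for the receiver noise, so any signal channel
factors through it trivially. -/
lemma isFadingChannel_UR (hS : S.IsModel P) (hΘ : S.IsSideInfo P Θ) :
    IsFadingChannel P Θ (S.stateUR p) (signalUR p) (noiseUR p)
      (fun e => Matrix.fromRows 0 (signalUR p e)) (fun t ω => S.x t ω)
      (fun t ω => Sum.elim (S.xJ t ω) fun l => S.data (.noiseUR t l) ω) := by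
  have hsig : ∀ i j, Measurable fun e : StateUR Nr => signalUR p e i j :=
    measurable_matrix_smul _ (measurable_matrix_mul_const (X := fun e : StateUR Nr => Matrix.of e.2)
      (fun i j => by simp only [Matrix.of_apply]; fun_prop) _)
  have hsig2 : ∀ i j, MemLp (fun ω => signalUR p (S.stateUR p ω) i j) 2 P :=
    memLp_matrix_smul _ (memLp_matrix_mul_const (memLp_A p hS) _)
  have hst : ∀ m₁ : MeasurableSpace Ω, (∀ i, Measurable[m₁] (S.train i)) →
      Measurable[m₁] (S.stateUR p) := fun m₁ hm =>
    (measurable_pi_lambda _ fun i => measurable_pi_lambda _ fun j =>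
      measurable_FJr p hm i j).prodMk
    (measurable_pi_lambda _ fun i => measurable_pi_lambda _ fun j => measurable_A p hm i j)
  refine isFadingChannel_of_isModel hS hΘ (fun t l => .noiseUR t l) (fun t l l' h => ?_)
    (fun t t' j l => by simp) (hst _ hS.train_measurable) (hst _ measurable_train_trainAlgebra)
    hsig ?_ ?_ hsig2 ?_ ?_ fun e => ?_
  · simpa using h
  · rintro i (j | j)
    · simp only [noiseUR, Matrix.fromCols_apply_inl, Matrix.smul_apply, Matrix.of_apply]
      fun_prop
    · simp only [noiseUR, Matrix.fromCols_apply_inr]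
      exact measurable_const
  · rintro (i | i) j
    · simp only [Matrix.fromRows_apply_inl]
      exact measurable_const
    · simp only [Matrix.fromRows_apply_inr]
      exact hsig i j
  · rintro i (j | j)
    · simp only [noiseUR, Matrix.fromCols_apply_inl]
      exact (memLp_FJr p hS i j).const_mul _
    · simp only [noiseUR, Matrix.fromCols_apply_inr]
      exact memLp_const _
  · rintro (i | i) j
    · simp only [Matrix.fromRows_apply_inl]
      exact memLp_const _
    · simp only [Matrix.fromRows_apply_inr]
      exact hsig2 i j
  · rw [noiseUR, Matrix.fromCols_mul_fromRows, Matrix.mul_zero, Matrix.one_mul, zero_add]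

lemma sum_norm_sq_le_noiseUR (e : StateUR Nr) (u : Fin Nr → ℂ) :
    ∑ i, ‖u i‖ ^ 2 ≤ ∑ l, ‖(star u ᵥ* noiseUR p e) l‖ ^ 2 := by
  rw [noiseUR, Matrix.vecMul_fromCols, Fintype.sum_sum_type]
  simp only [Sum.elim_inl, Sum.elim_inr, Matrix.vecMul_one, Pi.star_apply, norm_star]
  exact le_add_of_nonneg_left (Finset.sum_nonneg fun _ _ => by positivity)

lemma received_UR (t : Fin (τ - (τt + τr))) (ω : Ω) :
    IsFadingChannel.received (S.stateUR p) (signalUR p) (noiseUR p) (fun t ω => S.x t ω)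
      (fun t ω => Sum.elim (S.xJ t ω) fun l => S.data (.noiseUR t l) ω) t ω = S.yUR p t ω := by
  have h1 : Matrix.of (S.stateUR p ω).2 = (S.Grt p ω)ᴴ * S.W p ω := rfl
  have h2 : Matrix.of (S.stateUR p ω).1 = S.FJr p ω := rfl
  rw [IsFadingChannel.received, signalUR, noiseUR, Matrix.fromCols_mulVec_sumElim, h1, h2, yUR,
    Matrix.one_mulVec, ← add_assoc]
  congr 2
  · rw [sUT, Matrix.mulVec_smul, Matrix.mulVec_mulVec, Matrix.smul_mulVec, Matrix.mul_assoc]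
  · rw [FJr, Matrix.smul_mulVec, Matrix.sum_mulVec, Finset.smul_sum]
    refine Finset.sum_congr rfl fun m _ => ?_
    rw [sMN, Matrix.mulVec_smul, Matrix.mulVec_mulVec, Matrix.smul_mulVec, smul_smul,
      Matrix.mul_assoc, mul_comm]

end UR

end Signals


namespace Signals

variable {Ω 𝓣 : Type*} [MeasurableSpace Ω] [MeasurableSpace 𝓣] {M N Nt Nr τ τr τt : ℕ}
  {S : Signals Ω M N Nt Nr τ τr τt} (p : SystemParams M N Nt Nr τ τr τt) {P : Measure Ω}
  [IsProbabilityMeasure P] {Θ : Ω → 𝓣}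

/-! #### The central processing unit -/

section CPU

/-- The mode indicator occurs both in the signal at a node and in the combining at the CPU; being
binary, it counts once. -/
lemma alpha_mul_self (m : Fin M) : (p.α m : ℂ) * (p.α m : ℂ) = p.α m := by
  rcases p.α_binary m with h | h <;> simp [h]

variable (S P) in
/-- Jamming channel to the CPU (without the factor `√ρJ`). -/
def FJc (ω : Ω) : Matrix (Fin Nr) (Fin Nr) ℂ :=
  ∑ m, (p.α m : ℂ) • ((S.V p P m ω)ᴴ * S.FJ p m ω)

variable (S P) in
/-- Channel from the noise at the MNs to the CPU. -/
def combiner (ω : Ω) : Matrix (Fin Nr) (Fin M × Fin N) ℂ :=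
  Matrix.of fun i q => (p.α q.1 : ℂ) * (S.V p P q.1 ω)ᴴ i q.2

/-- The matrix with the blocks `C 0, C 1, …` on top of each other. -/
def stack {κ : Type*} (C : Fin M → Matrix (Fin N) κ ℂ) : Matrix (Fin M × Fin N) κ ℂ :=
  Matrix.of fun q j => C q.1 q.2 j

variable (S) in
/-- Stacked signal channels to the MNs. -/
def stackedB (ω : Ω) : Matrix (Fin M × Fin N) (Fin Nr) ℂ :=
  stack fun m => S.B p m ω * p.lamSqrt

/-- State space of the channel to the CPU. -/
abbrev StateCPU (M N Nr : ℕ) :=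
  (Fin Nr → Fin Nr ⊕ Fin M × Fin N → ℂ) × (Fin Nr ⊕ Fin M × Fin N → Fin Nr → ℂ)

instance standardBorelSpace_stateCPU : StandardBorelSpace (StateCPU M N Nr) :=
  have _ : StandardBorelSpace (Fin Nr → Fin Nr ⊕ Fin M × Fin N → ℂ) := inferInstance
  have _ : StandardBorelSpace (Fin Nr ⊕ Fin M × Fin N → Fin Nr → ℂ) := inferInstance
  StandardBorelSpace.prod

variable (S P) in
/-- Noise channel to the CPU. -/
def noiseCPU (ω : Ω) : Matrix (Fin Nr) (Fin Nr ⊕ Fin M × Fin N) ℂ :=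
  Matrix.fromCols ((Real.sqrt p.ρJ : ℂ) • S.FJc p P ω) (S.combiner p P ω)

variable (S) in
/-- Factor of the signal channel to the CPU through the noise channel. -/
def factorCPU (ω : Ω) : Matrix (Fin Nr ⊕ Fin M × Fin N) (Fin Nr) ℂ :=
  Matrix.fromRows 0 ((Real.sqrt p.ρt : ℂ) • S.stackedB p ω)

variable (S P) in
/-- State of the channel to the CPU. -/
def stateCPU (ω : Ω) : StateCPU M N Nr :=
  (fun i l => S.noiseCPU p P ω i l, fun l j => S.factorCPU p ω l j)

lemma combiner_mul {κ : Type*} (ω : Ω) (C : Fin M → Matrix (Fin N) κ ℂ) :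
    S.combiner p P ω * stack C =
      ∑ m, (p.α m : ℂ) • ((S.V p P m ω)ᴴ * C m) := by
  ext i j
  simp only [combiner, stack, Matrix.mul_apply, Matrix.of_apply, Fintype.sum_prod_type,
    Matrix.sum_apply, Matrix.smul_apply, smul_eq_mul, Finset.mul_sum, mul_assoc]

lemma combiner_mulVec (ω : Ω) (c : Fin M → Fin N → ℂ) :
    S.combiner p P ω *ᵥ (fun q => c q.1 q.2) =
      ∑ m, (p.α m : ℂ) • ((S.V p P m ω)ᴴ *ᵥ c m) := by
  ext i
  simp only [combiner, Matrix.mulVec, dotProduct, Matrix.of_apply, Fintype.sum_prod_type,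
    Finset.sum_apply, Pi.smul_apply, smul_eq_mul, Finset.mul_sum, mul_assoc]

lemma combiner_mul_stackedB (ω : Ω) : S.combiner p P ω * S.stackedB p ω = S.D p P ω := by
  rw [stackedB, combiner_mul p ω fun m => S.B p m ω * p.lamSqrt, D]
  simp_rw [Matrix.mul_assoc]

/-- The signal reaches the CPU through the same combiners as the node noise. This factorization is
the substitute for positive definiteness of `Ψ_c`, which can fail. -/
lemma noiseCPU_mul_factorCPU (ω : Ω) :
    S.noiseCPU p P ω * S.factorCPU p ω = (Real.sqrt p.ρt : ℂ) • S.D p P ω := by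
  rw [noiseCPU, factorCPU, Matrix.fromCols_mul_fromRows, Matrix.mul_zero, zero_add,
    Matrix.mul_smul, combiner_mul_stackedB]

lemma combiner_mul_conjTranspose (ω : Ω) : S.combiner p P ω * (S.combiner p P ω)ᴴ =
    ∑ m, (p.α m : ℂ) • ((S.V p P m ω)ᴴ * S.V p P m ω) := by
  have h1 : (S.combiner p P ω)ᴴ =
      stack fun m => (p.α m : ℂ) • S.V p P m ω := by
    ext q j
    simp [combiner, stack, Matrix.conjTranspose_apply]
  rw [h1, combiner_mul p ω fun m => (p.α m : ℂ) • S.V p P m ω]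
  refine Finset.sum_congr rfl fun m _ => ?_
  rw [Matrix.mul_smul, smul_smul, alpha_mul_self]

lemma FJc_mul_conjTranspose (ω : Ω) : S.FJc p P ω * (S.FJc p P ω)ᴴ =
    ∑ m, ∑ l, (p.α m * p.α l : ℂ) •
      ((S.V p P m ω)ᴴ * S.FJ p m ω * (S.FJ p l ω)ᴴ * S.V p P l ω) := by
  rw [FJc, Matrix.conjTranspose_sum, Finset.sum_mul_sum]
  refine Finset.sum_congr rfl fun m _ => Finset.sum_congr rfl fun l _ => ?_
  rw [Matrix.conjTranspose_smul, RCLike.star_def, Complex.conj_ofReal, Matrix.smul_mul,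
    Matrix.mul_smul, smul_smul, Matrix.conjTranspose_mul, Matrix.conjTranspose_conjTranspose,
    Matrix.mul_assoc ((S.V p P m ω)ᴴ * S.FJ p m ω)]

lemma noiseCPU_mul_conjTranspose (ω : Ω) : S.noiseCPU p P ω * (S.noiseCPU p P ω)ᴴ =
    (p.ρJ : ℂ) • (∑ m, ∑ l, (p.α m * p.α l : ℂ) •
      ((S.V p P m ω)ᴴ * S.FJ p m ω * (S.FJ p l ω)ᴴ * S.V p P l ω)) +
    ∑ m, (p.α m : ℂ) • ((S.V p P m ω)ᴴ * S.V p P m ω) := by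
  rw [noiseCPU, Matrix.conjTranspose_fromCols_eq_fromRows_conjTranspose,
    Matrix.fromCols_mul_fromRows, smul_mul_conjTranspose_smul p.ρJ_nonneg,
    combiner_mul_conjTranspose, FJc_mul_conjTranspose]

lemma received_CPU (t : Fin (τ - (τt + τr))) (ω : Ω) :
    IsFadingChannel.received (S.stateCPU p P)
      (fun e => Matrix.of e.1 * Matrix.of e.2) (fun e => Matrix.of e.1) (fun t ω => S.x t ω)
      (fun t ω => Sum.elim (S.xJ t ω) fun q => S.data (.noiseMN t q.1 q.2) ω) t ω =
      S.zCPU p P t ω := by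
  have h1 : Matrix.of (S.stateCPU p P ω).1 = S.noiseCPU p P ω := rfl
  have h2 : Matrix.of (S.stateCPU p P ω).2 = S.factorCPU p ω := rfl
  rw [IsFadingChannel.received, h1, h2, noiseCPU_mul_factorCPU, noiseCPU,
    Matrix.fromCols_mulVec_sumElim,
    combiner_mulVec p ω fun m a => S.data (.noiseMN t m a) ω, zCPU, D, FJc, Matrix.smul_mulVec,
    Matrix.smul_mulVec, Matrix.sum_mulVec, Matrix.sum_mulVec, Finset.smul_sum, Finset.smul_sum,
    ← Finset.sum_add_distrib, ← Finset.sum_add_distrib]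
  refine Finset.sum_congr rfl fun m _ => ?_
  have hsig : (S.Gtm p m ω)ᴴ *ᵥ S.sUT p t ω =
      (Real.sqrt p.ρt : ℂ) • ((S.B p m ω * p.lamSqrt) *ᵥ S.x t ω) := by
    rw [sUT, Matrix.mulVec_smul, Matrix.mulVec_mulVec, B, Matrix.mul_assoc]
  have hjam : ∑ m', (S.Gmm p m m' ω)ᴴ *ᵥ S.sMN p m' t ω =
      (Real.sqrt p.ρJ : ℂ) • (S.FJ p m ω *ᵥ S.xJ t ω) := by
    rw [FJ, Matrix.sum_mulVec, Finset.smul_sum]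
    refine Finset.sum_congr rfl fun m' _ => ?_
    rw [sMN, Matrix.mulVec_smul, Matrix.mulVec_mulVec, Matrix.smul_mulVec, smul_smul,
      Matrix.mul_assoc, mul_comm]
  rw [yMN, hsig, hjam, ← smul_add, ← smul_add, Matrix.mulVec_smul, smul_smul, alpha_mul_self,
    Matrix.mulVec_add, Matrix.mulVec_add, smul_add, smul_add, Matrix.mulVec_smul,
    Matrix.mulVec_smul, Matrix.mulVec_mulVec, Matrix.mulVec_mulVec, Matrix.smul_mulVec,
    Matrix.smul_mulVec, Matrix.mul_assoc, smul_comm (p.α m : ℂ), smul_comm (p.α m : ℂ), ← add_assoc]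

end CPU

section Measurability

lemma measurable_entries_prodMk {α ι κ ι' κ' : Type*} {mα : MeasurableSpace α}
    {X : α → Matrix ι κ ℂ} {Y : α → Matrix ι' κ' ℂ}
    (hX : ∀ i j, Measurable fun a => X a i j) (hY : ∀ i j, Measurable fun a => Y a i j) :
    Measurable fun a => ((fun i j => X a i j), (fun i j => Y a i j)) :=
  (measurable_pi_lambda _ fun i => measurable_pi_lambda _ (hX i)).prodMk
    (measurable_pi_lambda _ fun i => measurable_pi_lambda _ (hY i))

variable {Ω : Type*} {m₁ : MeasurableSpace Ω} [MeasurableSpace Ω] {M N Nt Nr τ τr τt : ℕ}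
  {S : Signals Ω M N Nt Nr τ τr τt} (p : SystemParams M N Nt Nr τ τr τt) (P : Measure Ω)

lemma measurable_noiseCPU (hS : ∀ i, Measurable[m₁] (S.train i)) (i : Fin Nr)
    (l : Fin Nr ⊕ Fin M × Fin N) : Measurable[m₁] fun ω => S.noiseCPU p P ω i l := by
  rcases l with l | l
  · exact measurable_matrix_smul _ (measurable_matrix_sum _ fun m => measurable_matrix_smul _
      (measurable_matrix_mul (measurable_matrix_conjTranspose (measurable_V p P hS m))
        (measurable_FJ p hS m))) i l
  · exact (measurable_matrix_conjTranspose (measurable_V p P hS l.1) i l.2).const_mul _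

lemma measurable_factorCPU (hS : ∀ i, Measurable[m₁] (S.train i)) (l : Fin Nr ⊕ Fin M × Fin N)
    (j : Fin Nr) : Measurable[m₁] fun ω => S.factorCPU p ω l j := by
  rcases l with l | l
  · exact measurable_const
  · exact (measurable_matrix_mul_const (measurable_B p hS l.1) _ l.2 j).const_mul _

lemma measurable_stateCPU (hS : ∀ i, Measurable[m₁] (S.train i)) :
    Measurable[m₁] (S.stateCPU p P) :=
  measurable_entries_prodMk (measurable_noiseCPU p P hS) (measurable_factorCPU p hS)

end Measurability

lemma memLp_FJc (hS : S.IsModel P) (i j : Fin Nr) : MemLp (fun ω => S.FJc p P ω i j) 2 P :=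
  memLp_matrix_sum _ (fun m => memLp_matrix_smul _
    (memLp_matrix_mul (p := ∞) (q := 2) (memLp_matrix_conjTranspose (memLp_V p hS m))
      (memLp_FJ p hS m))) i j

lemma memLp_combiner (hS : S.IsModel P) (i : Fin Nr) (q : Fin M × Fin N) :
    MemLp (fun ω => S.combiner p P ω i q) 2 P :=
  ((memLp_matrix_conjTranspose (memLp_V p hS q.1) i q.2).const_mul _).mono_exponent le_top

/-- The state is the pair of noise channel and factor, with the signal channel defined as their
product, so the factorization holds at every point of the state space. -/
lemma isFadingChannel_CPU (hS : S.IsModel P) (hΘ : S.IsSideInfo P Θ) :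
    IsFadingChannel P Θ (S.stateCPU p P) (fun e => Matrix.of e.1 * Matrix.of e.2)
      (fun e => Matrix.of e.1) (fun e => Matrix.of e.2) (fun t ω => S.x t ω)
      (fun t ω => Sum.elim (S.xJ t ω) fun q => S.data (.noiseMN t q.1 q.2) ω) := by
  have h1 : ∀ i l, Measurable fun e : StateCPU M N Nr => Matrix.of e.1 i l := fun i l => by
    simp only [Matrix.of_apply]
    fun_prop
  have h2 : ∀ l j, Measurable fun e : StateCPU M N Nr => Matrix.of e.2 l j := fun l j => by
    simp only [Matrix.of_apply]
    fun_prop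
  refine isFadingChannel_of_isModel hS hΘ (fun t q => .noiseMN t q.1 q.2) (fun t q q' h => ?_)
    (fun t t' j l => by simp) (measurable_stateCPU p P hS.train_measurable)
    (measurable_stateCPU p P measurable_train_trainAlgebra)
    (measurable_matrix_mul h1 h2) h1 h2 ?_ ?_ ?_ fun e => rfl
  · simp only [DataIdx.noiseMN.injEq, true_and] at h
    exact Prod.ext h.1 h.2
  · intro i j
    have h3 : ∀ ω, Matrix.of (S.stateCPU p P ω).1 * Matrix.of (S.stateCPU p P ω).2 =
        (Real.sqrt p.ρt : ℂ) • S.D p P ω := fun ω => noiseCPU_mul_factorCPU p ω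
    simp_rw [h3]
    exact memLp_matrix_smul _ (memLp_D p hS) i j
  · rintro i (l | l)
    · exact memLp_matrix_smul _ (memLp_FJc p hS) i l
    · exact memLp_combiner p hS i l
  · rintro (l | l) j
    · exact memLp_const _
    · exact (memLp_matrix_mul_const (memLp_B p hS l.1) _ l.2 j).const_mul _

end Signals


/-! ### Effective channels in terms of conditional expectations -/

namespace IsFadingChannel

variable {Ω 𝓣 E : Type*} [MeasurableSpace Ω] [MeasurableSpace 𝓣] [MeasurableSpace E]
  [StandardBorelSpace E] [Nonempty E]
  {ι κ : Type*} [Fintype ι] [Fintype κ] [DecidableEq ι] [DecidableEq κ] {n T : ℕ}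
  {P : Measure Ω} [IsProbabilityMeasure P] {Θ : Ω → 𝓣} {Z : Ω → E}
  {A : E → Matrix ι (Fin n) ℂ} {G : E → Matrix ι κ ℂ} {R : E → Matrix κ (Fin n) ℂ}
  {x : Fin T → Ω → Fin n → ℂ} {v : Fin T → Ω → κ → ℂ} (h : IsFadingChannel P Θ Z A G R x v)
  {r : ℝ} {C : Ω → Matrix ι (Fin n) ℂ} {K : Ω → Matrix ι ι ℂ}
include h

lemma ae_smul_matCondExp (hC : ∀ ω, A (Z ω) = (Real.sqrt r : ℂ) • C ω) : ∀ᵐ ω ∂P,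
    (Real.sqrt r : ℂ) • matCondExp P Θ C ω = effChannel P Θ Z A (Θ ω) := by
  filter_upwards [h.ae_matCondExp_signal, matCondExp_smul (P := P) (Θ := Θ) (X := C)
    (Real.sqrt r : ℂ)] with ω h1 h2
  rw [← h1, ← h2]
  simp_rw [hC]

/-- Matches the covariance formulas, where the power `r` stands outside the conditional
expectations, with the abstract covariance, whose signal channel carries `√r`. -/
lemma ae_smul_add_sub_smul (hr : 0 ≤ r) (hC : ∀ ω, A (Z ω) = (Real.sqrt r : ℂ) • C ω)
    (hK : ∀ ω, G (Z ω) * (G (Z ω))ᴴ = K ω) : ∀ᵐ ω ∂P,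
    (r : ℂ) • matCondExp P Θ (fun ω' => C ω' * (C ω')ᴴ) ω + matCondExp P Θ K ω -
      (r : ℂ) • (matCondExp P Θ C ω * (matCondExp P Θ C ω)ᴴ) =
      effCov P Θ Z A G (Θ ω) := by
  have hint1 := integrable_mul_conjTranspose h.memLp_signal
  have hint2 := integrable_mul_conjTranspose h.memLp_noise
  simp_rw [hC, Signals.smul_mul_conjTranspose_smul hr] at hint1
  simp_rw [hK] at hint2
  have h1 := h.ae_matCondExp_secondMoment
  simp_rw [hC, Signals.smul_mul_conjTranspose_smul hr, hK] at h1
  filter_upwards [h1, matCondExp_add (P := P) (Θ := Θ) hint1 hint2,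
    matCondExp_smul (P := P) (Θ := Θ) (X := fun ω' => C ω' * (C ω')ᴴ) (r : ℂ),
    matCondExp_smul (P := P) (Θ := Θ) (X := C) (Real.sqrt r : ℂ)] with ω h2 h3 h4 h5
  rw [← h2, h3, h4, h5, Signals.smul_mul_conjTranspose_smul hr]

end IsFadingChannel

lemma conjTranspose_smul_mul_mul_smul {ι κ : Type*} [Fintype ι] {r : ℝ} (hr : 0 ≤ r)
    (C : Matrix ι κ ℂ) (Q : Matrix ι ι ℂ) :
    ((Real.sqrt r : ℂ) • C)ᴴ * Q * ((Real.sqrt r : ℂ) • C) = (r : ℂ) • (Cᴴ * Q * C) := by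
  rw [Matrix.conjTranspose_smul, RCLike.star_def, Complex.conj_ofReal, Matrix.smul_mul,
    Matrix.smul_mul, Matrix.mul_smul, smul_smul, Signals.ofReal_sqrt_mul_self hr]

/-- The prelog factor is the number of data symbols divided by `τ`, the natural subtraction being
exact by `hle`; `log 2` converts nats to bits. -/
lemma ofReal_spectralEff_le {Ω : Type*} [MeasurableSpace Ω] {P : Measure Ω} {τ τr τt n : ℕ}
    {Υ : Ω → Matrix (Fin n) (Fin n) ℂ} {I : ℝ≥0∞} (hτ : 0 < τ) (hle : τt + τr ≤ τ)
    (h : ENNReal.ofReal ((τ - (τt + τr) : ℕ) * (Real.log 2 * ∫ ω, logDet (Υ ω) ∂P)) ≤ I) :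
    ENNReal.ofReal (spectralEff τ τr τt P Υ) ≤ I / ENNReal.ofReal (τ * Real.log 2) := by
  have hτ' : (0 : ℝ) < τ := Nat.cast_pos.2 hτ
  have hlog2 : 0 < Real.log 2 := Real.log_pos one_lt_two
  have he : spectralEff τ τr τt P Υ =
      ((τ - (τt + τr) : ℕ) * (Real.log 2 * ∫ ω, logDet (Υ ω) ∂P)) / (τ * Real.log 2) := by
    rw [spectralEff, Nat.cast_sub hle, Nat.cast_add]
    field_simp
  rw [he, ENNReal.ofReal_div_of_pos (by positivity)]
  gcongr

lemma ae_matCondExp_eq_matExp_of_indepFun {Ω 𝓣 : Type*} [MeasurableSpace Ω] [MeasurableSpace 𝓣]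
    {P : Measure Ω} [IsProbabilityMeasure P] {Θ : Ω → 𝓣} (hΘ : Measurable Θ) {E : Type*}
    [MeasurableSpace E] {Z : Ω → E} (hZ : Measurable Z) (hind : IndepFun Z Θ P)
    {ι κ : Type*} [Finite ι] [Finite κ] {B : E → Matrix ι κ ℂ}
    (hB : ∀ i j, Measurable fun e => B e i j) :
    ∀ᵐ ω ∂P, matCondExp P Θ (fun ω' => B (Z ω')) ω = matExp P fun ω' => B (Z ω') := by
  have h : ∀ᵐ ω ∂P, ∀ i j, (P[fun ω' => B (Z ω') i j | MeasurableSpace.comap Θ inferInstance]) ω =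
      ∫ ω', B (Z ω') i j ∂P := ae_all_iff.2 fun i => ae_all_iff.2 fun j =>
    condExp_indep_eq hZ.comap_le hΘ.comap_le
      ((hB i j).comp (comap_measurable Z)).stronglyMeasurable hind
  filter_upwards [h] with ω hω
  ext i j
  exact hω i j

namespace Signals

variable {Ω 𝓣 : Type*} [MeasurableSpace Ω] [MeasurableSpace 𝓣] {M N Nt Nr τ τr τt : ℕ}
  {S : Signals Ω M N Nt Nr τ τr τt} (p : SystemParams M N Nt Nr τ τr τt) {P : Measure Ω}
  [IsProbabilityMeasure P] {Θ : Ω → 𝓣}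

/-! #### The untrusted receiver -/

section UR

/-- The Gram matrix of the noise channel is `I` plus the jamming term, the identity being the
receiver noise. -/
lemma ae_PsiR_eq_effCov (hS : S.IsModel P) (hΘ : S.IsSideInfo P Θ) : ∀ᵐ ω ∂P,
    S.PsiR p P Θ ω = IsFadingChannel.effCov P Θ (S.stateUR p) (signalUR p) (noiseUR p) (Θ ω) := by
  have hK : ∀ ω, noiseUR p (S.stateUR p ω) * (noiseUR p (S.stateUR p ω))ᴴ =
      1 + (p.ρJ : ℂ) • (S.FJr p ω * (S.FJr p ω)ᴴ) := fun ω => by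
    have h2 : Matrix.of (S.stateUR p ω).1 = S.FJr p ω := rfl
    rw [noiseUR, Matrix.conjTranspose_fromCols_eq_fromRows_conjTranspose,
      Matrix.fromCols_mul_fromRows, Signals.smul_mul_conjTranspose_smul p.ρJ_nonneg, h2,
      Matrix.conjTranspose_one, Matrix.one_mul, add_comm]
  have hC : ∀ ω, signalUR p (S.stateUR p ω) = (Real.sqrt p.ρt : ℂ) • (S.A p ω * p.lamSqrt) :=
    fun ω => rfl
  have hA : ∀ ω, S.A p ω * p.lamSqrt * (S.A p ω * p.lamSqrt)ᴴ = S.A p ω * p.Lam * (S.A p ω)ᴴ :=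
    fun ω => by
      rw [Matrix.conjTranspose_mul, lamSqrt_conjTranspose, ← lamSqrt_mul_lamSqrt]
      simp only [Matrix.mul_assoc]
  have h1 := (isFadingChannel_UR p hS hΘ).ae_smul_add_sub_smul p.ρt_nonneg hC hK
  simp_rw [hA] at h1
  filter_upwards [h1, matCondExp_add (P := P) (Θ := Θ)
    (X := fun _ => (1 : Matrix (Fin Nr) (Fin Nr) ℂ)) (fun _ _ => integrable_const _)
    (fun i j => (integrable_mul_conjTranspose (memLp_FJr p hS) i j).const_mul (p.ρJ : ℂ)),
    matCondExp_smul (P := P) (Θ := Θ) (X := fun ω' => S.FJr p ω' * (S.FJr p ω')ᴴ) (p.ρJ : ℂ)]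
    with ω h2 h3 h4
  rw [← h2, PsiR, PsiRWith]
  refine congrArg (· - _) ((add_comm _ _).trans (congrArg (HAdd.hAdd _) ?_))
  refine Eq.trans ?_ h3.symm
  rw [matCondExp_const hΘ.measurable]
  exact congrArg (1 + ·) h4.symm

lemma ae_UpsilonR_eq (hS : S.IsModel P) (hΘ : S.IsSideInfo P Θ) : ∀ᵐ ω ∂P,
    S.UpsilonR p P Θ ω = (S.HR p P Θ ω)ᴴ * (S.PsiR p P Θ ω)⁻¹ * S.HR p P Θ ω := by
  have hT : ∀ ω, (S.A p ω * p.lamSqrt)ᴴ = p.lamSqrt * (S.A p ω)ᴴ := fun ω => by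
    rw [Matrix.conjTranspose_mul, lamSqrt_conjTranspose]
  have h1 := matCondExp_conjTranspose (P := P) hΘ.measurable
    (measurable_matrix_mul_const (measurable_A p hS.train_measurable) p.lamSqrt)
    fun i j => (memLp_matrix_mul_const (memLp_A p hS) p.lamSqrt i j).integrable one_le_two
  simp_rw [hT] at h1
  filter_upwards [h1] with ω h2
  rw [UpsilonR, HR, conjTranspose_smul_mul_mul_smul p.ρt_nonneg, h2]

lemma achievable_UR (hS : S.IsModel P) (hΘ : S.IsSideInfo P Θ) (σ : Equiv.Perm (Fin Nr)) :
    (∀ᵐ ω ∂P, (S.PsiR p P Θ ω).PosDef) ∧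
      (IndepFun (fun ω i j => S.FJr p ω i j) Θ P → ∀ᵐ ω ∂P, S.PsiR p P Θ ω =
        S.PsiRWith p P Θ (matExp P fun ω' => S.FJr p ω' * (S.FJr p ω')ᴴ) ω) ∧
      Integrable (fun ω => logDet (S.UpsilonR p P Θ ω)) P ∧
      (∀ᵐ ω ∂P, logDet (S.UpsilonR p P Θ ω) =
        ∑ k, Real.logb 2 (1 + sicSINR (S.HR p P Θ ω) (S.PsiR p P Θ ω) σ k)) ∧
      ENNReal.ofReal (spectralEff τ τr τt P (S.UpsilonR p P Θ)) ≤
        S.sicRate P Θ (S.yUR p) (S.HR p P Θ) (S.PsiR p P Θ) σ ∧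
      ENNReal.ofReal (spectralEff τ τr τt P (S.UpsilonR p P Θ)) ≤ S.jointRate P Θ (S.yUR p) := by
  have h := isFadingChannel_UR p hS hΘ
  have hΨ := ae_PsiR_eq_effCov p hS hΘ
  have hpos : ∀ᵐ ω ∂P, (S.PsiR p P Θ ω).PosDef := by
    filter_upwards [hΨ, h.ae_effCov_posDef (sum_norm_sq_le_noiseUR p)] with ω h1 h2
    rwa [h1]
  obtain ⟨-, hint, hsinr, hsic, hjoint⟩ := h.achievable
    (H := S.HR p P Θ) (h.ae_smul_matCondExp fun _ => rfl) hΨ (ae_UpsilonR_eq p hS hΘ) σ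
  simp_rw [received_UR] at hsic hjoint
  refine ⟨hpos, fun hind => ?_, hint, ?_, ofReal_spectralEff_le p.coherence_pos p.training_le hsic,
    ofReal_spectralEff_le p.coherence_pos p.training_le hjoint⟩
  · have hof : ∀ i j, Measurable fun e : Fin Nr → Fin Nr → ℂ => Matrix.of e i j := fun i j => by
      simp only [Matrix.of_apply]
      fun_prop
    have h1 := ae_matCondExp_eq_matExp_of_indepFun hΘ.measurable
      (measurable_pi_lambda _ fun i => measurable_pi_lambda _ fun j =>
        measurable_FJr p hS.train_measurable i j) hind
      (B := fun e : Fin Nr → Fin Nr → ℂ => Matrix.of e * (Matrix.of e)ᴴ)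
      (measurable_matrix_mul hof (measurable_matrix_conjTranspose hof))
    filter_upwards [h1] with ω h2
    exact congrArg (fun J => S.PsiRWith p P Θ J ω) h2
  · filter_upwards [hpos, hsinr] with ω h1 h2
    exact h2 h1.isUnit

end UR

/-! #### The central processing unit -/

section CPU

lemma ae_conjTranspose_D (hS : S.IsModel P) (hΘ : S.IsSideInfo P Θ) : ∀ᵐ ω ∂P,
    matCondExp P Θ (fun ω' => (S.D p P ω')ᴴ) ω = (matCondExp P Θ (S.D p P) ω)ᴴ :=
  matCondExp_conjTranspose (P := P) hΘ.measurable
    (measurable_matrix_sum _ fun m => measurable_matrix_smul _ (measurable_matrix_mul_const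
      (measurable_matrix_mul (measurable_matrix_conjTranspose
        (measurable_V p P hS.train_measurable m)) (measurable_B p hS.train_measurable m)) _))
    fun i j => (memLp_D p hS i j).integrable one_le_two

/-- Here the Gram matrix of the noise channel has only the jamming and combiner terms, with no
identity block; hence semidefiniteness is all that can be concluded. -/
lemma ae_PsiC_eq_effCov (hS : S.IsModel P) (hΘ : S.IsSideInfo P Θ) : ∀ᵐ ω ∂P,
    S.PsiC p P Θ ω = IsFadingChannel.effCov P Θ (S.stateCPU p P)
      (fun e => Matrix.of e.1 * Matrix.of e.2) (fun e => Matrix.of e.1) (Θ ω) := by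
  have h1 := (isFadingChannel_CPU p hS hΘ).ae_smul_add_sub_smul p.ρt_nonneg
    (noiseCPU_mul_factorCPU p) (noiseCPU_mul_conjTranspose p)
  have hint1 := integrable_mul_conjTranspose (memLp_FJc p hS)
  simp_rw [FJc_mul_conjTranspose] at hint1
  have hint2 := integrable_mul_conjTranspose (memLp_combiner p hS)
  simp_rw [combiner_mul_conjTranspose] at hint2
  filter_upwards [h1, ae_conjTranspose_D p hS hΘ, matCondExp_add (P := P) (Θ := Θ)
    (fun i j => (hint1 i j).const_mul (p.ρJ : ℂ)) hint2, matCondExp_smul (P := P) (Θ := Θ)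
    (X := fun ω => ∑ m, ∑ l, (p.α m * p.α l : ℂ) •
      ((S.V p P m ω)ᴴ * S.FJ p m ω * (S.FJ p l ω)ᴴ * S.V p P l ω)) (p.ρJ : ℂ)] with ω h2 h3 h4 h5
  rw [← h2, PsiC, h3]
  refine congrArg (· - _) ?_
  refine Eq.trans ?_ (congrArg (_ + ·) h4.symm)
  rw [add_comm (_ • _) (_ • _), add_assoc]
  exact congrArg (fun X => _ + (X + _)) h5.symm

lemma achievable_CPU (hS : S.IsModel P) (hΘ : S.IsSideInfo P Θ) (σ : Equiv.Perm (Fin Nr)) :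
    (∀ᵐ ω ∂P, (S.PsiC p P Θ ω).PosSemidef) ∧
      Integrable (fun ω => logDet (S.UpsilonC p P Θ ω)) P ∧
      (∀ᵐ ω ∂P, IsUnit (S.PsiC p P Θ ω) → logDet (S.UpsilonC p P Θ ω) =
        ∑ k, Real.logb 2 (1 + sicSINR (S.HC p P Θ ω) (S.PsiC p P Θ ω) σ k)) ∧
      ENNReal.ofReal (spectralEff τ τr τt P (S.UpsilonC p P Θ)) ≤
        S.sicRate P Θ (S.zCPU p P) (S.HC p P Θ) (S.PsiC p P Θ) σ ∧
      ENNReal.ofReal (spectralEff τ τr τt P (S.UpsilonC p P Θ)) ≤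
        S.jointRate P Θ (S.zCPU p P) := by
  have h := isFadingChannel_CPU p hS hΘ
  have hΥ : ∀ᵐ ω ∂P,
      S.UpsilonC p P Θ ω = (S.HC p P Θ ω)ᴴ * (S.PsiC p P Θ ω)⁻¹ * S.HC p P Θ ω := by
    filter_upwards [ae_conjTranspose_D p hS hΘ] with ω h1
    rw [UpsilonC, HC, conjTranspose_smul_mul_mul_smul p.ρt_nonneg, h1]
  obtain ⟨hpsd, hint, hsinr, hsic, hjoint⟩ := h.achievable (H := S.HC p P Θ)
    (h.ae_smul_matCondExp (noiseCPU_mul_factorCPU p)) (ae_PsiC_eq_effCov p hS hΘ) hΥ σ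
  simp_rw [received_CPU] at hsic hjoint
  exact ⟨hpsd, hint, hsinr, ofReal_spectralEff_le p.coherence_pos p.training_le hsic,
    ofReal_spectralEff_le p.coherence_pos p.training_le hjoint⟩

end CPU

end Signals

end
theorem proposition4 {Ω : Type*} [MeasurableSpace Ω] (P : Measure Ω) [IsProbabilityMeasure P]
    {M N Nt Nr τ τr τt : ℕ} (p : SystemParams M N Nt Nr τ τr τt)
    (S : Signals Ω M N Nt Nr τ τr τt) (hS : S.IsModel P)
    {𝓣r 𝓣c : Type*} [MeasurableSpace 𝓣r] [MeasurableSpace 𝓣c]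
    (Θr : Ω → 𝓣r) (Θc : Ω → 𝓣c) (hΘr : S.IsSideInfo P Θr) (hΘc : S.IsSideInfo P Θc)
    (σ : Equiv.Perm (Fin Nr)) :
    -- the untrusted receiver
    ((∀ᵐ ω ∂P, (S.PsiR p P Θr ω).PosDef) ∧
      (IndepFun (fun ω i j => S.FJr p ω i j) Θr P → ∀ᵐ ω ∂P, S.PsiR p P Θr ω =
        S.PsiRWith p P Θr (matExp P fun ω' => S.FJr p ω' * (S.FJr p ω')ᴴ) ω) ∧
      Integrable (fun ω => logDet (S.UpsilonR p P Θr ω)) P ∧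
      (∀ᵐ ω ∂P, logDet (S.UpsilonR p P Θr ω) =
        ∑ k, Real.logb 2 (1 + sicSINR (S.HR p P Θr ω) (S.PsiR p P Θr ω) σ k)) ∧
      ENNReal.ofReal (spectralEff τ τr τt P (S.UpsilonR p P Θr)) ≤
        S.sicRate P Θr (S.yUR p) (S.HR p P Θr) (S.PsiR p P Θr) σ ∧
      ENNReal.ofReal (spectralEff τ τr τt P (S.UpsilonR p P Θr)) ≤
        S.jointRate P Θr (S.yUR p)) ∧
    -- the central processing unit
    ((∀ᵐ ω ∂P, (S.PsiC p P Θc ω).PosSemidef) ∧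
      Integrable (fun ω => logDet (S.UpsilonC p P Θc ω)) P ∧
      (∀ᵐ ω ∂P, IsUnit (S.PsiC p P Θc ω) → logDet (S.UpsilonC p P Θc ω) =
        ∑ k, Real.logb 2 (1 + sicSINR (S.HC p P Θc ω) (S.PsiC p P Θc ω) σ k)) ∧
      ENNReal.ofReal (spectralEff τ τr τt P (S.UpsilonC p P Θc)) ≤
        S.sicRate P Θc (S.zCPU p P) (S.HC p P Θc) (S.PsiC p P Θc) σ ∧
      ENNReal.ofReal (spectralEff τ τr τt P (S.UpsilonC p P Θc)) ≤
        S.jointRate P Θc (S.zCPU p P)) := by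
  exact ⟨Signals.achievable_UR p hS hΘr σ, Signals.achievable_CPU p hS hΘc σ⟩
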